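/- Let $(W,\mathcal S)$ be a finite Coxeter system with length function $\ell$, longest element $w_\circ$ and $N=\ell(w_\circ)$. Let $\mathrm c=\mathrm s_1\cdots \mathrm s_n$ be a word containing every simple reflection exactly once (a word for a Coxeter element $c=s_1\cdots s_n$), and let $m\ge 0$. Let $\mathrm w_\circ(\mathrm c)$ be the $c$-sorting word of $w_\circ$, i.e. the lexicographically first subword (by positions) of $\mathrm c^\infty=\mathrm c\,\mathrm c\,\mathrm c\cdots$ that is a reduced word for $w_\circ$; let $\widetilde{\mathrm w}_\circ(\mathrm c)$ be obtained from it by replacing each letter $s$ by $w_\circ s w_\circ^{-1}\in\mathcal S$; and let $\mathrm w_\circ^m(\mathrm c)=\mathrm w_\circ(\mathrm c)\,\widetilde{\mathrm w}_\circ(\mathrm c)\,\mathrm w_\circ(\mathrm c)\cdots$ ($m$ factors, alternating). For a word $\mathrm Q$ in $\mathcal S$, $w\in W$ and $a\ge 0$, let $\mathrm{Sub}(\mathrm Q,w,a)$ be the simplicial complex on the positions of $\mathrm Q$ whose facets are the sets of positions whose complement spells a word of length $a$ for $w$. A finite simplicial complex is called vertex-decomposable if it is pure and either equals $\{\emptyset\}$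 or has a vertex whose deletion and link are both vertex-decomposable. (1) For every initial segment $\mathrm Q=\mathrm q_1\cdots \mathrm q_p$ of $\mathrm w_\circ^m(\mathrm c)$, with $w=q_1\cdots q_p\in W$, the subword complex $\mathrm{Sub}(\mathrm c\mathrm Q,w,p)$ is vertex-decomposable. (2) In particular, the $m$-eralized $c$-cluster complex $\mathsf{Asso}^{(m)}(W,c)=\mathrm{Sub}(\mathrm c\,\mathrm w_\circ^m(\mathrm c),w_\circ^m,mN)$ is vertex-decomposable. (3) The lexicographic order on the facets of $\mathsf{Asso}^{(m)}(W,c)$ (each facet being read as its increasing list of positions in $\mathrm c\,\mathrm w_\circ^m(\mathrm c)$) is a shelling order. -/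

import Mathlib

/-! ### Simplicial complexes -/

/-- A simplicial complex on vertices in `α`, with the empty face included: a family of finite sets
that is closed under taking subsets. So `⊥` has no face at all, and `LowerSet.Iic ∅` is `{∅}`. -/
abbrev FaceComplex (α : Type*) := LowerSet (Finset α)

namespace FaceComplex

variable {α : Type*}

/-- The facets are the inclusion-maximal faces. -/
def facets (Δ : FaceComplex α) : Set (Finset α) :=
  {F | Maximal (· ∈ Δ) F}

/-- All facets have the same number of vertices. -/
def IsPure (Δ : FaceComplex α) : Prop :=
  ∀ F ∈ Δ.facets, ∀ G ∈ Δ.facets, F.card = G.card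

/-- The deletion of `v`: all faces that do not contain `v`. -/
def deletion (Δ : FaceComplex α) (v : α) : FaceComplex α where
  carrier := {F | F ∈ Δ ∧ v ∉ F}
  lower' := fun _ _ hle h => ⟨Δ.lower hle h.1, fun hv => h.2 (hle hv)⟩

/-- The link of `v`: all faces `F` with `v ∉ F` such that `F ∪ {v}` is a face. -/
def link [DecidableEq α] (Δ : FaceComplex α) (v : α) : FaceComplex α where
  carrier := {F | v ∉ F ∧ insert v F ∈ Δ}
  lower' := fun _ _ hle h =>
    ⟨fun hv => h.1 (hle hv), Δ.lower (Finset.insert_subset_insert v hle) h.2⟩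

/-- Vertex-decomposability: `Δ` is pure, and either `Δ = {∅}`, or for some vertex `v` of `Δ` both
the deletion and the link of `v` are vertex-decomposable. -/
inductive VertexDecomposable [DecidableEq α] : FaceComplex α → Prop
  | singleton_empty : VertexDecomposable (LowerSet.Iic ∅)
  | step (Δ : FaceComplex α) (v : α) (pure : Δ.IsPure) (vertex : {v} ∈ Δ)
      (deletion : VertexDecomposable (Δ.deletion v)) (link : VertexDecomposable (Δ.link v)) :
      VertexDecomposable Δ

/-- The relation `r` ("comes strictly before") is a shelling order of `Δ`: `Δ` has finitely many
facets, `r` is a strict total order on them, and for every facet `G` the faces of `G` that lie in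
an earlier facet form a complex that is pure of codimension one in `G`, that is, each intersection
`F ∩ G` with an earlier facet `F` is contained in some `H ∩ G = G \ {v}` with `H` an
earlier facet and `v ∈ G`. -/
structure IsShellingOrder [DecidableEq α] (Δ : FaceComplex α)
    (r : Finset α → Finset α → Prop) : Prop where
  finite : Δ.facets.Finite
  irrefl : ∀ F ∈ Δ.facets, ¬ r F F
  trans : ∀ F ∈ Δ.facets, ∀ G ∈ Δ.facets, ∀ H ∈ Δ.facets, r F G → r G H → r F H
  total : ∀ F ∈ Δ.facets, ∀ G ∈ Δ.facets, F ≠ G → r F G ∨ r G F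
  shelling : ∀ F ∈ Δ.facets, ∀ G ∈ Δ.facets, r F G →
    ∃ H ∈ Δ.facets, r H G ∧ ∃ v ∈ G, F ∩ G ⊆ G.erase v ∧ H ∩ G = G.erase v

/-- The lexicographic order on sets of positions: the increasing lists of their elements are
compared lexicographically. -/
def lexLT {k : ℕ} (F G : Finset (Fin k)) : Prop :=
  F.sort (· ≤ ·) < G.sort (· ≤ ·)

end FaceComplex

/-! ### Coxeter elements and sorting words -/

namespace CoxeterSystem

variable {B W : Type*} [Group W] {M : CoxeterMatrix B} (cs : CoxeterSystem M W)

/-- A word `s₁ ⋯ sₙ` for a (standard) Coxeter element: every simple reflection occurs in it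
exactly once. -/
def IsCoxeterWord (c : List B) : Prop :=
  c.Nodup ∧ ∀ i, i ∈ c

/-- The letter at position `k` (counted from `0`) of the infinite word `c^∞ = c c c ⋯`. It is
`none` only if `c` is empty. -/
def infiniteLetter (c : List B) (k : ℕ) : Option B :=
  getElem? c (k % c.length)

/-- The positions `f` form a subword of `c^∞` that spells the word `ω`, and `ω` is a reduced
word for `w`. -/
def IsReducedSubword (c : List B) (w : W) (f : Fin (cs.length w) → ℕ) (ω : List B) : Prop :=
  StrictMono f ∧ ω.map some = List.ofFn (fun j => infiniteLetter c (f j)) ∧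
    cs.IsReduced ω ∧ cs.wordProd ω = w

/-- `ω` is the `c`-sorting word of `w`: the lexicographically first subword of `c^∞` that is a
reduced word for `w`. -/
def IsSortingWord (c : List B) (w : W) (ω : List B) : Prop :=
  ∃ f : Fin (cs.length w) → ℕ, cs.IsReducedSubword c w f ω ∧
    ∀ f' ω', cs.IsReducedSubword c w f' ω' → toLex f ≤ toLex f'

theorem exists_isSortingWord {c : List B} (hc : IsCoxeterWord c) (w : W) :
    ∃ ω, cs.IsSortingWord c w ω := by
  classical
  obtain ⟨ω, hred, hw⟩ := cs.exists_isReduced w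
  have hlen : cs.length w = ω.length := by rw [hw]; exact hred
  let S : Set (Lex (Fin (cs.length w) → ℕ)) :=
    {f | ∃ ω, cs.IsReducedSubword c w (ofLex f) ω}
  have hS : S.Nonempty := by
    have hidx (j : Fin (cs.length w)) : c.idxOf (ω.get (j.cast hlen)) < c.length :=
      List.idxOf_lt_length_iff.2 (hc.2 _)
    refine ⟨toLex fun j => c.length * j + c.idxOf (ω.get (j.cast hlen)), ω, ?_, ?_, hred, hw.symm⟩
    · intro i j hij
      have h1 := hidx i
      have h2 : c.length * (i + 1) ≤ c.length * j := Nat.mul_le_mul_left _ hij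
      simp only [ofLex_toLex]
      rw [Nat.mul_add] at h2
      omega
    · apply List.ext_getElem
      · simp [hlen]
      · intro k h1 h2
        have hk : k < cs.length w := by simpa using h2
        have h3 := hidx ⟨k, hk⟩
        simp only [Fin.cast_mk, List.get_eq_getElem] at h3
        simp only [List.getElem_map, List.getElem_ofFn, infiniteLetter, ofLex_toLex,
          Fin.cast_mk, List.get_eq_getElem, Nat.mul_add_mod, Nat.mod_eq_of_lt h3]
        rw [List.getElem?_eq_getElem h3, List.getElem_idxOf]
  obtain ⟨f, ⟨ω', hf⟩, hmin⟩ := WellFounded.has_min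
    (wellFounded_lt (α := Lex (Fin (cs.length w) → ℕ))) S hS
  exact ⟨ω', ofLex f, hf, fun f' ω'' h' => not_lt.1 (hmin (toLex f') ⟨ω'', h'⟩)⟩

/-- The `c`-sorting word of `w`. -/
noncomputable def sortingWord {c : List B} (hc : IsCoxeterWord c) (w : W) : List B :=
  (cs.exists_isSortingWord hc w).choose

/-- The longest element `w_∘` of a finite Coxeter group. -/
noncomputable def longest [Finite W] : W :=
  (Finite.exists_max cs.length).choose

/-- Conjugation by `w_∘` on the letters: `i` is sent to the `j` with `s_j = w_∘ s_i w_∘⁻¹`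
(the conjugate of a simple reflection by `w_∘` is again a simple reflection). -/
noncomputable def conjLongest [Finite W] (i : B) : B :=
  haveI : Nonempty B := ⟨i⟩
  Function.invFun cs.simple (cs.longest * cs.simple i * cs.longest⁻¹)

/-- The word `w_∘^m(c) = w_∘(c) w̃_∘(c) w_∘(c) ⋯` with `m` factors, alternating between the
`c`-sorting word of `w_∘` and its letterwise conjugate by `w_∘`. -/
noncomputable def longestPowWord [Finite W] {c : List B} (hc : IsCoxeterWord c) (m : ℕ) : List B :=
  (List.range m).flatMap fun k =>
    if Even k then cs.sortingWord hc cs.longest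
    else (cs.sortingWord hc cs.longest).map cs.conjLongest

/-! ### Subword complexes -/

/-- The word that is left of `Q` after the letters at the positions in `F` are removed. -/
def complementWord (Q : List B) (F : Finset (Fin Q.length)) : List B :=
  ((List.finRange Q.length).filter (· ∉ F)).map Q.get

/-- The subword complex `Sub(Q, w, a)`, on the positions of `Q`: its facets are the sets of
positions whose complement is a word for `w` of length `a`. -/
def subwordComplex (Q : List B) (w : W) (a : ℕ) : FaceComplex (Fin Q.length) :=
  lowerClosure {F | (complementWord Q F).length = a ∧ cs.wordProd (complementWord Q F) = w}

/-- The `m`-eralized `c`-cluster complex `Asso^(m)(W, c) = Sub(c w_∘^m(c), w_∘^m, m N)`, where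
`N` is the length of `w_∘`. -/
noncomputable def clusterComplex [Finite W] {c : List B} (hc : IsCoxeterWord c) (m : ℕ) :
    FaceComplex (Fin (c ++ cs.longestPowWord hc m).length) :=
  cs.subwordComplex (c ++ cs.longestPowWord hc m) (cs.longest ^ m) (m * cs.length cs.longest)

end CoxeterSystem

/-! ### Complexes of exceptional sets -/

namespace FaceComplex

variable {α : Type*}

/-! Write `n` for the length of `c`. Deleting positions from the word `c Q` multiplies its value `c
w` on the left by the corresponding reflections of the left inversion sequence, in increasing order.
So the facets of the subword complex are the `n`-element sets of positions whose reflections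
multiply to `c⁻¹`.

Let `E` be the Euler form of `c`, determined by `E (x - c x) y = ⟨x, y⟩`; its symmetrization is the
invariant inner product. A product of `n` reflections is `c⁻¹` exactly when their normal vectors `η
i` satisfy `E (η j) (η i) = 0` for `i < j` (`prod_eq_inv_iff_isExceptional`). Facets thus become
exceptional sets, as for representations of quivers.

This description is recursive: removing the largest position `l` of an exceptional set in `U` leaves
an exceptional set in `U ⊓ ker E (η l)`. Hence the link of the largest position has the same shape,
and what is needed for its deletion is `ExchangeProperty`: the largest position can be replaced by a
smaller one whenever some exceptional set in `U` uses smaller positions only. The same property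
gives the lexicographic shelling (`isShellingOrder_lexLT`).

For the exchange (`exchangeProperty`), the root at `l` is moved leftwards past the other members of
the exceptional set, by reflections that keep it compatible with them. If it ever agrees up to sign
with the root at an unused position that it passes, that position is the replacement. Otherwise it
arrives at the far left as a positive root, and the signs of `E` on the sorted list of roots
contradict the existence of the second exceptional set.

Those signs come from the roots along `c^∞`. On the first `n` of them `E` reads off a coefficient
(`eulerForm_cyclicRoot_of_lt`), and invariance of `E` under `c` carries this to the later ones. The
roots skipped by the greedy word are orthogonal to the later roots that are kept
(`IsSortingPosition.innerForm_eq_zero`), so the `c`-sorting word of `w_∘` lists the positive roots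
in the order of `c^∞` (`sortingWord_longest`). -/

theorem facets_lowerClosure_of_card {S : Set (Finset α)} {d : ℕ} (hS : ∀ F ∈ S, F.card = d) :
    facets (lowerClosure S) = S := by
  ext F
  constructor
  · rintro ⟨⟨G, hG, hFG⟩, hmax⟩
    have : G ≤ F := hmax (subset_lowerClosure hG) hFG
    rwa [le_antisymm hFG this]
  · intro hF
    refine ⟨subset_lowerClosure hF, ?_⟩
    rintro G ⟨H, hH, hGH⟩ hFG
    have : F = H := Finset.eq_of_subset_of_card_le (hFG.trans hGH) (by rw [hS F hF, hS H hH])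
    exact this ▸ hGH

end FaceComplex

/-- The vectors `η i`, `i ∈ G`, lie in `U`, are as many as the dimension of `U`, and their Gram
matrix with respect to the bilinear form `E` is triangular. -/
structure IsExceptional {V ι : Type*} [AddCommGroup V] [Module ℝ V] [LinearOrder ι]
    (E : LinearMap.BilinForm ℝ V) (η : ι → V) (U : Submodule ℝ V) (G : Finset ι) : Prop where
  mem : ∀ i ∈ G, η i ∈ U
  triangular : ∀ i ∈ G, ∀ j ∈ G, i < j → E (η j) (η i) = 0
  card_eq : G.card = Module.finrank ℝ U

/-- The largest element of an exceptional set can be exchanged for a smaller one, as soon as there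
is an exceptional set of smaller elements. -/
def ExchangeProperty {V ι : Type*} [AddCommGroup V] [Module ℝ V] [LinearOrder ι]
    (E : LinearMap.BilinForm ℝ V) (η : ι → V) : Prop :=
  ∀ (U : Submodule ℝ V) (G G' : Finset ι) (l : ι), IsExceptional E η U G →
    IsExceptional E η U G' → l ∈ G → (∀ i ∈ G, i ≤ l) → (∀ i ∈ G', i < l) →
    ∃ x < l, x ∉ G ∧ IsExceptional E η U (insert x (G.erase l))

namespace IsExceptional

variable {V ι : Type*} [AddCommGroup V] [Module ℝ V] [LinearOrder ι]
  {E : LinearMap.BilinForm ℝ V} {η : ι → V}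

theorem finrank_inf_ker_add_one [FiniteDimensional ℝ V] {U : Submodule ℝ V} {v : V} (hv : v ∈ U)
    (hEv : E v v ≠ 0) :
    Module.finrank ℝ (U ⊓ LinearMap.ker (E v) : Submodule ℝ V) + 1 = Module.finrank ℝ U := by
  have h1 := LinearMap.finrank_range_add_finrank_ker ((E v).domRestrict U)
  have h2 : LinearMap.range ((E v).domRestrict U) = ⊤ := by
    refine LinearMap.range_eq_top.2 (LinearMap.surjective fun h => ?_)
    exact hEv (by simpa using congrArg (fun f => f ⟨v, hv⟩) h)
  have h3 : Module.finrank ℝ (LinearMap.ker ((E v).domRestrict U)) =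
      Module.finrank ℝ (U ⊓ LinearMap.ker (E v) : Submodule ℝ V) := by
    have : (LinearMap.ker ((E v).domRestrict U)).map U.subtype = U ⊓ LinearMap.ker (E v) := by
      ext x
      simp only [Submodule.mem_map, LinearMap.mem_ker, LinearMap.domRestrict_apply,
        Submodule.mem_inf]
      constructor
      · rintro ⟨y, hy, rfl⟩
        exact ⟨y.2, hy⟩
      · rintro ⟨hx, hx'⟩
        exact ⟨⟨x, hx⟩, hx', rfl⟩
    rw [← this]
    exact (LinearEquiv.finrank_eq (Submodule.equivMapOfInjective _ U.injective_subtype _))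
  rw [h2, finrank_top, Module.finrank_self, h3] at h1
  omega

/-- Triangularity against the largest index is membership in `ker E (η l)`. Together with
`insert_top` this identifies the link of the largest position with a complex of the same kind. -/
theorem erase_top [FiniteDimensional ℝ V] {U : Submodule ℝ V} {G : Finset ι}
    (h : IsExceptional E η U G) {l : ι} (hl : l ∈ G) (hmax : ∀ i ∈ G, i ≤ l)
    (hη : E (η l) (η l) ≠ 0) :
    IsExceptional E η (U ⊓ LinearMap.ker (E (η l))) (G.erase l) where
  mem i hi := by
    obtain ⟨hil, hi⟩ := Finset.mem_erase.1 hi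
    exact ⟨h.mem i hi, h.triangular i hi l hl (lt_of_le_of_ne (hmax i hi) hil)⟩
  triangular i hi j hj := h.triangular i (Finset.mem_of_mem_erase hi) j (Finset.mem_of_mem_erase hj)
  card_eq := by
    have := finrank_inf_ker_add_one (h.mem l hl) hη
    rw [Finset.card_erase_of_mem hl, h.card_eq]
    omega

theorem insert_top [FiniteDimensional ℝ V] {U : Submodule ℝ V} {G : Finset ι} {l : ι}
    (h : IsExceptional E η (U ⊓ LinearMap.ker (E (η l))) G) (hl : ∀ i ∈ G, i < l)
    (hU : η l ∈ U) (hη : E (η l) (η l) ≠ 0) :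
    IsExceptional E η U (insert l G) where
  mem i hi := by
    rcases Finset.mem_insert.1 hi with rfl | hi
    · exact hU
    · exact (h.mem i hi).1
  triangular i hi j hj hij := by
    rcases Finset.mem_insert.1 hi with rfl | hi'
    · rcases Finset.mem_insert.1 hj with rfl | hj'
      · exact absurd hij (lt_irrefl _)
      · exact absurd (hij.trans (hl j hj')) (lt_irrefl _)
    · rcases Finset.mem_insert.1 hj with rfl | hj'
      · exact (h.mem i hi').2
      · exact h.triangular i hi' j hj' hij
  card_eq := by
    rw [Finset.card_insert_of_notMem fun h' => lt_irrefl _ (hl l h'), h.card_eq,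
      finrank_inf_ker_add_one hU hη]

/-- In a linear relation, apply `E (η l)` for the largest `l` with nonzero coefficient: only the
term of `l` survives. -/
theorem linearIndepOn (hη : ∀ i, E (η i) (η i) ≠ 0) {U : Submodule ℝ V} {G : Finset ι}
    (h : IsExceptional E η U G) : LinearIndepOn ℝ η (G : Set ι) := by
  rw [linearIndepOn_finset_iff]
  intro f hf i hi
  by_contra hne
  have hne' : (G.filter fun j => f j ≠ 0).Nonempty := ⟨i, by simp [hi, hne]⟩
  obtain ⟨l, hl, hmax⟩ := Finset.exists_max_image _ id hne'
  obtain ⟨hlG, hfl⟩ := Finset.mem_filter.1 hl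
  have h1 : E (η l) (∑ j ∈ G, f j • η j) = f l * E (η l) (η l) := by
    rw [map_sum, Finset.sum_eq_single l]
    · simp
    · intro j hj hjl
      by_cases hfj : f j = 0
      · simp [hfj]
      · have := hmax j (Finset.mem_filter.2 ⟨hj, hfj⟩)
        simp [h.triangular j hj l hlG (lt_of_le_of_ne this hjl)]
    · exact fun h => absurd hlG h
  rw [hf, map_zero] at h1
  exact mul_ne_zero hfl (hη l) h1.symm

theorem span_eq [FiniteDimensional ℝ V] (hη : ∀ i, E (η i) (η i) ≠ 0) {U : Submodule ℝ V}
    {G : Finset ι} (h : IsExceptional E η U G) : Submodule.span ℝ (η '' G) = U := by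
  apply Submodule.eq_of_le_of_finrank_le
  · rw [Submodule.span_le]
    rintro _ ⟨i, hi, rfl⟩
    exact h.mem i hi
  · classical
    have h1 := finrank_span_finset_eq_card (R := ℝ) (s := G.image η)
      (by rw [Finset.coe_image]; exact (h.linearIndepOn hη).id_image)
    rw [Finset.coe_image, Finset.card_image_of_injOn (h.linearIndepOn hη).injOn] at h1
    rw [h1, ← h.card_eq]

/-- An exceptional set is a basis of `U`, so functionals can be tested on any one of them. Comparing
two exceptional sets in the same `U` rests on this. -/
theorem eq_zero_of_forall_mem [FiniteDimensional ℝ V] (hη : ∀ i, E (η i) (η i) ≠ 0)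
    {U : Submodule ℝ V} {G : Finset ι} (h : IsExceptional E η U G) {f : V →ₗ[ℝ] ℝ}
    (hf : ∀ i ∈ G, f (η i) = 0) {u : V} (hu : u ∈ U) : f u = 0 := by
  have : Submodule.span ℝ (η '' G) ≤ LinearMap.ker f := by
    rw [Submodule.span_le]
    rintro _ ⟨i, hi, rfl⟩
    exact hf i hi
  rw [h.span_eq hη] at this
  exact this hu

end IsExceptional

/-! ### Vertex decomposition at the largest position -/

section VertexDecomposable

open FaceComplex

variable {V : Type*} [AddCommGroup V] [Module ℝ V] [FiniteDimensional ℝ V]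
  {E : LinearMap.BilinForm ℝ V} {k : ℕ} {η : Fin k → V}

/-- The complex whose facets are the exceptional sets in `U` with elements less than `L`. -/
def exceptionalComplex (E : LinearMap.BilinForm ℝ V) (η : Fin k → V) (U : Submodule ℝ V) (L : ℕ) :
    FaceComplex (Fin k) :=
  lowerClosure {G | IsExceptional E η U G ∧ ∀ i ∈ G, (i : ℕ) < L}

theorem vertexDecomposable_exceptionalComplex (hη : ∀ i, E (η i) (η i) ≠ 0)
    (hex : ExchangeProperty E η) (L : ℕ) (hL : L ≤ k) (U : Submodule ℝ V)
    (hne : ∃ G, IsExceptional E η U G ∧ ∀ i ∈ G, (i : ℕ) < L) :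
    (exceptionalComplex E η U L).VertexDecomposable := by
  induction L generalizing U with
  | zero =>
    have hset : {G | IsExceptional E η U G ∧ ∀ i ∈ G, (i : ℕ) < 0} = {∅} := by
      obtain ⟨G, hG, hG0⟩ := hne
      have hempty (F : Finset (Fin k)) (hF : ∀ i ∈ F, (i : ℕ) < 0) : F = ∅ :=
        Finset.eq_empty_of_forall_notMem fun i hi => absurd (hF i hi) (by omega)
      ext F
      constructor
      · exact fun h => hempty F h.2
      · rintro rfl
        exact ⟨hempty G hG0 ▸ hG, by simp⟩
    rw [exceptionalComplex, hset, lowerClosure_singleton]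
    exact VertexDecomposable.singleton_empty
  | succ L ih =>
    let l : Fin k := ⟨L, hL⟩
    have hlt {G : Finset (Fin k)} (hG : ∀ i ∈ G, (i : ℕ) < L + 1) (hl : l ∉ G) :
        ∀ i ∈ G, (i : ℕ) < L := fun i hi => by
      have h1 := hG i hi
      have h2 : (i : ℕ) ≠ L := fun h => hl ((Fin.ext h : i = l) ▸ hi)
      omega
    by_cases hLG : ∃ G, (IsExceptional E η U G ∧ ∀ i ∈ G, (i : ℕ) < L + 1) ∧ l ∈ G
    · obtain ⟨G₀, ⟨hG₀, hG₀L⟩, hlG₀⟩ := hLG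
      have hlU : η l ∈ U := hG₀.mem l hlG₀
      have hle {G : Finset (Fin k)} (hG : ∀ i ∈ G, (i : ℕ) < L + 1) : ∀ i ∈ G, i ≤ l :=
        fun i hi => Nat.lt_succ_iff.1 (hG i hi)
      have herase {G : Finset (Fin k)} (hG : IsExceptional E η U G)
          (hGL : ∀ i ∈ G, (i : ℕ) < L + 1) (hl : l ∈ G) :
          IsExceptional E η (U ⊓ LinearMap.ker (E (η l))) (G.erase l) ∧
            ∀ i ∈ G.erase l, (i : ℕ) < L :=
        ⟨hG.erase_top hl (hle hGL) (hη l),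
          hlt (fun i hi => hGL i (Finset.mem_of_mem_erase hi)) (Finset.notMem_erase _ _)⟩
      have hinsert {G : Finset (Fin k)}
          (hG : IsExceptional E η (U ⊓ LinearMap.ker (E (η l))) G)
          (hGL : ∀ i ∈ G, (i : ℕ) < L) :
          IsExceptional E η U (insert l G) ∧ ∀ i ∈ insert l G, (i : ℕ) < L + 1 := by
        refine ⟨hG.insert_top (fun i hi => hGL i hi) hlU (hη l), fun i hi => ?_⟩
        rcases Finset.mem_insert.1 hi with rfl | hi
        · exact Nat.lt_succ_self L
        · exact (hGL i hi).trans (Nat.lt_succ_self L)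
      have hnot {G : Finset (Fin k)} (hGL : ∀ i ∈ G, (i : ℕ) < L) : l ∉ G :=
        fun h => lt_irrefl _ (hGL l h)
      have hlink : (exceptionalComplex E η U (L + 1)).link l =
          exceptionalComplex E η (U ⊓ LinearMap.ker (E (η l))) L := by
        ext F
        constructor
        · rintro ⟨hlF, G, ⟨hG, hGL⟩, hFG⟩
          have hlG : l ∈ G := hFG (Finset.mem_insert_self _ _)
          refine ⟨G.erase l, herase hG hGL hlG, fun i hi => ?_⟩
          exact Finset.mem_erase.2 ⟨fun h => hlF (h ▸ hi), hFG (Finset.mem_insert_of_mem hi)⟩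
        · rintro ⟨G, ⟨hG, hGL⟩, hFG⟩
          exact ⟨fun h => hnot hGL (hFG h), insert l G, hinsert hG hGL,
            Finset.insert_subset_insert l hFG⟩
      have hvd := ih (by omega) (U ⊓ LinearMap.ker (E (η l)))
        ⟨G₀.erase l, herase hG₀ hG₀L hlG₀⟩
      refine VertexDecomposable.step _ l ?_ ?_ ?_ (hlink ▸ hvd)
      · intro F hF G hG
        rw [exceptionalComplex, facets_lowerClosure_of_card fun F hF => hF.1.card_eq] at hF hG
        rw [hF.1.card_eq, hG.1.card_eq]
      · exact ⟨G₀, ⟨hG₀, hG₀L⟩, Finset.singleton_subset_iff.2 hlG₀⟩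
      -- If some exceptional set avoids `l`, an exchange moves every face avoiding `l` into such a
      -- set. Otherwise every facet contains `l`, the complex is a cone with apex `l`, and the
      -- deletion equals the link.
      · by_cases hne' : ∃ G, IsExceptional E η U G ∧ ∀ i ∈ G, (i : ℕ) < L
        · have hdel : (exceptionalComplex E η U (L + 1)).deletion l =
              exceptionalComplex E η U L := by
            ext F
            constructor
            · rintro ⟨⟨G, ⟨hG, hGL⟩, hFG⟩, hlF⟩
              by_cases hlG : l ∈ G
              · obtain ⟨G', hG', hG'L⟩ := hne'
                obtain ⟨x, hxl, hxG, hx⟩ := hex U G G' l hG hG' hlG (hle hGL) fun i hi => hG'L i hi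
                refine ⟨_, ⟨hx, fun i hi => ?_⟩, fun i hi => Finset.mem_insert_of_mem ?_⟩
                · rcases Finset.mem_insert.1 hi with rfl | hi
                  · exact hxl
                  · exact (herase hG hGL hlG).2 i hi
                · exact Finset.mem_erase.2 ⟨fun h => hlF (h ▸ hi), hFG hi⟩
              · exact ⟨G, ⟨hG, hlt hGL hlG⟩, hFG⟩
            · rintro ⟨G, ⟨hG, hGL⟩, hFG⟩
              exact ⟨⟨G, ⟨hG, fun i hi => (hGL i hi).trans (Nat.lt_succ_self L)⟩, hFG⟩,
                fun h => hnot hGL (hFG h)⟩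
          rw [hdel]
          exact ih (by omega) U hne'
        · have hdel : (exceptionalComplex E η U (L + 1)).deletion l =
              exceptionalComplex E η (U ⊓ LinearMap.ker (E (η l))) L := by
            ext F
            constructor
            · rintro ⟨⟨G, ⟨hG, hGL⟩, hFG⟩, hlF⟩
              have hlG : l ∈ G := by_contra fun h => hne' ⟨G, hG, hlt hGL h⟩
              refine ⟨G.erase l, herase hG hGL hlG, fun i hi => ?_⟩
              exact Finset.mem_erase.2 ⟨fun h => hlF (h ▸ hi), hFG hi⟩
            · rintro ⟨G, ⟨hG, hGL⟩, hFG⟩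
              exact ⟨⟨insert l G, hinsert hG hGL, hFG.trans (Finset.subset_insert _ _)⟩,
                fun h => hnot hGL (hFG h)⟩
          rw [hdel]
          exact hvd
    -- Here `l` is not a vertex, so lowering the bound changes nothing.
    · have hset : {G | IsExceptional E η U G ∧ ∀ i ∈ G, (i : ℕ) < L + 1} =
          {G | IsExceptional E η U G ∧ ∀ i ∈ G, (i : ℕ) < L} := by
        ext G
        constructor
        · exact fun h => ⟨h.1, hlt h.2 fun hl => hLG ⟨G, h, hl⟩⟩
        · exact fun h => ⟨h.1, fun i hi => (h.2 i hi).trans (Nat.lt_succ_self L)⟩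
      obtain ⟨G, hG⟩ := hne
      have := ih (by omega) U ⟨G, hset.subset hG⟩
      rwa [exceptionalComplex, ← hset] at this

end VertexDecomposable

/-! ### Lexicographic shellings -/

/-- Below `x` the lists agree; there the first continues with `x` and the second with something
larger. Equal lengths prevent the second from having ended. -/
theorem List.lt_of_first_difference {α : Type*} [LinearOrder α] {l₁ l₂ : List α} {x : α}
    (h₁ : l₁.SortedLT) (h₂ : l₂.SortedLT)
    (hlen : l₁.length = l₂.length) (hx₁ : x ∈ l₁) (hx₂ : x ∉ l₂)
    (hlt : ∀ i < x, i ∈ l₁ ↔ i ∈ l₂) : l₁ < l₂ := by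
  induction l₁ generalizing l₂ with
  | nil => simp at hx₁
  | cons a t₁ ih =>
    cases l₂ with
    | nil => simp at hlen
    | cons b t₂ =>
      rw [List.cons_lt_cons_iff]
      have h₁' := List.pairwise_cons.1 h₁.pairwise
      have h₂' := List.pairwise_cons.1 h₂.pairwise
      have hax : a ≤ x := by
        rcases List.mem_cons.1 hx₁ with rfl | h
        · exact le_rfl
        · exact (h₁'.1 x h).le
      rcases lt_trichotomy a b with hab | rfl | hab
      · exact Or.inl hab
      · refine Or.inr ⟨rfl, ih h₁'.2.sortedLT h₂'.2.sortedLT (by simpa using hlen) ?_ ?_ ?_⟩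
        · rcases List.mem_cons.1 hx₁ with rfl | h
          · simp at hx₂
          · exact h
        · exact fun h => hx₂ (List.mem_cons_of_mem _ h)
        · intro i hi
          have := hlt i hi
          rw [List.mem_cons, List.mem_cons] at this
          constructor
          · intro h
            exact (this.1 (Or.inr h)).resolve_left (h₁'.1 i h).ne'
          · intro h
            exact (this.2 (Or.inr h)).resolve_left (h₂'.1 i h).ne'
      · have hb : b ∈ a :: t₁ := (hlt b (hab.trans_le hax)).2 (by simp)
        rcases List.mem_cons.1 hb with rfl | h
        · exact absurd hab (lt_irrefl _)
        · exact absurd (hab.trans (h₁'.1 b h)) (lt_irrefl _)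

namespace FaceComplex

variable {k : ℕ}

theorem lexLT_insert_erase {G : Finset (Fin k)} {x v : Fin k} (hv : v ∈ G) (hx : x ∉ G)
    (hxv : x < v) : lexLT (insert x (G.erase v)) G := by
  refine List.lt_of_first_difference (x := x) (Finset.sortedLT_sort _) (Finset.sortedLT_sort _)
    ?_ (by simp) (by simpa using hx) fun i hi => ?_
  · rw [Finset.length_sort, Finset.length_sort, Finset.card_insert_of_notMem (by simp [hx]),
      Finset.card_erase_of_mem hv]
    have := Finset.card_pos.2 ⟨v, hv⟩
    omega
  · simp [hi.ne, (hi.trans hxv).ne]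

/-- The exchange hypothesis concerns the last difference of two facets, while the order is decided
by the first. If the last difference lies in `G`, exchange in `G`; if it lies in `F`, replace `F` by
a lexicographically smaller facet and repeat. -/
theorem isShellingOrder_lexLT {Δ : FaceComplex (Fin k)}
    (hex : ∀ F ∈ Δ.facets, ∀ G ∈ Δ.facets, ∀ v ∈ G, v ∉ F → (∀ i, v < i → (i ∈ F ↔ i ∈ G)) →
      ∃ x < v, x ∉ G ∧ insert x (G.erase v) ∈ Δ.facets) :
    Δ.IsShellingOrder lexLT where
  finite := Set.toFinite _
  irrefl _ _ := lt_irrefl _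
  trans _ _ _ _ _ _ := lt_trans
  total F _ G _ hne := lt_or_gt_of_ne fun h => hne (by
    have := congrArg List.toFinset h
    simpa using this)
  shelling := by
    intro F hF G hG hFG
    suffices h : ∃ v ∈ G, v ∉ F ∧ ∃ x < v, x ∉ G ∧ insert x (G.erase v) ∈ Δ.facets by
      obtain ⟨v, hvG, hvF, x, hxv, hxG, hH⟩ := h
      refine ⟨_, hH, lexLT_insert_erase hvG hxG hxv, v, hvG, ?_, ?_⟩
      · intro i hi
        obtain ⟨hiF, hiG⟩ := Finset.mem_inter.1 hi
        exact Finset.mem_erase.2 ⟨fun h => hvF (h ▸ hiF), hiG⟩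
      · rw [Finset.insert_inter_of_notMem hxG]
        exact Finset.inter_eq_left.2 (Finset.erase_subset _ _)
    by_contra hcon
    push Not at hcon
    -- An exchange in `F` lowers the sum of its positions, which makes the repetition terminate.
    have key : ∀ (d : ℕ) (F : Finset (Fin k)), ∑ i ∈ F, (i : ℕ) = d → F ∈ Δ.facets →
        (∀ v ∈ G, v ∉ F → ∀ x < v, x ∉ G → insert x (G.erase v) ∉ Δ.facets) →
        ¬ lexLT F G := by
      intro d
      induction d using Nat.strong_induction_on with
      | _ d ih =>
        intro F hd hF hcon hlt
        have hne : F ≠ G := fun h => lt_irrefl _ (h ▸ hlt : lexLT G G)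
        have hne' : (symmDiff F G).Nonempty := by
          rw [Finset.nonempty_iff_ne_empty]
          intro h
          exact hne (symmDiff_eq_bot.1 h)
        obtain ⟨v, hv, hmax⟩ := Finset.exists_max_image _ id hne'
        have hiff (i : Fin k) (hi : v < i) : i ∈ F ↔ i ∈ G := by
          have : i ∉ symmDiff F G := fun h => absurd (hmax i h) (not_le.2 hi)
          rw [Finset.mem_symmDiff] at this
          tauto
        rcases Finset.mem_symmDiff.1 hv with ⟨hvF, hvG⟩ | ⟨hvG, hvF⟩
        · obtain ⟨x, hxv, hxF, hH⟩ := hex G hG F hF v hvF hvG fun i hi => (hiff i hi).symm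
          refine ih _ ?_ _ rfl hH ?_ ((lexLT_insert_erase hvF hxF hxv).trans hlt)
          · rw [Finset.sum_insert (by simp [hxF]), ← hd, ← Finset.add_sum_erase F _ hvF]
            have : (x : ℕ) < v := hxv
            omega
          -- As `v ∉ G`, an element of `G` missing from the exchanged facet is already missing from
          -- `F`.
          · intro u huG huF
            refine hcon u huG fun h => huF ?_
            exact Finset.mem_insert_of_mem (Finset.mem_erase.2 ⟨fun h' => hvG (h' ▸ huG), h⟩)
        · obtain ⟨x, hxv, hxG, hH⟩ := hex F hF G hG v hvG hvF hiff
          exact hcon v hvG hvF x hxv hxG hH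
    exact key _ F rfl hF hcon hFG

end FaceComplex

/-- The elements above `v` are common to `F` and `G`. Peeling them off with `erase_top` makes `v`
the largest element of `G` and leaves only smaller ones in `F`, which is the situation of
`ExchangeProperty`. -/
theorem IsExceptional.exchange {V ι : Type*} [AddCommGroup V] [Module ℝ V]
    [FiniteDimensional ℝ V] [LinearOrder ι] {E : LinearMap.BilinForm ℝ V} {η : ι → V}
    (hη : ∀ i, E (η i) (η i) ≠ 0) (hex : ExchangeProperty E η) {U : Submodule ℝ V}
    {F G : Finset ι} (hF : IsExceptional E η U F) (hG : IsExceptional E η U G) {v : ι}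
    (hvG : v ∈ G) (hvF : v ∉ F) (hiff : ∀ i, v < i → (i ∈ F ↔ i ∈ G)) :
    ∃ x < v, x ∉ G ∧ IsExceptional E η U (insert x (G.erase v)) := by
  induction hd : G.card generalizing U F G with
  | zero => simp [Finset.card_eq_zero.1 hd] at hvG
  | succ d ih =>
    obtain ⟨l, hlG, hmax⟩ := Finset.exists_max_image G id ⟨v, hvG⟩
    simp only [id] at hmax
    rcases (hmax v hvG).eq_or_lt with rfl | hvl
    · refine hex U G F v hG hF hvG hmax fun i hi => ?_
      rcases lt_trichotomy i v with h | rfl | h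
      · exact h
      · exact absurd hi hvF
      · exact absurd (hmax i ((hiff i h).1 hi)) (not_le.2 h)
    · have hlF : l ∈ F := (hiff l hvl).2 hlG
      have hmaxF : ∀ i ∈ F, i ≤ l := fun i hi => by
        by_contra h
        rw [not_le] at h
        exact absurd (hmax i ((hiff i (hvl.trans h)).1 hi)) (not_le.2 h)
      obtain ⟨x, hxv, hxG, hx⟩ := ih (hF.erase_top hlF hmaxF (hη l))
        (hG.erase_top hlG hmax (hη l)) (Finset.mem_erase.2 ⟨hvl.ne, hvG⟩)
        (fun h => hvF (Finset.mem_of_mem_erase h))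
        (fun i hi => by rw [Finset.mem_erase, Finset.mem_erase, hiff i hi])
        (by rw [Finset.card_erase_of_mem hlG]; omega)
      have hxl := hxv.trans hvl
      refine ⟨x, hxv, fun h => hxG (Finset.mem_erase.2 ⟨hxl.ne, h⟩), ?_⟩
      have := hx.insert_top (l := l) ?_ (hG.mem l hlG) (hη l)
      · rwa [Finset.erase_right_comm, Finset.insert_comm, Finset.insert_erase
          (Finset.mem_erase.2 ⟨hvl.ne', hlG⟩)] at this
      · intro i hi
        rcases Finset.mem_insert.1 hi with rfl | hi
        · exact hxl
        · obtain ⟨-, hi⟩ := Finset.mem_erase.1 hi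
          obtain ⟨hil, hi⟩ := Finset.mem_erase.1 hi
          exact lt_of_le_of_ne (hmax i hi) hil

/-! ### The exchange property for sorted sequences of roots -/

/-- The `n` vectors `ρ` and the antiperiodic sequence `γ`, one half-period of which lists the
positive roots of `Φ` in an order compatible with the form `E`; the linear map `c` plays the role
of a Coxeter element, and the `ρ a` are the positive roots that it makes negative. -/
structure IsSortedRootSequence {V : Type*} [AddCommGroup V] [Module ℝ V]
    (E : LinearMap.BilinForm ℝ V) (Φ : Set V) (c : V →ₗ[ℝ] V) (n N : ℕ) (ρ γ : ℕ → V) : Prop where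
  pos : ∀ x, x ≠ 0 → 0 < E x x
  ne_zero : ∀ x ∈ Φ, x ≠ 0
  γ_mem : ∀ i, γ i ∈ Φ
  ρ_mem : ∀ a < n, ρ a ∈ Φ
  reflect : ∀ x ∈ Φ, ∀ g ∈ Φ, x - ((E x g + E g x) / E g g) • g ∈ Φ
  c_mem : ∀ x ∈ Φ, c x ∈ Φ
  serre : ∀ x y, E y x = - E (c x) y
  antiperiodic : ∀ i, γ (i + N) = - γ i
  nonneg : ∀ i j, i ≤ j → j < i + N → 0 ≤ E (γ i) (γ j)
  cover : ∀ x ∈ Φ, ∃ i < N, x = γ i ∨ x = - γ i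
  coef_nonneg : ∀ i < N, ∀ b < n, 0 ≤ E (γ i) (ρ b)
  ρ_triangular : ∀ a < n, ∀ b < a, E (ρ a) (ρ b) = 0
  eq_zero : ∀ x, (∀ b < n, E x (ρ b) = 0) → x = 0
  initial : ∀ i < N, ∀ j < N, c (γ i) = - γ j → ∃ a < n, γ i = ρ a

/-- The `n` vectors `ρ`, followed by the sequence `γ`. -/
def positionVector {V : Type*} (n : ℕ) (ρ γ : ℕ → V) (j : ℕ) : V :=
  if j < n then ρ j else γ (j - n)

theorem positionVector_of_lt {V : Type*} {n : ℕ} {ρ γ : ℕ → V} {j : ℕ} (h : j < n) :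
    positionVector n ρ γ j = ρ j := if_pos h

theorem positionVector_add {V : Type*} {n : ℕ} {ρ γ : ℕ → V} (j : ℕ) :
    positionVector n ρ γ (n + j) = γ j := by
  simp [positionVector]

theorem IsExceptional.insert_erase {V ι : Type*} [AddCommGroup V] [Module ℝ V] [LinearOrder ι]
    {E : LinearMap.BilinForm ℝ V} {η : ι → V} {U : Submodule ℝ V} {G : Finset ι}
    (h : IsExceptional E η U G) {l x : ι} (hl : l ∈ G) (hx : x ∉ G) (hxU : η x ∈ U)
    (hlt : ∀ g ∈ G, g ≠ l → g < x → E (η x) (η g) = 0)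
    (hgt : ∀ g ∈ G, g ≠ l → x < g → E (η g) (η x) = 0) :
    IsExceptional E η U (insert x (G.erase l)) where
  mem i hi := by
    rcases Finset.mem_insert.1 hi with rfl | hi
    · exact hxU
    · exact h.mem i (Finset.mem_of_mem_erase hi)
  triangular i hi j hj hij := by
    rcases Finset.mem_insert.1 hi with rfl | hi'
    · rcases Finset.mem_insert.1 hj with rfl | hj'
      · exact absurd hij (lt_irrefl _)
      · exact hgt j (Finset.mem_of_mem_erase hj') (Finset.ne_of_mem_erase hj') hij
    · rcases Finset.mem_insert.1 hj with rfl | hj'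
      · exact hlt i (Finset.mem_of_mem_erase hi') (Finset.ne_of_mem_erase hi') hij
      · exact h.triangular i (Finset.mem_of_mem_erase hi') j (Finset.mem_of_mem_erase hj') hij
  card_eq := by
    have := Finset.card_pos.2 ⟨l, hl⟩
    rw [Finset.card_insert_of_notMem (by simp [hx]), Finset.card_erase_of_mem hl, ← h.card_eq]
    omega

namespace IsSortedRootSequence

variable {V : Type*} [AddCommGroup V] [Module ℝ V] {E : LinearMap.BilinForm ℝ V} {Φ : Set V}
  {c : V →ₗ[ℝ] V} {n N : ℕ} {ρ γ : ℕ → V}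

theorem γ_pos (h : IsSortedRootSequence E Φ c n N ρ γ)
    (i : ℕ) : 0 < E (γ i) (γ i) := h.pos _ (h.ne_zero _ (h.γ_mem i))

theorem N_pos (h : IsSortedRootSequence E Φ c n N ρ γ) : 0 < N := by
  obtain ⟨i, hi, -⟩ := h.cover _ (h.γ_mem 0)
  omega

theorem nonpos (h : IsSortedRootSequence E Φ c n N ρ γ)
    {i j : ℕ} (hij : i < j) (hji : j ≤ i + N) : E (γ j) (γ i) ≤ 0 := by
  have := h.nonneg j (i + N) hji (by omega)
  rw [h.antiperiodic, map_neg] at this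
  linarith

theorem exists_window (h : IsSortedRootSequence E Φ c n N ρ γ) {x : V} (hx : x ∈ Φ) (g : ℕ) :
    ∃ i, g < i ∧ i ≤ g + N ∧ (x = γ i ∨ x = - γ i) := by
  have hN := h.N_pos
  induction g with
  | zero =>
    obtain ⟨i, hi, hxi⟩ := h.cover x hx
    rcases Nat.eq_zero_or_pos i with rfl | hi0
    · refine ⟨N, hN, by omega, ?_⟩
      have := h.antiperiodic 0
      rw [zero_add] at this
      rw [this, neg_neg]
      exact hxi.symm
    · exact ⟨i, hi0, by omega, hxi⟩
  | succ g ih =>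
    obtain ⟨i, hgi, hi, hxi⟩ := ih
    rcases Nat.eq_or_lt_of_le (Nat.succ_le_of_lt hgi) with heq | hlt
    · refine ⟨i + N, by omega, by omega, ?_⟩
      rw [h.antiperiodic, neg_neg]
      exact hxi.symm
    · exact ⟨i, hlt, by omega, hxi⟩

/-- Moving a root to the left past a member of an exceptional set moves its position in the
antiperiodic sequence to the right. -/
theorem exists_reflect (h : IsSortedRootSequence E Φ c n N ρ γ)
    {g x : ℕ} (hgx : g < x) (hxg : x < g + N) (hE : E (γ x) (γ g) = 0) :
    ∃ x', x ≤ x' ∧ x' < g + N ∧ ∃ μ ν : ℝ, γ x' = μ • γ x + ν • γ g ∧ E (γ g) (γ x') = 0 := by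
  have hgg := h.γ_pos g
  set lam := E (γ g) (γ x) / E (γ g) (γ g) with hlam
  have hlam0 : 0 ≤ lam := div_nonneg (h.nonneg g x hgx.le hxg) hgg.le
  rcases hlam0.eq_or_lt with h0 | hpos
  · refine ⟨x, le_rfl, hxg, 1, 0, by simp, ?_⟩
    rw [eq_comm, hlam, div_eq_zero_iff] at h0
    exact h0.resolve_right hgg.ne'
  -- Since `E (γ x) (γ g) = 0`, subtracting `lam • γ g` is the reflection of `γ x` along `γ g`.
  have hy : γ x - lam • γ g ∈ Φ := by
    have := h.reflect _ (h.γ_mem x) _ (h.γ_mem g)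
    rwa [hE, zero_add] at this
  have hgy : E (γ g) (γ x - lam • γ g) = 0 := by
    rw [map_sub, map_smul, smul_eq_mul, hlam, div_mul_cancel₀ _ hgg.ne', sub_self]
  have hyg : E (γ x - lam • γ g) (γ g) < 0 := by
    rw [map_sub, LinearMap.sub_apply, hE, map_smul, LinearMap.smul_apply, smul_eq_mul]
    nlinarith
  have hxy : 0 < E (γ x) (γ x - lam • γ g) := by
    rw [map_sub, map_smul, hE, smul_zero, sub_zero]
    exact h.γ_pos x
  obtain ⟨x', hgx', hx'g, hx'⟩ := h.exists_window hy g
  have hne : x' ≠ g + N := by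
    rintro rfl
    rw [h.antiperiodic, neg_neg] at hx'
    rcases hx' with hx' | hx' <;> rw [hx'] at hgy
    · rw [map_neg, neg_eq_zero] at hgy
      exact hgg.ne' hgy
    · exact hgg.ne' hgy
  have hlt : x' < g + N := lt_of_le_of_ne hx'g hne
  -- If `x' < x`, the sign `+` contradicts `0 < E (γ x) y` and the sign `-` contradicts `E y (γ g) <
  -- 0`, where `y` is the reflected root.
  have hxx' : x ≤ x' := by
    by_contra hcon
    rw [not_le] at hcon
    have h1 := h.nonpos hgx' hx'g
    have h2 := h.nonpos hcon (by omega)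
    rcases hx' with hx' | hx'
    · rw [hx'] at hxy
      linarith
    · rw [hx', map_neg, LinearMap.neg_apply] at hyg
      linarith
  refine ⟨x', hxx', hlt, ?_⟩
  rcases hx' with hx' | hx'
  · exact ⟨1, -lam, by rw [← hx', one_smul, neg_smul, sub_eq_add_neg], by rw [← hx', hgy]⟩
  · have hx'' : γ x' = -(γ x - lam • γ g) := by rw [hx', neg_neg]
    refine ⟨-1, lam, ?_, by rw [hx'', map_neg, hgy, neg_zero]⟩
    rw [hx'', neg_smul, one_smul]
    abel

/-- The root `γ x` is what completes `G \ {n + l}` when inserted at the slot `n + a`. Passing a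
member of `G` uses `exists_reflect`. Passing a free slot keeps `γ x`, and `x` cannot be `a + N`
there: then `γ a = -γ x` would be an admissible replacement, against `hcon`. -/
theorem walk (h : IsSortedRootSequence E Φ c n N ρ γ) {U : Submodule ℝ V} {G : Finset ℕ} {l : ℕ}
    (hG : IsExceptional E (positionVector n ρ γ) U G) (hl : n + l ∈ G)
    (hmax : ∀ g ∈ G, g ≤ n + l)
    (hcon : ∀ x < n + l, x ∉ G →
      ¬ IsExceptional E (positionVector n ρ γ) U (insert x (G.erase (n + l))))
    (a : ℕ) (ha : a ≤ l) :
    ∃ x, l ≤ x ∧ x < a + N ∧ γ x ∈ U ∧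
      (∀ g ∈ G, g < n + a → E (γ x) (positionVector n ρ γ g) = 0) ∧
      (∀ g ∈ G, g < n + l → n + a ≤ g → E (positionVector n ρ γ g) (γ x) = 0) := by
  have hN := h.N_pos
  induction ha using Nat.decreasingInduction with
  | self =>
    have hmem := hG.mem _ hl
    rw [positionVector_add] at hmem
    refine ⟨l, le_rfl, by omega, hmem, fun g hg hgl => ?_, fun g _ _ _ => by omega⟩
    have := hG.triangular g hg _ hl hgl
    rwa [positionVector_add] at this
  | of_succ a hal ih =>
    obtain ⟨x, hlx, hxa, hxU, hlow, hup⟩ := ih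
    have hva : positionVector n ρ γ (n + a) = γ a := positionVector_add a
    by_cases haG : n + a ∈ G
    · have hE : E (γ x) (γ a) = 0 := hva ▸ hlow _ haG (by omega)
      have hxa' : x < a + N := by
        refine lt_of_le_of_ne (by omega) ?_
        rintro rfl
        rw [h.antiperiodic, map_neg, LinearMap.neg_apply] at hE
        linarith [h.γ_pos a]
      obtain ⟨x', hxx', hx'a, μ, ν, hx', hEx'⟩ := h.exists_reflect (by omega) hxa' hE
      refine ⟨x', hlx.trans hxx', hx'a, ?_, fun g hg hga => ?_, fun g hg hgl hag => ?_⟩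
      · rw [hx']
        exact U.add_mem (U.smul_mem _ hxU) (U.smul_mem _ (hva ▸ hG.mem _ haG))
      · have h2 := hG.triangular g hg _ haG hga
        rw [hva] at h2
        rw [hx']
        simp [hlow g hg (by omega), h2]
      · rcases Nat.eq_or_lt_of_le hag with rfl | hag
        · rwa [hva]
        · have h2 := hG.triangular _ haG g hg hag
          rw [hva] at h2
          rw [hx']
          simp [hup g hg hgl (by omega), h2]
    · rcases Nat.lt_or_eq_of_le (Nat.lt_succ_iff.1 (by omega : x < (a + N) + 1)) with hxa' | rfl
      · refine ⟨x, hlx, hxa', hxU, fun g hg hga => hlow g hg (by omega), fun g hg hgl hag => ?_⟩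
        refine hup g hg hgl ?_
        have : g ≠ n + a := fun h => haG (h ▸ hg)
        omega
      · exfalso
        have hneg : γ a = - γ (a + N) := by rw [h.antiperiodic, neg_neg]
        refine hcon (n + a) (by omega) haG (hG.insert_erase hl haG ?_ ?_ ?_)
        · rw [hva, hneg]
          exact U.neg_mem hxU
        · intro g hg _ hga
          rw [hva, hneg, map_neg, LinearMap.neg_apply, hlow g hg (by omega), neg_zero]
        · intro g hg hgl hag
          rw [hva, hneg, map_neg]
          rw [hup g hg (lt_of_le_of_ne (hmax g hg) hgl) (by omega), neg_zero]

/-- If `c` made `γ i` negative, `γ i` would be some `ρ a`. This could replace `n + l` at position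
`a`, whatever the slot `b`: the `ρ`'s are triangular among themselves, and the members from position
`n` on are covered by `hup`. -/
theorem exists_c_γ_eq (h : IsSortedRootSequence E Φ c n N ρ γ)
    {U : Submodule ℝ V} {G : Finset ℕ} {l : ℕ}
    (hG : IsExceptional E (positionVector n ρ γ) U G) (hl : n + l ∈ G)
    (hmax : ∀ g ∈ G, g ≤ n + l)
    (hcon : ∀ x < n + l, x ∉ G →
      ¬ IsExceptional E (positionVector n ρ γ) U (insert x (G.erase (n + l))))
    {b i : ℕ} (hb : b ≤ n) (hi : i < N) (hiU : γ i ∈ U)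
    (hlow : ∀ g ∈ G, g < b → E (γ i) (positionVector n ρ γ g) = 0)
    (hup : ∀ g ∈ G, g < n + l → b ≤ g → E (positionVector n ρ γ g) (γ i) = 0) :
    ∃ j < N, c (γ i) = γ j := by
  obtain ⟨j, hj, hj' | hj'⟩ := h.cover _ (h.c_mem _ (h.γ_mem i))
  · exact ⟨j, hj, hj'⟩
  exfalso
  obtain ⟨a, ha, hia⟩ := h.initial i hi j hj hj'
  have hva : positionVector n ρ γ a = γ i := by rw [positionVector_of_lt ha, hia]
  have haG : a ∉ G := by
    intro haG
    have : E (γ i) (γ i) = 0 := by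
      rcases lt_or_ge a b with hab | hab
      · simpa only [hva] using hlow a haG hab
      · simpa only [hva] using hup a haG (by omega) hab
    exact (h.γ_pos i).ne' this
  refine hcon a (by omega) haG (hG.insert_erase hl haG (hva ▸ hiU) ?_ ?_)
  · intro g _ _ hga
    rw [positionVector_of_lt ha, positionVector_of_lt (hga.trans ha), h.ρ_triangular a ha g hga]
  · intro g hg hgl hag
    rcases lt_or_ge g n with hgn | hgn
    · rw [positionVector_of_lt ha, positionVector_of_lt hgn, h.ρ_triangular g hgn a hag]
    · rw [hva]
      exact hup g hg (lt_of_le_of_ne (hmax g hg) hgl) (hb.trans hgn)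

/-- The walk continues through the `ρ`'s, now keeping the root among `γ 0, …, γ (N - 1)`. Since `c`
maps it to another of these, `E (ρ b) (γ i) = -E (c (γ i)) (ρ b) ≤ 0`. So passing `ρ b` adds a
nonnegative multiple of `ρ b`, which preserves all the sign conditions. -/
theorem walk_initial (h : IsSortedRootSequence E Φ c n N ρ γ)
    {U : Submodule ℝ V} {G : Finset ℕ} {l : ℕ}
    (hG : IsExceptional E (positionVector n ρ γ) U G) (hl : n + l ∈ G)
    (hmax : ∀ g ∈ G, g ≤ n + l)
    (hcon : ∀ x < n + l, x ∉ G →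
      ¬ IsExceptional E (positionVector n ρ γ) U (insert x (G.erase (n + l))))
    {x : ℕ} (hlx : l ≤ x) (hxN : x < N) (hxU : γ x ∈ U)
    (hlow : ∀ g ∈ G, g < n → E (γ x) (positionVector n ρ γ g) = 0)
    (hup : ∀ g ∈ G, g < n + l → n ≤ g → E (positionVector n ρ γ g) (γ x) = 0)
    (b : ℕ) (hb : b ≤ n) :
    ∃ i < N, γ i ∈ U ∧ (∀ g ∈ G, g < b → E (γ i) (positionVector n ρ γ g) = 0) ∧
      (∀ g ∈ G, g < n + l → b ≤ g → E (positionVector n ρ γ g) (γ i) = 0) ∧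
      ∀ k ≤ l, 0 ≤ E (γ k) (γ i) := by
  induction hb using Nat.decreasingInduction with
  | self => exact ⟨x, hxN, hxU, hlow, hup, fun k hk => h.nonneg k x (by omega) (by omega)⟩
  | of_succ b hbn ih =>
    obtain ⟨i, hi, hiU, hlow, hup, hk⟩ := ih
    have hvb : positionVector n ρ γ b = ρ b := positionVector_of_lt hbn
    by_cases hbG : b ∈ G
    · obtain ⟨j, hj, hcj⟩ := h.exists_c_γ_eq hG hl hmax hcon (by omega) hi hiU hlow hup
      have hbb : 0 < E (ρ b) (ρ b) := h.pos _ (h.ne_zero _ (h.ρ_mem b hbn))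
      have hib : E (γ i) (ρ b) = 0 := hvb ▸ hlow b hbG (by omega)
      set μ := - (E (ρ b) (γ i) / E (ρ b) (ρ b)) with hμ
      have hμ0 : 0 ≤ μ := by
        rw [hμ, h.serre, hcj, neg_div, neg_neg]
        exact div_nonneg (h.coef_nonneg j hj b hbn) hbb.le
      have hy : γ i + μ • ρ b ∈ Φ := by
        have := h.reflect _ (h.γ_mem i) _ (h.ρ_mem b hbn)
        rwa [hib, zero_add, sub_eq_add_neg, ← neg_smul, ← hμ] at this
      have hby : E (ρ b) (γ i + μ • ρ b) = 0 := by
        rw [map_add, map_smul, smul_eq_mul, hμ, neg_mul, div_mul_cancel₀ _ hbb.ne', add_neg_cancel]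
      have hcoef (a : ℕ) (ha : a < n) : 0 ≤ E (γ i + μ • ρ b) (ρ a) := by
        obtain ⟨i', hi', hρb⟩ := h.cover _ (h.ρ_mem b hbn)
        have hba : 0 ≤ E (ρ b) (ρ a) := by
          rcases hρb with hρb | hρb
          · rw [hρb]
            exact h.coef_nonneg i' hi' a ha
          · have := h.coef_nonneg i' hi' b hbn
            rw [← neg_neg (γ i'), ← hρb, map_neg, LinearMap.neg_apply] at this
            linarith
        rw [map_add, map_smul, LinearMap.add_apply, LinearMap.smul_apply, smul_eq_mul]
        have := h.coef_nonneg i hi a ha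
        positivity
      obtain ⟨i', hi', hyi⟩ := h.cover _ hy
      replace hyi : γ i' = γ i + μ • ρ b := by
        rcases hyi with hyi | hyi
        · exact hyi.symm
        -- With the sign `-` all values `E y (ρ a)` would be both nonnegative and nonpositive, so
        -- the new root `y` would vanish.
        · refine absurd (h.eq_zero (γ i + μ • ρ b) fun a ha => ?_) (h.ne_zero _ hy)
          refine le_antisymm ?_ (hcoef a ha)
          rw [hyi, map_neg, LinearMap.neg_apply]
          linarith [h.coef_nonneg i' hi' a ha]
      refine ⟨i', hi', ?_, fun g hg hgb => ?_, fun g hg hgl hbg => ?_, fun k hkl => ?_⟩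
      · rw [hyi]
        exact U.add_mem hiU (U.smul_mem _ (hvb ▸ hG.mem b hbG))
      · have h1 := hlow g hg (by omega)
        have h2 := hG.triangular g hg b hbG hgb
        rw [hvb] at h2
        simp [hyi, h1, h2]
      · rcases Nat.eq_or_lt_of_le hbg with rfl | hbg
        · rw [hyi, hvb, hby]
        · have h1 := hup g hg hgl hbg
          have h2 := hG.triangular b hbG g hg hbg
          rw [hvb] at h2
          simp [hyi, h1, h2]
      · rw [hyi, map_add, map_smul, smul_eq_mul]
        have h1 := hk k hkl
        have h2 := h.coef_nonneg k (by omega) b hbn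
        positivity
    · refine ⟨i, hi, hiU, fun g hg hgb => hlow g hg (by omega), fun g hg hgl hbg => ?_, hk⟩
      refine hup g hg hgl ?_
      have : g ≠ b := fun h => hbG (h ▸ hg)
      omega

theorem positionVector_mem (h : IsSortedRootSequence E Φ c n N ρ γ)
    (j : ℕ) : positionVector n ρ γ j ∈ Φ := by
  unfold positionVector
  split_ifs with hj
  · exact h.ρ_mem j hj
  · exact h.γ_mem _

theorem positionVector_pos (h : IsSortedRootSequence E Φ c n N ρ γ) (j : ℕ) :
    0 < E (positionVector n ρ γ j) (positionVector n ρ γ j) :=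
  h.pos _ (h.ne_zero _ (h.positionVector_mem j))

/-- If no exchange exists, the walk ends with a root `γ i ∈ U` such that `E g (γ i) = 0` for all `g
∈ G` except the largest. The signs of `E` then force `E (·) (γ i)` to vanish on `G'`, hence on `U`,
although `E (γ i) (γ i) > 0`. -/
theorem exchangeProperty (h : IsSortedRootSequence E Φ c n N ρ γ) [FiniteDimensional ℝ V] :
    ExchangeProperty E (positionVector n ρ γ) := by
  intro U G G' l hG hG' hlG hmax hG'l
  have hη (i : ℕ) := (h.positionVector_pos i).ne'
  by_contra hcon
  push Not at hcon
  rcases lt_or_ge l n with hln | hln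
  -- Here `G'` consists of `ρ`'s before `ρ l`, so `E (ρ l)` vanishes on `G'` and hence on `U`, which
  -- contains `ρ l`.
  · refine hη l (hG'.eq_zero_of_forall_mem hη (f := E (positionVector n ρ γ l)) ?_
      (hG.mem l hlG))
    intro i hi
    have := hG'l i hi
    rw [positionVector_of_lt hln, positionVector_of_lt (this.trans hln),
      h.ρ_triangular l hln i this]
  obtain ⟨l, rfl⟩ := Nat.exists_eq_add_of_le hln
  obtain ⟨x, hlx, hxN, hxU, hlow, hup⟩ := h.walk hG hlG hmax hcon 0 (Nat.zero_le l)
  rw [zero_add] at hxN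
  obtain ⟨i, hi, hiU, hlow, hup, hk⟩ :=
    h.walk_initial hG hlG hmax hcon hlx hxN hxU hlow hup 0 (Nat.zero_le n)
  obtain ⟨j, hj, hcj⟩ := h.exists_c_γ_eq hG hlG hmax hcon (Nat.zero_le n) hi hiU hlow hup
  have hll := h.γ_pos l
  -- As functions of `u` both terms vanish on the members of `G` other than the largest, and they
  -- agree at `γ l`.
  have hprop {u : V} (hu : u ∈ U) :
      E (γ l) (γ l) * E u (γ i) - E (γ l) (γ i) * E (γ l) u = 0 := by
    refine hG.eq_zero_of_forall_mem hη
      (f := E (γ l) (γ l) • LinearMap.flip E (γ i) - E (γ l) (γ i) • E (γ l)) ?_ hu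
    intro g hg
    simp only [LinearMap.sub_apply, LinearMap.smul_apply, LinearMap.flip_apply, smul_eq_mul]
    rcases (hmax g hg).eq_or_lt with rfl | hgl
    · rw [positionVector_add]
      ring
    · have h1 := hG.triangular g hg _ hlG hgl
      rw [positionVector_add] at h1
      rw [hup g hg hgl (Nat.zero_le g), h1]
      ring
  -- For each member of `G'` the two terms of `hprop` have opposite weak signs, so both are zero.
  have hzero : E (γ i) (γ i) = 0 := by
    refine hG'.eq_zero_of_forall_mem hη (f := LinearMap.flip E (γ i)) ?_ hiU
    intro g hg
    rw [LinearMap.flip_apply]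
    have h1 := hprop (hG'.mem g hg)
    have h2 := hk l le_rfl
    rcases lt_or_ge g n with hgn | hgn
    · rw [positionVector_of_lt hgn] at h1 ⊢
      have h3 : E (ρ g) (γ i) ≤ 0 := by
        rw [h.serre, hcj]
        linarith [h.coef_nonneg j hj g hgn]
      have h4 := mul_nonneg h2 (h.coef_nonneg l (by omega) g hgn)
      have h5 := mul_nonneg hll.le (neg_nonneg.2 h3)
      have : E (γ l) (γ l) * E (ρ g) (γ i) = 0 := by linarith
      exact (mul_eq_zero.1 this).resolve_left hll.ne'
    · obtain ⟨g, rfl⟩ := Nat.exists_eq_add_of_le hgn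
      have hgl : g < l := by
        have := hG'l _ hg
        omega
      rw [positionVector_add] at h1 ⊢
      have h3 := mul_nonneg h2 (neg_nonneg.2 (h.nonpos hgl (by omega)))
      have h4 := mul_nonneg hll.le (hk g hgl.le)
      have : E (γ l) (γ l) * E (γ g) (γ i) = 0 := by linarith
      exact (mul_eq_zero.1 this).resolve_left hll.ne'
  exact (h.γ_pos i).ne' hzero

end IsSortedRootSequence

theorem ExchangeProperty.comp_fin {V : Type*} [AddCommGroup V] [Module ℝ V]
    {E : LinearMap.BilinForm ℝ V} {η : ℕ → V} (h : ExchangeProperty E η) (k : ℕ) :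
    ExchangeProperty E (fun i : Fin k => η i) := by
  have hiff (U : Submodule ℝ V) (G : Finset (Fin k)) :
      IsExceptional E (fun i : Fin k => η i) U G ↔
        IsExceptional E η U (G.map Fin.valEmbedding) := by
    constructor
    · rintro ⟨h1, h2, h3⟩
      refine ⟨?_, ?_, by rw [Finset.card_map, h3]⟩
      · simpa using h1
      · simpa using h2
    · rintro ⟨h1, h2, h3⟩
      refine ⟨by simpa using h1, by simpa using h2, by rw [← h3, Finset.card_map]⟩
  intro U G G' l hG hG' hl hmax hG'l
  obtain ⟨x, hxl, hxG, hx⟩ := h U _ _ (l : ℕ) ((hiff U G).1 hG) ((hiff U G').1 hG')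
    (Finset.mem_map_of_mem Fin.valEmbedding hl)
    (by simpa using fun i hi => hmax i hi) (by simpa using fun i hi => hG'l i hi)
  refine ⟨⟨x, hxl.trans l.2⟩, hxl, fun h => hxG ?_, ?_⟩
  · exact Finset.mem_map_of_mem Fin.valEmbedding h
  · rw [hiff, Finset.map_insert, Finset.map_erase]
    exact hx

/-! ### The geometric representation of a Coxeter group -/

namespace CoxeterMatrix

variable {B : Type*} (M : CoxeterMatrix B)

/-- The entries `-cos (π / m_ij)` of the canonical bilinear form; this is `-1` for `m_ij = ∞`. -/
noncomputable def cosForm (i j : B) : ℝ := -Real.cos (Real.pi / M i j)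

theorem cosForm_self (i : B) : M.cosForm i i = 1 := by simp [cosForm]

theorem cosForm_comm (i j : B) : M.cosForm i j = M.cosForm j i := by
  rw [cosForm, cosForm, M.symmetric]

open Polynomial.Chebyshev in
-- The value is `sin ((k + 1) π / m) / sin (π / m)`, and `k + 1` when `m = ∞`.
theorem chebyshev_cosForm_nonneg {i j : B} (hij : i ≠ j)
    {k : ℤ} (hk : 0 ≤ k + 1) (hkM : M i j = 0 ∨ k + 1 ≤ M i j) :
    0 ≤ (S ℝ k).eval (-2 * M.cosForm i j) := by
  have hkR : (0 : ℝ) ≤ k + 1 := by exact_mod_cast hk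
  have h1 : -2 * M.cosForm i j = 2 * Real.cos (Real.pi / M i j) := by
    rw [cosForm]
    ring
  by_cases h0 : M i j = 0
  · rw [h1, h0]
    simp only [Nat.cast_zero, div_zero, Real.cos_zero, mul_one]
    rw [S_eval_two]
    exact_mod_cast hk
  · have hm2 : 2 ≤ M i j := by
      have := M.off_diagonal i j hij
      omega
    have hm2R : (2 : ℝ) ≤ M i j := by exact_mod_cast hm2
    have hkMR : (k + 1 : ℝ) ≤ M i j := by exact_mod_cast hkM.resolve_left h0
    have hpi := Real.pi_pos
    have hsin : 0 < Real.sin (Real.pi / M i j) := by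
      refine Real.sin_pos_of_pos_of_lt_pi (by positivity) ?_
      rw [div_lt_iff₀ (by linarith)]
      nlinarith
    have h2 : 0 ≤ Real.sin ((k + 1) * (Real.pi / M i j)) := by
      refine Real.sin_nonneg_of_nonneg_of_le_pi (by positivity) ?_
      rw [mul_div_assoc', div_le_iff₀ (by linarith), mul_comm]
      exact mul_le_mul_of_nonneg_left hkMR hpi.le
    rw [← S_two_mul_real_cos, ← h1] at h2
    exact nonneg_of_mul_nonneg_left h2 hsin

variable [Fintype B]

/-- The coroot of the simple root with index `i`. -/
noncomputable def simpleCoroot (i : B) : Module.Dual ℝ (B → ℝ) :=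
  ∑ j, (2 * M.cosForm i j) • LinearMap.proj j

theorem simpleCoroot_apply (i : B) (x : B → ℝ) :
    M.simpleCoroot i x = ∑ j, 2 * M.cosForm i j * x j := by
  simp [simpleCoroot]

variable [DecidableEq B]

theorem simpleCoroot_single (i j : B) :
    M.simpleCoroot i (Pi.single j 1) = 2 * M.cosForm i j := by
  simp [simpleCoroot_apply, Pi.single_apply]

theorem simpleCoroot_single_self (i : B) : M.simpleCoroot i (Pi.single i 1) = 2 := by
  rw [simpleCoroot_single, cosForm_self, mul_one]

/-- The reflection of `B → ℝ` attached to the simple root with index `i`. -/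
noncomputable def simpleReflection (i : B) : (B → ℝ) ≃ₗ[ℝ] (B → ℝ) :=
  Module.reflection (M.simpleCoroot_single_self i)

theorem simpleReflection_apply (i : B) (x : B → ℝ) :
    M.simpleReflection i x = x - M.simpleCoroot i x • Pi.single i 1 :=
  Module.reflection_apply _ _

/-- In the plane of the two simple roots the product is a rotation by `φ = 2π / m`. The general
formula for powers of a product of two reflections has Chebyshev coefficients, which cancel or
vanish at the `m`-th power. -/
theorem isLiftable_simpleReflection : M.IsLiftable M.simpleReflection := by
  intro i j
  by_cases hij : i = j
  · subst hij
    rw [M.diagonal, pow_one]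
    ext1 x
    exact Module.involutive_reflection (M.simpleCoroot_single_self i) x
  by_cases h0 : M i j = 0
  · rw [h0, pow_zero]
  have hm2 : 2 ≤ M i j := by
    have := M.off_diagonal i j hij
    omega
  ext1 z
  set m := M i j with hm
  have ht : 2 * Real.cos (2 * (Real.pi / m)) = M.simpleCoroot i (Pi.single j 1) *
      M.simpleCoroot j (Pi.single i 1) - 2 := by
    rw [simpleCoroot_single, simpleCoroot_single, M.cosForm_comm j i, cosForm, ← hm,
      Real.cos_two_mul]
    ring
  have key := Module.reflection_mul_reflection_pow_apply (M.simpleCoroot_single_self i)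
    (M.simpleCoroot_single_self j) m z _ ht
  change ((M.simpleReflection i * M.simpleReflection j) ^ m) z = _ at key
  rw [key]
  change _ = z
  have hmR : (m : ℝ) ≠ 0 := by exact_mod_cast h0
  -- For `m = 2` the angle is `π`, and the coefficients cannot be written as quotients by `sin φ`.
  rcases hm2.eq_or_lt with h2 | h3
  · rw [← h2]
    have h1 : M.cosForm i j = 0 := by
      rw [cosForm, ← hm, ← h2]
      simp
    have h1' : M.cosForm j i = 0 := by rw [M.cosForm_comm, h1]
    have e1 : (((2 : ℕ) : ℤ) - 2) / 2 = 0 := by norm_num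
    have e2 : (((2 : ℕ) : ℤ) - 1) / 2 = 0 := by norm_num
    have e3 : (((2 : ℕ) : ℤ) - 3) / 2 = -1 := by norm_num
    have e4 : ((2 : ℕ) : ℤ) / 2 = 1 := by norm_num
    rw [e1, e2, e3, e4]
    have e5 : 2 * Real.cos (2 * (Real.pi / ((2 : ℕ) : ℝ))) = -2 := by
      rw [show 2 * (Real.pi / ((2 : ℕ) : ℝ)) = Real.pi by push_cast; ring, Real.cos_pi]
      norm_num
    rw [e5]
    simp only [simpleCoroot_single, h1, h1', Polynomial.Chebyshev.S_zero,
      Polynomial.Chebyshev.S_neg_one, Polynomial.Chebyshev.S_one, Polynomial.eval_one,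
      Polynomial.eval_zero, Polynomial.eval_X]
    module
  · set φ := 2 * (Real.pi / m) with hφ
    have hmφ : (m : ℝ) * φ = 2 * Real.pi := by
      rw [hφ]
      field_simp
    have hsin : Real.sin φ ≠ 0 := by
      have hm3 : (3 : ℝ) ≤ m := by exact_mod_cast h3
      have hpi := Real.pi_pos
      refine (Real.sin_pos_of_pos_of_lt_pi (by positivity) ?_).ne'
      have : (0 : ℝ) < m := by linarith
      by_contra hcon
      rw [not_lt] at hcon
      nlinarith
    have hS (k : ℤ) : (Polynomial.Chebyshev.S ℝ k).eval (2 * Real.cos φ) =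
        Real.sin ((k + 1) * φ) / Real.sin φ := by
      rw [eq_div_iff hsin, Polynomial.Chebyshev.S_two_mul_real_cos]
    rcases Nat.even_or_odd' m with ⟨k, hk | hk⟩
    · have e1 : ((m : ℤ) - 2) / 2 = k - 1 := by omega
      have e2 : ((m : ℤ) - 1) / 2 = k - 1 := by omega
      have hz : (Polynomial.Chebyshev.S ℝ ((k : ℤ) - 1)).eval (2 * Real.cos φ) = 0 := by
        rw [hS]
        have : (((k : ℤ) - 1 : ℤ) + 1 : ℝ) * φ = Real.pi := by
          push_cast
          have : (m : ℝ) = 2 * k := by exact_mod_cast hk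
          rw [this] at hmφ
          linarith
        rw [this, Real.sin_pi, zero_div]
      rw [e1, e2, hz]
      simp
    · have e1 : ((m : ℤ) - 2) / 2 = k - 1 := by omega
      have e2 : ((m : ℤ) - 1) / 2 = k := by omega
      have e3 : ((m : ℤ) - 3) / 2 = k - 1 := by omega
      have e4 : (m : ℤ) / 2 = k := by omega
      have hz : (Polynomial.Chebyshev.S ℝ (k : ℤ)).eval (2 * Real.cos φ) +
          (Polynomial.Chebyshev.S ℝ ((k : ℤ) - 1)).eval (2 * Real.cos φ) = 0 := by
        rw [hS, hS, ← add_div]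
        have h1 : (((k : ℤ) : ℝ) + 1) * φ = 2 * Real.pi - k * φ := by
          push_cast
          have : (m : ℝ) = 2 * k + 1 := by exact_mod_cast hk
          rw [this] at hmφ
          linarith
        have h2 : (((k : ℤ) - 1 : ℤ) + 1 : ℝ) * φ = k * φ := by
          push_cast
          ring
        rw [h1, h2, Real.sin_two_pi_sub, neg_add_cancel, zero_div]
      rw [e1, e2, e3, e4, hz]
      simp

end CoxeterMatrix

namespace CoxeterSystem

variable {B W : Type*} [Group W] {M : CoxeterMatrix B} (cs : CoxeterSystem M W)

/-- Split off on the right the longest alternating word in `i` and `j`, ending in `j`, for which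
lengths add up. -/
theorem exists_alternating_factor {w : W} {i j : B} (hi : ¬ cs.IsRightDescent w i)
    (hj : cs.IsRightDescent w j) :
    ∃ (k : ℕ) (v : W), w = v * cs.wordProd (alternatingWord i j k) ∧
      cs.length v < cs.length w ∧ (M i j = 0 ∨ k + 1 ≤ M i j) ∧
      ¬ cs.IsRightDescent v i ∧ ¬ cs.IsRightDescent v j := by
  classical
  let P (k : ℕ) : Prop := ∃ v, w = v * cs.wordProd (alternatingWord i j k) ∧
    cs.length w = cs.length v + k
  have hP1 : P 1 := by
    refine ⟨w * cs.simple j, by simp [alternatingWord], ?_⟩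
    exact (cs.isRightDescent_iff.1 hj).symm
  have hbound (k : ℕ) (hk : P k) : k ≤ cs.length w := by
    obtain ⟨v, -, hv⟩ := hk
    omega
  obtain ⟨v, hv, hlen⟩ : P (Nat.findGreatest P (cs.length w)) :=
    Nat.findGreatest_spec (hbound 1 hP1) hP1
  have hk1 : 1 ≤ Nat.findGreatest P (cs.length w) := Nat.le_findGreatest (hbound 1 hP1) hP1
  have hmax : ¬ P (Nat.findGreatest P (cs.length w) + 1) := fun h => by
    have := Nat.le_findGreatest (hbound _ h) h
    omega
  set k := Nat.findGreatest P (cs.length w) with hk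
  have hnext : ¬ cs.IsRightDescent v (if Even k then j else i) := by
    intro hdesc
    refine hmax ⟨v * cs.simple (if Even k then j else i), ?_, ?_⟩
    · rw [alternatingWord_succ', wordProd_cons, ← mul_assoc, simple_mul_simple_cancel_right, hv]
    · have := cs.isRightDescent_iff.1 hdesc
      omega
  obtain ⟨k', hk'⟩ : ∃ k', k = k' + 1 := ⟨k - 1, by omega⟩
  -- Otherwise `w` would be a product of elements of length at most `ℓ(v) - 1` and `k - 1`.
  have hprev : ¬ cs.IsRightDescent v (if Even k' then j else i) := by
    intro hdesc
    have h1 := cs.isRightDescent_iff.1 hdesc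
    have h2 : w = v * cs.simple (if Even k' then j else i) *
        cs.wordProd (alternatingWord i j k') := by
      rw [hv, hk', alternatingWord_succ', wordProd_cons, mul_assoc]
    have h3 := cs.length_mul_le (v * cs.simple (if Even k' then j else i))
      (cs.wordProd (alternatingWord i j k'))
    have h4 := cs.length_wordProd_le (alternatingWord i j k')
    rw [length_alternatingWord] at h4
    rw [← h2] at h3
    omega
  have hboth : ¬ cs.IsRightDescent v i ∧ ¬ cs.IsRightDescent v j := by
    rw [hk'] at hnext
    by_cases he : Even k'
    · rw [if_pos he] at hprev
      rw [if_neg (by simpa [Nat.even_add_one] using he)] at hnext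
      exact ⟨hnext, hprev⟩
    · rw [if_neg he] at hprev
      rw [if_pos (by simpa [Nat.even_add_one] using he)] at hnext
      exact ⟨hprev, hnext⟩
  refine ⟨k, v, hv, by omega, ?_, hboth⟩
  by_contra hcon
  push Not at hcon
  -- As `i` is not a descent of `w`, the alternating word can be prolonged by `i` and stays reduced.
  -- This bounds its length by `M i j`.
  have hred : cs.IsReduced (alternatingWord j i (k + 1)) := by
    have h1 := cs.not_isRightDescent_iff.1 hi
    have h2 : w * cs.simple i = v * cs.wordProd (alternatingWord j i (k + 1)) := by
      rw [alternatingWord_succ, wordProd_concat, hv, mul_assoc]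
    have h3 := cs.length_mul_le v (cs.wordProd (alternatingWord j i (k + 1)))
    have h4 := cs.length_wordProd_le (alternatingWord j i (k + 1))
    rw [← h2] at h3
    rw [IsReduced]
    rw [length_alternatingWord] at h4 ⊢
    omega
  rw [M.symmetric i j] at hcon
  exact cs.not_isReduced_alternatingWord j i hcon.1 hcon.2 hred

/-- The simple root with index `i`. -/
def simpleRoot [DecidableEq B] (i : B) : B → ℝ := Pi.single i 1

theorem simpleRoot_nonneg [DecidableEq B] (i : B) : 0 ≤ simpleRoot i :=
  Pi.single_nonneg.2 zero_le_one

variable [Fintype B] [DecidableEq B]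

/-- The geometric representation of a Coxeter group. -/
noncomputable def geomRep : W →* ((B → ℝ) ≃ₗ[ℝ] (B → ℝ)) :=
  cs.lift ⟨M.simpleReflection, M.isLiftable_simpleReflection⟩

theorem geomRep_simple (i : B) (x : B → ℝ) :
    cs.geomRep (cs.simple i) x = x - M.simpleCoroot i x • simpleRoot i := by
  rw [geomRep, cs.lift_apply_simple, CoxeterMatrix.simpleReflection_apply, simpleRoot]

theorem geomRep_mul (v w : W) (x : B → ℝ) :
    cs.geomRep (v * w) x = cs.geomRep v (cs.geomRep w x) := by
  rw [map_mul, LinearEquiv.mul_apply]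

theorem geomRep_one (x : B → ℝ) : cs.geomRep 1 x = x := by
  rw [map_one]; rfl

theorem geomRep_inv_apply_self (w : W) (x : B → ℝ) :
    cs.geomRep w⁻¹ (cs.geomRep w x) = x := by
  rw [← geomRep_mul, inv_mul_cancel, geomRep_one]

theorem geomRep_apply_inv_self (w : W) (x : B → ℝ) :
    cs.geomRep w (cs.geomRep w⁻¹ x) = x := by
  rw [← geomRep_mul, mul_inv_cancel, geomRep_one]

theorem simpleCoroot_simpleRoot (i j : B) :
    M.simpleCoroot i (simpleRoot j) = 2 * M.cosForm i j :=
  M.simpleCoroot_single i j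

theorem geomRep_simple_self (i : B) :
    cs.geomRep (cs.simple i) (simpleRoot i) = - simpleRoot i := by
  rw [geomRep_simple, simpleCoroot_simpleRoot, M.cosForm_self]
  module

open Polynomial.Chebyshev in
-- Each further letter is one step of the recurrence for the Chebyshev polynomials `S`.
theorem geomRep_alternatingWord (i j : B) (k : ℕ) :
    cs.geomRep (cs.wordProd (alternatingWord i j k)) (simpleRoot i) =
      if Even k then
        (S ℝ k).eval (-2 * M.cosForm i j) • simpleRoot i +
          (S ℝ (k - 1)).eval (-2 * M.cosForm i j) • simpleRoot j
      else (S ℝ (k - 1)).eval (-2 * M.cosForm i j) • simpleRoot i +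
          (S ℝ k).eval (-2 * M.cosForm i j) • simpleRoot j := by
  induction k with
  | zero => simp [alternatingWord]
  | succ k ih =>
    have hS : (S ℝ (k + 1)).eval (-2 * M.cosForm i j) =
        -2 * M.cosForm i j * (S ℝ k).eval (-2 * M.cosForm i j) -
          (S ℝ (k - 1)).eval (-2 * M.cosForm i j) := by
      simp [S_add_one]
    rw [alternatingWord_succ', wordProd_cons, geomRep_mul, ih]
    push_cast
    rw [add_sub_cancel_right, hS]
    by_cases hk : Even k
    · have hk' : ¬ Even (k + 1) := by simpa [Nat.even_add_one] using hk
      rw [if_pos hk, if_pos hk, if_neg hk', geomRep_simple]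
      simp only [map_add, map_smul, simpleCoroot_simpleRoot, M.cosForm_self, M.cosForm_comm j i,
        smul_eq_mul]
      module
    · have hk' : Even (k + 1) := by simpa [Nat.even_add_one] using hk
      rw [if_neg hk, if_neg hk, if_pos hk', geomRep_simple]
      simp only [map_add, map_smul, simpleCoroot_simpleRoot, M.cosForm_self, smul_eq_mul]
      module

/-- Reduction to rank two: the alternating factor sends the simple root to a nonnegative combination
of two simple roots, and the remaining factor is shorter and has neither letter as a descent. -/
theorem geomRep_simpleRoot_nonneg {w : W} {i : B} (hi : ¬ cs.IsRightDescent w i) :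
    0 ≤ cs.geomRep w (simpleRoot i) := by
  induction hd : cs.length w using Nat.strong_induction_on generalizing w i with
  | _ d ih =>
    by_cases hw : w = 1
    · rw [hw, geomRep_one]
      exact simpleRoot_nonneg i
    obtain ⟨j, hj⟩ := cs.exists_rightDescent_of_ne_one hw
    have hij : i ≠ j := fun h => hi (h ▸ hj)
    obtain ⟨k, v, hv, hlt, hk, hvi, hvj⟩ := cs.exists_alternating_factor hi hj
    have h1 := ih _ (hd ▸ hlt) hvi rfl
    have h2 := ih _ (hd ▸ hlt) hvj rfl
    have h3 := M.chebyshev_cosForm_nonneg hij (k := k) (by omega) (by omega)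
    have h4 := M.chebyshev_cosForm_nonneg hij (k := k - 1) (by omega) (by omega)
    rw [hv, geomRep_mul, geomRep_alternatingWord]
    split_ifs
    · rw [map_add, map_smul, map_smul]
      exact add_nonneg (smul_nonneg h3 h1) (smul_nonneg h4 h2)
    · rw [map_add, map_smul, map_smul]
      exact add_nonneg (smul_nonneg h4 h1) (smul_nonneg h3 h2)

theorem geomRep_simpleRoot_nonpos {w : W} {i : B} (hi : cs.IsRightDescent w i) :
    cs.geomRep w (simpleRoot i) ≤ 0 := by
  have h1 := cs.geomRep_simpleRoot_nonneg (cs.isRightDescent_iff_not_isRightDescent_mul.1 hi)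
  rw [geomRep_mul, geomRep_simple_self, map_neg] at h1
  exact neg_nonneg.1 h1

end CoxeterSystem

/-! ### Roots -/

namespace CoxeterSystem

variable {B W : Type*} [Group W] {M : CoxeterMatrix B} (cs : CoxeterSystem M W)

theorem length_le_length_longest [Finite W] (w : W) : cs.length w ≤ cs.length cs.longest :=
  (Finite.exists_max cs.length).choose_spec w

theorem isRightDescent_longest [Finite W] (i : B) : cs.IsRightDescent cs.longest i := by
  by_contra h
  have h1 := cs.not_isRightDescent_iff.1 h
  have h2 := cs.length_le_length_longest (cs.longest * cs.simple i)
  omega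

variable [Fintype B] [DecidableEq B]

theorem eq_sum_smul_simpleRoot (x : B → ℝ) : x = ∑ i, x i • simpleRoot i := by
  ext j
  simp [simpleRoot, Finset.sum_apply, Pi.single_apply]

/-- The roots of a Coxeter system. -/
def rootSet : Set (B → ℝ) := {x | ∃ w i, x = cs.geomRep w (simpleRoot i)}

theorem geomRep_simpleRoot_mem (w : W) (i : B) : cs.geomRep w (simpleRoot i) ∈ cs.rootSet :=
  ⟨w, i, rfl⟩

theorem simpleRoot_mem (i : B) : simpleRoot i ∈ cs.rootSet := ⟨1, i, (cs.geomRep_one _).symm⟩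

variable {cs} in
theorem geomRep_mem (w : W) {x : B → ℝ} (hx : x ∈ cs.rootSet) : cs.geomRep w x ∈ cs.rootSet := by
  obtain ⟨v, i, rfl⟩ := hx
  exact ⟨w * v, i, (cs.geomRep_mul _ _ _).symm⟩

variable {cs} in
theorem neg_mem_rootSet {x : B → ℝ} (hx : x ∈ cs.rootSet) : -x ∈ cs.rootSet := by
  obtain ⟨v, i, rfl⟩ := hx
  exact ⟨v * cs.simple i, i, by rw [geomRep_mul, geomRep_simple_self, map_neg]⟩

variable {cs} in
theorem ne_zero_of_mem_rootSet {x : B → ℝ} (hx : x ∈ cs.rootSet) : x ≠ 0 := by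
  obtain ⟨v, i, rfl⟩ := hx
  rw [Ne, LinearEquiv.map_eq_zero_iff]
  intro h
  simpa [simpleRoot] using congrFun h i

variable {cs} in
theorem nonneg_or_nonpos_of_mem_rootSet {x : B → ℝ} (hx : x ∈ cs.rootSet) : 0 ≤ x ∨ x ≤ 0 := by
  obtain ⟨v, i, rfl⟩ := hx
  by_cases h : cs.IsRightDescent v i
  · exact Or.inr (cs.geomRep_simpleRoot_nonpos h)
  · exact Or.inl (cs.geomRep_simpleRoot_nonneg h)

variable {cs} in
theorem not_nonpos_of_nonneg {x : B → ℝ} (hx : x ∈ cs.rootSet) (h : 0 ≤ x) : ¬ x ≤ 0 :=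
  fun h' => ne_zero_of_mem_rootSet hx (le_antisymm h' h)

theorem isRightDescent_iff_nonpos {w : W} {i : B} :
    cs.IsRightDescent w i ↔ cs.geomRep w (simpleRoot i) ≤ 0 := by
  refine ⟨cs.geomRep_simpleRoot_nonpos, fun h => ?_⟩
  by_contra hcon
  exact not_nonpos_of_nonneg (cs.geomRep_simpleRoot_mem w i) (cs.geomRep_simpleRoot_nonneg hcon) h

theorem not_isRightDescent_iff_nonneg {w : W} {i : B} :
    ¬ cs.IsRightDescent w i ↔ 0 ≤ cs.geomRep w (simpleRoot i) := by
  refine ⟨cs.geomRep_simpleRoot_nonneg, fun h hcon => ?_⟩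
  exact not_nonpos_of_nonneg (cs.geomRep_simpleRoot_mem w i) h (cs.geomRep_simpleRoot_nonpos hcon)

theorem eq_one_of_forall_nonneg {w : W} (h : ∀ i, 0 ≤ cs.geomRep w (simpleRoot i)) : w = 1 := by
  by_contra hw
  obtain ⟨i, hi⟩ := cs.exists_rightDescent_of_ne_one hw
  exact cs.not_isRightDescent_iff_nonneg.2 (h i) hi

theorem geomRep_injective : Function.Injective cs.geomRep := by
  rw [injective_iff_map_eq_one]
  intro w hw
  refine cs.eq_one_of_forall_nonneg fun i => ?_
  rw [hw]
  exact simpleRoot_nonneg i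

/-- This is the invariance of the cosine form, checked on generators. It fixes the scale of the
roots. -/
theorem sum_simpleCoroot_geomRep (w : W) (x : B → ℝ) :
    ∑ i, cs.geomRep w x i * M.simpleCoroot i (cs.geomRep w x) =
      ∑ i, x i * M.simpleCoroot i x := by
  induction w using cs.simple_induction_left with
  | one => rw [geomRep_one]
  | mul_simple_left w k ih =>
    rw [← ih, geomRep_mul]
    set y := cs.geomRep w x
    rw [geomRep_simple]
    have h1 : ∑ i, y i * (2 * M.cosForm i k) = M.simpleCoroot k y := by
      rw [CoxeterMatrix.simpleCoroot_apply]
      exact Finset.sum_congr rfl fun i _ => by rw [M.cosForm_comm]; ring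
    have h2 (i : B) : (y - M.simpleCoroot k y • simpleRoot k) i *
        M.simpleCoroot i (y - M.simpleCoroot k y • simpleRoot k) =
        y i * M.simpleCoroot i y - M.simpleCoroot k y * (y i * (2 * M.cosForm i k)) -
        simpleRoot k i * (M.simpleCoroot k y * M.simpleCoroot i y) +
        simpleRoot k i * (M.simpleCoroot k y * M.simpleCoroot k y * (2 * M.cosForm i k)) := by
      rw [map_sub, map_smul, simpleCoroot_simpleRoot]
      simp only [Pi.sub_apply, Pi.smul_apply, smul_eq_mul]
      ring
    have h3 (f : B → ℝ) : ∑ i, simpleRoot k i * f i = f k := by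
      simp [simpleRoot, Pi.single_apply]
    rw [Finset.sum_congr rfl fun i _ => h2 i, Finset.sum_add_distrib, Finset.sum_sub_distrib,
      Finset.sum_sub_distrib, ← Finset.mul_sum, h1, h3, h3, M.cosForm_self]
    ring

variable {cs} in
-- All roots have the same norm for the cosine form, so the only coefficient has square one.
theorem eq_simpleRoot_of_mem_rootSet {x : B → ℝ} (hx : x ∈ cs.rootSet) (h : 0 ≤ x) {i : B}
    (hi : ∀ j ≠ i, x j = 0) : x = simpleRoot i := by
  have hxi : x = x i • simpleRoot i := by
    ext j
    by_cases hj : j = i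
    · subst hj
      simp [simpleRoot]
    · simp [simpleRoot, hi j hj, hj]
  have hsum (j : B) : ∑ k, simpleRoot j k * M.simpleCoroot k (simpleRoot j) = 2 := by
    simp only [simpleCoroot_simpleRoot]
    simp [simpleRoot, Pi.single_apply, M.cosForm_self]
  have hx2 : x i * x i = 1 := by
    obtain ⟨w, j, hw⟩ := hx
    have h1 := cs.sum_simpleCoroot_geomRep w (simpleRoot j)
    rw [hsum, ← hw] at h1
    have h2 : ∑ k, x k * M.simpleCoroot k x = x i * x i * 2 := by
      rw [← hsum i, Finset.mul_sum]
      refine Finset.sum_congr rfl fun k _ => ?_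
      rw [hxi, map_smul]
      simp [simpleRoot]
      ring
    linarith
  have h0 : 0 ≤ x i := h i
  have : x i = 1 := by nlinarith
  rw [hxi, this, one_smul]

variable {cs} in
-- The reflection changes only the coordinate `i`. Some other coordinate is positive and survives,
-- and roots do not have mixed signs.
theorem geomRep_simple_nonneg {x : B → ℝ} (hx : x ∈ cs.rootSet) (h : 0 ≤ x) {i : B}
    (hxi : x ≠ simpleRoot i) : 0 ≤ cs.geomRep (cs.simple i) x := by
  obtain ⟨j, hji, hj⟩ : ∃ j, j ≠ i ∧ x j ≠ 0 := by
    by_contra hcon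
    push Not at hcon
    exact hxi (eq_simpleRoot_of_mem_rootSet hx h hcon)
  refine (nonneg_or_nonpos_of_mem_rootSet (geomRep_mem _ hx)).resolve_right fun hcon => hj ?_
  have h1 := hcon j
  rw [geomRep_simple] at h1
  simp only [simpleRoot, Pi.sub_apply, Pi.smul_apply, Pi.single_eq_of_ne hji, smul_zero,
    sub_zero] at h1
  exact le_antisymm h1 (h j)

/-! ### The invariant inner product -/

section Finite

variable [Finite W]

/-- An inner product on the geometric representation of a finite Coxeter group that is invariant
under the group. -/
noncomputable def innerForm : LinearMap.BilinForm ℝ (B → ℝ) :=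
  letI := Fintype.ofFinite W
  ∑ w : W, (dotProductBilin ℝ ℝ).compl₁₂ (cs.geomRep w).toLinearMap (cs.geomRep w).toLinearMap

theorem innerForm_apply [Fintype W] (x y : B → ℝ) :
    cs.innerForm x y = ∑ w : W, cs.geomRep w x ⬝ᵥ cs.geomRep w y := by
  rw [innerForm, LinearMap.sum_apply, LinearMap.sum_apply]
  convert rfl
  rfl

theorem innerForm_comm (x y : B → ℝ) : cs.innerForm x y = cs.innerForm y x := by
  let := Fintype.ofFinite W
  simp only [innerForm_apply, dotProduct_comm]

theorem innerForm_pos {x : B → ℝ} (hx : x ≠ 0) : 0 < cs.innerForm x x := by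
  let := Fintype.ofFinite W
  rw [innerForm_apply]
  refine Finset.sum_pos (fun w _ => ?_) ⟨1, Finset.mem_univ _⟩
  have : cs.geomRep w x ≠ 0 := by rwa [Ne, LinearEquiv.map_eq_zero_iff]
  refine lt_of_le_of_ne ?_ (fun h => this (dotProduct_self_eq_zero.1 h.symm))
  exact Finset.sum_nonneg fun i _ => mul_self_nonneg _

theorem innerForm_geomRep (w : W) (x y : B → ℝ) :
    cs.innerForm (cs.geomRep w x) (cs.geomRep w y) = cs.innerForm x y := by
  let := Fintype.ofFinite W
  rw [innerForm_apply, innerForm_apply]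
  simp only [← geomRep_mul]
  exact Fintype.sum_equiv (Equiv.mulRight w) _ _ fun v => rfl

theorem innerForm_geomRep_left (w : W) (x y : B → ℝ) :
    cs.innerForm (cs.geomRep w x) y = cs.innerForm x (cs.geomRep w⁻¹ y) := by
  rw [← cs.innerForm_geomRep w x, geomRep_apply_inv_self]

/-- Invariance under `s_i` forces this proportionality, so `s_i` is an orthogonal reflection for the
averaged inner product. Positive definiteness of the cosine form is not needed. -/
theorem two_mul_innerForm_simpleRoot (i : B) (x : B → ℝ) :
    2 * cs.innerForm x (simpleRoot i) =
      M.simpleCoroot i x * cs.innerForm (simpleRoot i) (simpleRoot i) := by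
  have h := cs.innerForm_geomRep (cs.simple i) x (simpleRoot i)
  rw [geomRep_simple_self, map_neg, geomRep_simple, map_sub, LinearMap.sub_apply, map_smul,
    LinearMap.smul_apply, smul_eq_mul] at h
  linarith

/-- A vector is a normal vector of the element `t` if `t` acts as the orthogonal reflection in the
hyperplane perpendicular to it. -/
def IsNormal (t : W) (β : B → ℝ) : Prop :=
  β ≠ 0 ∧ ∀ x, cs.geomRep t x = x - (2 * cs.innerForm x β / cs.innerForm β β) • β

theorem isNormal_simple (i : B) : cs.IsNormal (cs.simple i) (simpleRoot i) := by
  have h0 := ne_zero_of_mem_rootSet (cs.simpleRoot_mem i)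
  refine ⟨h0, fun x => ?_⟩
  rw [geomRep_simple, two_mul_innerForm_simpleRoot, mul_div_cancel_right₀ _ (cs.innerForm_pos h0).ne']

variable {cs} in
theorem IsNormal.conj {t : W} {β : B → ℝ} (h : cs.IsNormal t β) (w : W) :
    cs.IsNormal (w * t * w⁻¹) (cs.geomRep w β) := by
  refine ⟨by simpa using h.1, fun x => ?_⟩
  rw [geomRep_mul, geomRep_mul, h.2, map_sub, map_smul, geomRep_apply_inv_self, innerForm_geomRep,
    innerForm_geomRep_left, inv_inv]

variable {cs} in
theorem IsNormal.neg {t : W} {β : B → ℝ} (h : cs.IsNormal t β) : cs.IsNormal t (-β) := by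
  refine ⟨neg_ne_zero.2 h.1, fun x => ?_⟩
  rw [h.2]
  simp only [map_neg, LinearMap.neg_apply, neg_neg, smul_neg, mul_neg, neg_div, neg_smul]

variable {cs} in
theorem IsNormal.eq {t t' : W} {β : B → ℝ} (h : cs.IsNormal t β) (h' : cs.IsNormal t' β) :
    t = t' := by
  apply cs.geomRep_injective
  ext1 x
  rw [h.2, h'.2]

theorem isNormal_geomRep (w : W) (i : B) :
    cs.IsNormal (w * cs.simple i * w⁻¹) (cs.geomRep w (simpleRoot i)) :=
  (cs.isNormal_simple i).conj w

/-! ### The longest element -/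

theorem geomRep_longest_nonpos {x : B → ℝ} (hx : 0 ≤ x) : cs.geomRep cs.longest x ≤ 0 := by
  rw [eq_sum_smul_simpleRoot x, map_sum]
  refine Finset.sum_nonpos fun i _ => ?_
  rw [map_smul]
  exact smul_nonpos_of_nonneg_of_nonpos (hx i)
    (cs.geomRep_simpleRoot_nonpos (cs.isRightDescent_longest i))

theorem length_longest_mul_add (w : W) :
    cs.length (cs.longest * w) + cs.length w = cs.length cs.longest := by
  induction hd : cs.length w generalizing w with
  | zero => rw [cs.length_eq_zero_iff.1 hd, mul_one, add_zero]
  | succ d ih =>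
    have hw : w ≠ 1 := fun h => by simp [h] at hd
    obtain ⟨i, hi⟩ := cs.exists_rightDescent_of_ne_one hw
    have h1 := cs.isRightDescent_iff.1 hi
    have h2 := ih (w * cs.simple i) (by omega)
    have h3 : cs.IsRightDescent (cs.longest * (w * cs.simple i)) i := by
      rw [isRightDescent_iff_nonpos, geomRep_mul]
      exact cs.geomRep_longest_nonpos
        (cs.geomRep_simpleRoot_nonneg (cs.isRightDescent_iff_not_isRightDescent_mul.1 hi))
    have h4 := cs.isRightDescent_iff.1 h3
    rw [mul_assoc, simple_mul_simple_cancel_right] at h4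
    omega

theorem longest_mul_longest : cs.longest * cs.longest = 1 := by
  have := cs.length_longest_mul_add cs.longest
  exact cs.length_eq_zero_iff.1 (by omega)

theorem eq_longest_of_forall_isRightDescent {v : W} (h : ∀ i, cs.IsRightDescent v i) :
    v = cs.longest := by
  have : cs.longest * v = 1 := by
    refine cs.eq_one_of_forall_nonneg fun i => ?_
    rw [geomRep_mul, ← neg_neg (cs.geomRep v _), map_neg]
    exact neg_nonneg.2 (cs.geomRep_longest_nonpos
      (neg_nonneg.2 (cs.geomRep_simpleRoot_nonpos (h i))))
  rw [← mul_right_inj cs.longest, this, longest_mul_longest]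

/-- By complementarity of lengths the conjugate has length `N - (N - 1) = 1`. -/
theorem simple_conjLongest (i : B) :
    cs.simple (cs.conjLongest i) = cs.longest * cs.simple i * cs.longest⁻¹ := by
  have h1 := cs.length_longest_mul_add (cs.simple i * cs.longest⁻¹)
  have h2 := cs.isRightDescent_iff.1 (cs.isRightDescent_longest i)
  have h3 : cs.length (cs.simple i * cs.longest⁻¹) = cs.length (cs.longest * cs.simple i) := by
    rw [← cs.length_inv, mul_inv_rev, inv_inv, inv_simple]
  obtain ⟨j, hj⟩ := cs.length_eq_one_iff.1
    (by omega : cs.length (cs.longest * (cs.simple i * cs.longest⁻¹)) = 1)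
  have : Nonempty B := ⟨i⟩
  exact Function.invFun_eq ⟨j, by rw [← hj, mul_assoc]⟩

end Finite

end CoxeterSystem

/-! ### Products of reflections and triangular Gram matrices -/

namespace LinearMap.BilinForm

variable {V : Type*} [AddCommGroup V] [Module ℝ V] (E : LinearMap.BilinForm ℝ V)

/-- The reflection along `g` that is orthogonal for the symmetrization of `E`. -/
noncomputable def reflectAlong (x g : V) : V := x - ((E x g + E g x) / E g g) • g

theorem apply_sub_foldl_reflectAlong_eq_zero {l : List V} {y : V} (h : ∀ g ∈ l, E g y = 0)
    (x : V) : E (x - l.foldl E.reflectAlong x) y = 0 := by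
  induction l generalizing x with
  | nil => simp
  | cons g l ih =>
    have h1 := ih (fun g' hg' => h g' (List.mem_cons_of_mem _ hg')) (E.reflectAlong x g)
    have h2 : E (x - E.reflectAlong x g) y = 0 := by
      rw [reflectAlong, sub_sub_cancel, map_smul, LinearMap.smul_apply, h g (by simp), smul_zero]
    rw [List.foldl_cons, ← sub_add_sub_cancel x (E.reflectAlong x g), map_add,
      LinearMap.add_apply, h1, h2, add_zero]

/-- The difference telescopes into multiples of the vectors of the list. Pairing with the head `g`
sees only the first reflection, since later vectors are killed. For a later `y`, the correction to
`x` by a multiple of `g` cancels, because `E y g = 0`. -/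
theorem apply_sub_foldl_reflectAlong {l : List V} (hl : l.Pairwise fun g g' => E g' g = 0)
    (h0 : ∀ g ∈ l, E g g ≠ 0) (x : V) {y : V} (hy : y ∈ l) :
    E (x - l.foldl E.reflectAlong x) y = E x y + E y x := by
  induction l generalizing x with
  | nil => simp at hy
  | cons g l ih =>
    obtain ⟨hg, hl⟩ := List.pairwise_cons.1 hl
    rw [List.foldl_cons, ← sub_add_sub_cancel x (E.reflectAlong x g), map_add,
      LinearMap.add_apply]
    have hsub : x - E.reflectAlong x g = ((E x g + E g x) / E g g) • g := by
      rw [reflectAlong, sub_sub_cancel]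
    rcases List.mem_cons.1 hy with rfl | hy
    · rw [E.apply_sub_foldl_reflectAlong_eq_zero hg, hsub, map_smul, LinearMap.smul_apply,
        smul_eq_mul, div_mul_cancel₀ _ (h0 y (by simp)), add_zero]
    · rw [ih hl (fun g' hg' => h0 g' (List.mem_cons_of_mem _ hg')) _ hy, hsub]
      simp only [reflectAlong, map_smul, LinearMap.smul_apply, map_sub, LinearMap.sub_apply,
        hg y hy, smul_zero]
      abel

theorem sub_foldl_reflectAlong_mem_span (l : List V) (x : V) :
    x - l.foldl E.reflectAlong x ∈ Submodule.span ℝ {v | v ∈ l} := by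
  induction l generalizing x with
  | nil => simp
  | cons g l ih =>
    rw [List.foldl_cons, ← sub_add_sub_cancel x (E.reflectAlong x g)]
    refine Submodule.add_mem _ ?_ (Submodule.span_mono (fun v hv => List.mem_cons_of_mem _ hv) (ih _))
    rw [reflectAlong, sub_sub_cancel]
    exact Submodule.smul_mem _ _ (Submodule.subset_span (by simp))

/-- By independence, the coefficient of the head of `l₁` in `x - r x` comes from the first
reflection alone. It must vanish, so `x` is fixed by that reflection; then recurse. -/
theorem symm_apply_eq_zero_of_sub_foldl_mem_span {l₁ l₂ : List V}
    (hli : LinearIndependent ℝ (l₁ ++ l₂).get) (h0 : ∀ g ∈ l₁, E g g ≠ 0) {x : V}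
    (hx : x - (l₁ ++ l₂).foldl E.reflectAlong x ∈ Submodule.span ℝ {v | v ∈ l₂}) :
    ∀ g ∈ l₁, E x g + E g x = 0 := by
  induction l₁ generalizing x with
  | nil => simp
  | cons g l₁ ih =>
    rw [List.cons_append] at hx hli
    have hg : g ∉ Submodule.span ℝ {v | v ∈ l₁ ++ l₂} := by
      have hcons : (g :: (l₁ ++ l₂)).get = Fin.cons g (l₁ ++ l₂).get := by
        funext i
        refine Fin.cases ?_ (fun i => ?_) i <;> rfl
      rw [hcons] at hli
      have := (linearIndependent_finCons.1 hli).2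
      rwa [show Set.range (l₁ ++ l₂).get = {v | v ∈ l₁ ++ l₂} from Set.range_list_get _] at this
    have htail : LinearIndependent ℝ (l₁ ++ l₂).get := by
      have := hli.comp (Fin.succ : Fin (l₁ ++ l₂).length → _) (Fin.succ_injective _)
      exact this
    have hxg : E x g + E g x = 0 := by
      by_contra hne
      apply hg
      rw [List.foldl_cons, ← sub_add_sub_cancel x (E.reflectAlong x g)] at hx
      have h1 := E.sub_foldl_reflectAlong_mem_span (l₁ ++ l₂) (E.reflectAlong x g)
      have h2 := Submodule.sub_mem _ (Submodule.span_mono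
        (t := {v | v ∈ l₁ ++ l₂}) (fun v hv => List.mem_append_right _ hv) hx) h1
      rw [add_sub_cancel_right, reflectAlong, sub_sub_cancel] at h2
      exact (Submodule.smul_mem_iff _ (div_ne_zero hne (h0 g (by simp)))).1 h2
    have hr : E.reflectAlong x g = x := by rw [reflectAlong, hxg, zero_div, zero_smul, sub_zero]
    rw [List.foldl_cons, hr] at hx
    intro g' hg'
    rcases List.mem_cons.1 hg' with rfl | hg'
    · exact hxg
    · exact ih htail (fun g hg => h0 g (List.mem_cons_of_mem _ hg)) hx g' hg'

/-- Since `1 - d` is bijective, the `dim V` vectors span and are independent. Choosing `x` with `x -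
d x = l[j]` makes `x` orthogonal to all earlier vectors, and for `i < j` the pairing of `x` with
`l[i]` is `E l[j] l[i]`. -/
theorem pairwise_of_foldl_reflectAlong [FiniteDimensional ℝ V] (hE : ∀ x, x ≠ 0 → 0 < E x x)
    {l : List V} (hlen : l.length = Module.finrank ℝ V) (h0 : ∀ g ∈ l, g ≠ 0)
    {d : V →ₗ[ℝ] V} (hd : ∀ x, l.foldl E.reflectAlong x = d x)
    (hdE : ∀ x y, E (x - d x) y = E x y + E y x) : l.Pairwise fun g g' => E g' g = 0 := by
  have hinj : Function.Injective (LinearMap.id - d : V →ₗ[ℝ] V) := by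
    rw [injective_iff_map_eq_zero]
    intro x hx
    have h1 := hdE x x
    change x - d x = 0 at hx
    rw [hx, map_zero, LinearMap.zero_apply] at h1
    by_contra hne
    linarith [hE x hne]
  have hsurj := LinearMap.injective_iff_surjective.1 hinj
  have hli : LinearIndependent ℝ l.get := by
    refine linearIndependent_of_top_le_span_of_card_eq_finrank ?_ (by simp [hlen])
    intro v _
    obtain ⟨x, rfl⟩ := hsurj v
    have := E.sub_foldl_reflectAlong_mem_span l x
    rw [hd] at this
    rwa [Set.range_list_get]
  rw [List.pairwise_iff_getElem]
  intro i j hi hj hij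
  obtain ⟨x, hx⟩ := hsurj l[j]
  change x - d x = l[j] at hx
  have hsplit : l.take j ++ l.drop j = l := List.take_append_drop j l
  have hz := E.symm_apply_eq_zero_of_sub_foldl_mem_span (l₁ := l.take j) (l₂ := l.drop j) (x := x)
    (hsplit.symm ▸ hli) (fun g hg => (hE g (h0 g (List.mem_of_mem_take hg))).ne') (by
      rw [hsplit, hd, hx]
      refine Submodule.subset_span ?_
      change l[j] ∈ l.drop j
      rw [List.drop_eq_getElem_cons hj]
      exact List.mem_cons_self)
  rw [← hx, hdE]
  exact hz _ (List.mem_take_iff_getElem.2 ⟨i, by omega, rfl⟩)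

end LinearMap.BilinForm

namespace CoxeterSystem

theorem IsCoxeterWord.pairwise_reverse_idxOf {B : Type*} [DecidableEq B] {c : List B}
    (hc : IsCoxeterWord c) :
    c.reverse.Pairwise fun i j => c.idxOf j < c.idxOf i := by
  rw [List.pairwise_reverse, List.pairwise_iff_getElem]
  intro i j hi hj hij
  rwa [hc.1.idxOf_getElem, hc.1.idxOf_getElem]

variable {B W : Type*} [Group W] {M : CoxeterMatrix B} (cs : CoxeterSystem M W)
  [Fintype B] [DecidableEq B] [Finite W]

/-! ### The Euler form of a Coxeter word -/

/-- The bilinear form with symmetrization `cs.innerForm` whose Gram matrix on the simple roots,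
taken in the order of the word `c`, is lower triangular. -/
noncomputable def eulerForm (c : List B) : LinearMap.BilinForm ℝ (B → ℝ) :=
  Matrix.toBilin' (Matrix.of fun i j =>
    if i = j then cs.innerForm (simpleRoot i) (simpleRoot j) / 2
    else if c.idxOf j < c.idxOf i then cs.innerForm (simpleRoot i) (simpleRoot j) else 0)

theorem eulerForm_simpleRoot (c : List B) (i j : B) :
    cs.eulerForm c (simpleRoot i) (simpleRoot j) =
      if i = j then cs.innerForm (simpleRoot i) (simpleRoot j) / 2
      else if c.idxOf j < c.idxOf i then cs.innerForm (simpleRoot i) (simpleRoot j) else 0 := by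
  rw [eulerForm, simpleRoot, simpleRoot, Matrix.toBilin'_single]
  rfl

theorem linearMap_ext_simpleRoot {f g : (B → ℝ) →ₗ[ℝ] ℝ}
    (h : ∀ i, f (simpleRoot i) = g (simpleRoot i)) : f = g :=
  LinearMap.pi_ext' fun i => LinearMap.ext_ring (h i)

variable {cs} {c : List B}

theorem eulerForm_add_flip (hc : IsCoxeterWord c) (x y : B → ℝ) :
    cs.eulerForm c x y + cs.eulerForm c y x = cs.innerForm x y := by
  have key : ∀ i, (LinearMap.flip (cs.eulerForm c) + cs.eulerForm c) (simpleRoot i) =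
      cs.innerForm (simpleRoot i) := by
    intro i
    refine linearMap_ext_simpleRoot fun j => ?_
    rw [LinearMap.add_apply, LinearMap.add_apply, LinearMap.flip_apply, eulerForm_simpleRoot,
      eulerForm_simpleRoot]
    by_cases hij : i = j
    · subst hij
      simp
    · have hne : c.idxOf i ≠ c.idxOf j := fun h => hij ((List.idxOf_inj (hc.2 i)).1 h)
      rw [if_neg (Ne.symm hij), if_neg hij]
      rcases lt_or_gt_of_ne hne with h | h
      · rw [if_pos h, if_neg h.not_gt, add_zero, innerForm_comm]
      · rw [if_neg h.not_gt, if_pos h, zero_add]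
  have h2 : LinearMap.flip (cs.eulerForm c) + cs.eulerForm c = cs.innerForm :=
    LinearMap.pi_ext' fun i => LinearMap.ext_ring (key i)
  rw [← h2, add_comm]
  rfl

theorem eulerForm_self (hc : IsCoxeterWord c) (x : B → ℝ) :
    cs.eulerForm c x x = cs.innerForm x x / 2 := by
  linarith [eulerForm_add_flip (cs := cs) hc x x]

theorem eulerForm_pos (hc : IsCoxeterWord c) {x : B → ℝ} (hx : x ≠ 0) :
    0 < cs.eulerForm c x x := by
  rw [eulerForm_self hc]
  exact half_pos (cs.innerForm_pos hx)

theorem IsNormal.reflectAlong (hc : IsCoxeterWord c) {t : W} {β : B → ℝ} (h : cs.IsNormal t β)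
    (x : B → ℝ) : (cs.eulerForm c).reflectAlong x β = cs.geomRep t x := by
  rw [h.2, LinearMap.BilinForm.reflectAlong, eulerForm_add_flip hc, eulerForm_self hc]
  congr 2
  rw [div_div_eq_mul_div, mul_comm]

/-- The fold applies the head first, which reverses the product; for involutions the reversed
product is the inverse. -/
theorem foldl_reflectAlong (hc : IsCoxeterWord c) {ι : Type*} (l : List ι) {t : ι → W}
    {β : ι → B → ℝ} (h : ∀ i ∈ l, cs.IsNormal (t i) (β i)) (x : B → ℝ) :
    (l.map β).foldl (cs.eulerForm c).reflectAlong x = cs.geomRep (l.map t).prod⁻¹ x := by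
  induction l generalizing x with
  | nil => simp
  | cons i l ih =>
    have hi := h i (by simp)
    rw [List.map_cons, List.foldl_cons, hi.reflectAlong hc,
      ih fun j hj => h j (List.mem_cons_of_mem _ hj), List.map_cons, List.prod_cons, mul_inv_rev,
      geomRep_mul]
    congr 1
    have hinv : (t i)⁻¹ = t i := by
      rw [inv_eq_iff_mul_eq_one]
      apply cs.geomRep_injective
      ext1 y
      rw [geomRep_mul, hi.2, hi.2, map_one]
      have hne := (cs.innerForm_pos hi.1).ne'
      simp only [map_sub, map_smul, LinearMap.sub_apply, LinearMap.smul_apply, smul_eq_mul]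
      rw [div_mul_cancel₀ _ hne, ← sub_eq_zero, LinearEquiv.coe_one, id]
      module
    rw [hinv]

/-- The last letter of `c` acts first, so the general formula is applied to the reversed word, along
which `E` is triangular. -/
theorem eulerForm_sub_wordProd (hc : IsCoxeterWord c) (x y : B → ℝ) :
    cs.eulerForm c (x - cs.geomRep (cs.wordProd c) x) y = cs.innerForm x y := by
  have hfold := foldl_reflectAlong (cs := cs) hc c.reverse (t := cs.simple) (β := simpleRoot)
    (fun i _ => cs.isNormal_simple i) x
  have hprod : ((c.reverse.map cs.simple).prod)⁻¹ = cs.wordProd c := by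
    have := cs.wordProd_reverse c
    rw [wordProd] at this
    rw [this, inv_inv]
  rw [hprod] at hfold
  rw [← hfold]
  refine LinearMap.congr_fun (linearMap_ext_simpleRoot fun i => ?_) y
  rw [LinearMap.BilinForm.apply_sub_foldl_reflectAlong, eulerForm_add_flip hc]
  · rw [List.pairwise_map]
    refine hc.pairwise_reverse_idxOf.imp fun {i j} hij => ?_
    rw [eulerForm_simpleRoot, if_neg (fun h => by simp [h] at hij), if_neg hij.not_gt]
  · intro g hg
    obtain ⟨i, -, rfl⟩ := List.mem_map.1 hg
    exact (eulerForm_pos hc (ne_zero_of_mem_rootSet (cs.simpleRoot_mem i))).ne'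
  · exact List.mem_map_of_mem (List.mem_reverse.2 (hc.2 i))

theorem eulerForm_serre (hc : IsCoxeterWord c) (x y : B → ℝ) :
    cs.eulerForm c y x = - cs.eulerForm c (cs.geomRep (cs.wordProd c) x) y := by
  have h1 := eulerForm_sub_wordProd (cs := cs) hc x y
  have h2 := eulerForm_add_flip (cs := cs) hc x y
  rw [map_sub, LinearMap.sub_apply] at h1
  linarith

theorem eulerForm_wordProd (hc : IsCoxeterWord c) (x y : B → ℝ) :
    cs.eulerForm c (cs.geomRep (cs.wordProd c) x) (cs.geomRep (cs.wordProd c) y) =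
      cs.eulerForm c x y := by
  rw [eulerForm_serre hc y x, eulerForm_serre hc x (cs.geomRep (cs.wordProd c) y), neg_neg]

end CoxeterSystem

/-! ### The roots of the word `c^∞` -/

namespace CoxeterSystem

section Letters

variable {B W : Type*} [Group W] {M : CoxeterMatrix B} (cs : CoxeterSystem M W) {c : List B}

/-- The letter at position `k` of `c^∞`, for a nonempty word `c`. -/
def cyclicLetter (c : List B) (hn : 0 < c.length) (k : ℕ) : B :=
  getElem c (k % c.length) (Nat.mod_lt _ hn)

theorem infiniteLetter_eq_some (hn : 0 < c.length) (k : ℕ) :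
    infiniteLetter c k = some (cyclicLetter c hn k) :=
  List.getElem?_eq_getElem _

theorem exists_cyclicLetter_eq (hc : IsCoxeterWord c) (hn : 0 < c.length) (i : B) :
    ∃ a < c.length, cyclicLetter c hn a = i := by
  obtain ⟨a, ha, rfl⟩ := List.mem_iff_getElem.1 (hc.2 i)
  refine ⟨a, ha, ?_⟩
  simp only [cyclicLetter, Nat.mod_eq_of_lt ha]

theorem cyclicLetter_add_mul (hn : 0 < c.length) (k r : ℕ) :
    cyclicLetter c hn (k + r * c.length) = cyclicLetter c hn k := by
  simp only [cyclicLetter, Nat.add_mul_mod_self_right]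

/-- The product of the first `k` letters of `c^∞`. -/
def prefixElement (c : List B) (k : ℕ) : W :=
  cs.wordProd c ^ (k / c.length) * cs.wordProd (c.take (k % c.length))

theorem prefixElement_of_lt {k : ℕ} (hk : k < c.length) :
    cs.prefixElement c k = cs.wordProd (c.take k) := by
  rw [prefixElement, Nat.div_eq_of_lt hk, Nat.mod_eq_of_lt hk, pow_zero, one_mul]

theorem prefixElement_zero : cs.prefixElement c 0 = 1 := by
  simp [prefixElement]

theorem prefixElement_length (hn : 0 < c.length) :
    cs.prefixElement c c.length = cs.wordProd c := by
  simp [prefixElement, Nat.div_self hn]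

theorem prefixElement_add_mul (hn : 0 < c.length) (k r : ℕ) :
    cs.prefixElement c (k + r * c.length) = cs.wordProd c ^ r * cs.prefixElement c k := by
  rw [prefixElement, prefixElement, Nat.add_mul_div_right _ _ hn, Nat.add_mul_mod_self_right,
    add_comm (k / c.length), pow_add, mul_assoc]

theorem prefixElement_succ (hn : 0 < c.length) (k : ℕ) :
    cs.prefixElement c (k + 1) = cs.prefixElement c k * cs.simple (cyclicLetter c hn k) := by
  have hlt := Nat.mod_lt k hn
  have hk : k % c.length + k / c.length * c.length = k := by
    rw [mul_comm]
    exact Nat.mod_add_div k c.length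
  have htake : cs.wordProd (c.take (k % c.length)) * cs.simple (cyclicLetter c hn k) =
      cs.wordProd (c.take (k % c.length + 1)) := by
    rw [List.take_succ_eq_append_getElem hlt, wordProd_append, wordProd_singleton, cyclicLetter]
  have h1 : cs.prefixElement c (k + 1) =
      cs.wordProd c ^ (k / c.length) * cs.prefixElement c (k % c.length + 1) := by
    rw [← cs.prefixElement_add_mul hn]
    congr 1
    omega
  rw [h1]
  conv_rhs => rw [prefixElement, mul_assoc, htake]
  rcases Nat.lt_or_ge (k % c.length + 1) c.length with h | h
  · rw [cs.prefixElement_of_lt h]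
  · have : k % c.length + 1 = c.length := by omega
    rw [this, cs.prefixElement_length hn, List.take_length]

end Letters

variable {B W : Type*} [Group W] {M : CoxeterMatrix B} (cs : CoxeterSystem M W)
  [Fintype B] [DecidableEq B] {c : List B}

theorem geomRep_wordProd_apply_of_notMem {l : List B} {i : B} (hi : i ∉ l) (x : B → ℝ) :
    cs.geomRep (cs.wordProd l) x i = x i := by
  induction l with
  | nil => simp
  | cons j l ih =>
    rw [List.mem_cons, not_or] at hi
    rw [wordProd_cons, geomRep_mul, geomRep_simple, Pi.sub_apply, ih hi.2, Pi.smul_apply,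
      simpleRoot, Pi.single_eq_of_ne hi.1, smul_zero, sub_zero]

/-- The root at position `k` of `c^∞`. -/
noncomputable def cyclicRoot (hn : 0 < c.length) (k : ℕ) : B → ℝ :=
  cs.geomRep (cs.prefixElement c k) (simpleRoot (cyclicLetter c hn k))

theorem cyclicRoot_mem (hn : 0 < c.length) (k : ℕ) : cs.cyclicRoot hn k ∈ cs.rootSet :=
  cs.geomRep_simpleRoot_mem _ _

theorem cyclicRoot_add_mul (hn : 0 < c.length) (k r : ℕ) :
    cs.cyclicRoot hn (k + r * c.length) = cs.geomRep (cs.wordProd c ^ r) (cs.cyclicRoot hn k) := by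
  rw [cyclicRoot, cyclicRoot, cyclicLetter_add_mul, prefixElement_add_mul _ hn, geomRep_mul]

theorem cyclicRoot_add_length (hn : 0 < c.length) (k : ℕ) :
    cs.cyclicRoot hn (k + c.length) = cs.geomRep (cs.wordProd c) (cs.cyclicRoot hn k) := by
  have := cs.cyclicRoot_add_mul hn k 1
  rwa [one_mul, pow_one] at this

theorem cyclicRoot_apply_of_lt (hc : IsCoxeterWord c) (hn : 0 < c.length) {a b : ℕ}
    (hab : a ≤ b) (hb : b < c.length) :
    cs.cyclicRoot hn a (cyclicLetter c hn b) = if a = b then 1 else 0 := by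
  have ha := hab.trans_lt hb
  have hlb : cyclicLetter c hn b = getElem c b hb := by simp only [cyclicLetter, Nat.mod_eq_of_lt hb]
  have hla : cyclicLetter c hn a = getElem c a ha := by simp only [cyclicLetter, Nat.mod_eq_of_lt ha]
  rw [cyclicRoot, prefixElement_of_lt _ ha, geomRep_wordProd_apply_of_notMem, hla, hlb, simpleRoot,
    Pi.single_apply]
  · simp only [hc.1.getElem_inj_iff, eq_comm]
  · rw [hlb]
    intro h
    obtain ⟨j, hj, hj'⟩ := List.mem_take_iff_getElem.1 h
    have := (hc.1.getElem_inj_iff).1 hj'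
    omega

theorem cyclicRoot_nonneg_of_lt (hc : IsCoxeterWord c) (hn : 0 < c.length) {a : ℕ}
    (ha : a < c.length) : 0 ≤ cs.cyclicRoot hn a := by
  refine (nonneg_or_nonpos_of_mem_rootSet (cs.cyclicRoot_mem hn a)).resolve_right fun h => ?_
  have h1 := h (cyclicLetter c hn a)
  rw [cs.cyclicRoot_apply_of_lt hc hn le_rfl ha, if_pos rfl] at h1
  exact absurd h1 (by simp)

/-- Apply the inverse letters of `c` one at a time: a positive root turns negative only at the step
where it is the simple root of that letter. -/
theorem exists_eq_cyclicRoot_of_nonpos (hn : 0 < c.length) {y : B → ℝ} (hy : y ∈ cs.rootSet)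
    (hpos : 0 ≤ y) (hneg : cs.geomRep (cs.wordProd c)⁻¹ y ≤ 0) :
    ∃ a < c.length, y = cs.cyclicRoot hn a := by
  by_contra hcon
  push Not at hcon
  have key : ∀ j ≤ c.length, 0 ≤ cs.geomRep (cs.prefixElement c j)⁻¹ y := by
    intro j hj
    induction j with
    | zero => rwa [prefixElement_zero, inv_one, geomRep_one]
    | succ j ih =>
      rw [prefixElement_succ _ hn, mul_inv_rev, inv_simple, geomRep_mul]
      refine geomRep_simple_nonneg (geomRep_mem _ hy) (ih (by omega)) fun h => hcon j (by omega) ?_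
      rw [cyclicRoot, ← h, geomRep_apply_inv_self]
  have := key _ le_rfl
  rw [prefixElement_length _ hn] at this
  exact not_nonpos_of_nonneg (geomRep_mem _ hy) this hneg

/-- The positions of `c^∞` that belong to the `c`-sorting word of the longest element. -/
def IsSortingPosition (hn : 0 < c.length) (k : ℕ) : Prop :=
  ∀ r, r * c.length ≤ k → 0 ≤ cs.cyclicRoot hn (k - r * c.length)

variable {cs}

theorem IsSortingPosition.nonneg {hn : 0 < c.length} {k : ℕ} (h : cs.IsSortingPosition hn k) :
    0 ≤ cs.cyclicRoot hn k := by
  simpa using h 0 (by simp)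

theorem IsSortingPosition.sub_length {hn : 0 < c.length} {k : ℕ} (h : cs.IsSortingPosition hn k)
    (hk : c.length ≤ k) : cs.IsSortingPosition hn (k - c.length) := by
  intro r hr
  have := h (r + 1) (by rw [add_mul]; omega)
  rwa [add_mul, one_mul, add_comm, ← Nat.sub_sub] at this

theorem isSortingPosition_of_lt (hc : IsCoxeterWord c) (hn : 0 < c.length) {k : ℕ}
    (hk : k < c.length) : cs.IsSortingPosition hn k := by
  intro r _
  exact cs.cyclicRoot_nonneg_of_lt hc hn (by omega)

/-- When a root first turns negative along its `c`-orbit, its negative is positive and is made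
negative by `c⁻¹`, so it is one of the first `n` roots. From then on apply `c` to both. -/
theorem exists_cyclicRoot_eq_neg (hc : IsCoxeterWord c) {hn : 0 < c.length} {k : ℕ}
    (hk : ¬ cs.IsSortingPosition hn k) :
    ∃ j, j / c.length ≤ k / c.length ∧ cs.cyclicRoot hn k = - cs.cyclicRoot hn j := by
  induction k using Nat.strong_induction_on with
  | _ k ih =>
    have hnk : c.length ≤ k := by
      by_contra h
      exact hk (isSortingPosition_of_lt hc hn (not_le.1 h))
    have hstep : cs.cyclicRoot hn k =
        cs.geomRep (cs.wordProd c) (cs.cyclicRoot hn (k - c.length)) := by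
      rw [← cyclicRoot_add_length, Nat.sub_add_cancel hnk]
    have hdiv : (k - c.length) / c.length + 1 = k / c.length := by
      rw [← Nat.add_div_right _ hn, Nat.sub_add_cancel hnk]
    by_cases hk' : cs.IsSortingPosition hn (k - c.length)
    · have hneg : cs.cyclicRoot hn k ≤ 0 := by
        refine (nonneg_or_nonpos_of_mem_rootSet (cs.cyclicRoot_mem hn k)).resolve_left fun h => hk ?_
        intro r hr
        rcases Nat.eq_zero_or_pos r with rfl | hr0
        · simpa using h
        · obtain ⟨r, rfl⟩ := Nat.exists_eq_add_one_of_ne_zero hr0.ne'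
          rw [add_mul, one_mul] at hr ⊢
          have := hk' r (by omega)
          rwa [Nat.sub_sub, add_comm] at this
      obtain ⟨a, ha, hka⟩ := cs.exists_eq_cyclicRoot_of_nonpos hn
        (neg_mem_rootSet (cs.cyclicRoot_mem hn k)) (neg_nonneg.2 hneg) (by
          rw [hstep, map_neg, geomRep_inv_apply_self]
          exact neg_nonpos.2 hk'.nonneg)
      exact ⟨a, by rw [Nat.div_eq_of_lt ha]; exact Nat.zero_le _, by rw [← hka, neg_neg]⟩
    · obtain ⟨j, hj, hj'⟩ := ih (k - c.length) (by omega) hk'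
      refine ⟨j + c.length, ?_, ?_⟩
      · rw [Nat.add_div_right _ hn]
        omega
      · rw [hstep, hj', map_neg, cyclicRoot_add_length]

theorem cyclicRoot_eq_pow (hn : 0 < c.length) {k r : ℕ} (hr : r * c.length ≤ k) :
    cs.cyclicRoot hn k = cs.geomRep (cs.wordProd c ^ r) (cs.cyclicRoot hn (k - r * c.length)) := by
  rw [← cyclicRoot_add_mul, Nat.sub_add_cancel hr]

/-! ### The Euler form on the roots of `c^∞` -/

variable [Finite W]

theorem eulerForm_wordProd_pow (hc : IsCoxeterWord c) (r : ℕ) (x y : B → ℝ) :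
    cs.eulerForm c (cs.geomRep (cs.wordProd c ^ r) x) (cs.geomRep (cs.wordProd c ^ r) y) =
      cs.eulerForm c x y := by
  induction r with
  | zero => simp
  | succ r ih => rw [pow_succ', geomRep_mul, geomRep_mul, eulerForm_wordProd hc, ih]

/-- A multiple of the fundamental weight with index `i`. -/
theorem exists_fundamentalWeight (cs : CoxeterSystem M W) (i : B) :
    ∃ x : B → ℝ, ∀ j, M.simpleCoroot j x = if j = i then 1 else 0 := by
  let f : (B → ℝ) →ₗ[ℝ] (B → ℝ) := LinearMap.pi M.simpleCoroot
  have hinj : Function.Injective f := by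
    rw [injective_iff_map_eq_zero]
    intro x hx
    by_contra hne
    have h0 : cs.innerForm x = 0 := linearMap_ext_simpleRoot fun j => by
      have h1 := cs.two_mul_innerForm_simpleRoot j x
      have h2 : M.simpleCoroot j x = 0 := congrFun hx j
      rw [h2, zero_mul] at h1
      rw [LinearMap.zero_apply]
      linarith
    have := cs.innerForm_pos hne
    rw [h0] at this
    exact lt_irrefl _ this
  obtain ⟨x, hx⟩ := LinearMap.injective_iff_surjective.1 hinj (simpleRoot i)
  refine ⟨x, fun j => ?_⟩
  have : M.simpleCoroot j x = simpleRoot i j := congrFun hx j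
  rw [this, simpleRoot, Pi.single_apply]

/-- The root is `x - c x` for a multiple `x` of the fundamental weight of its letter, so `E` pairs
it with `y` as `⟨x, y⟩`, which reads off one coefficient. -/
theorem eulerForm_cyclicRoot_of_lt (hc : IsCoxeterWord c) (hn : 0 < c.length) {a : ℕ}
    (ha : a < c.length) (y : B → ℝ) :
    cs.eulerForm c (cs.cyclicRoot hn a) y =
      cs.innerForm (simpleRoot (cyclicLetter c hn a)) (simpleRoot (cyclicLetter c hn a)) / 2 *
        y (cyclicLetter c hn a) := by
  set i := cyclicLetter c hn a with hi
  have hia : i = getElem c a ha := by simp only [hi, cyclicLetter, Nat.mod_eq_of_lt ha]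
  obtain ⟨x, hx⟩ := cs.exists_fundamentalWeight i
  have hfix (l : List B) (hl : i ∉ l) : cs.geomRep (cs.wordProd l) x = x := by
    induction l with
    | nil => simp
    | cons j l ih =>
      rw [List.mem_cons, not_or] at hl
      rw [wordProd_cons, geomRep_mul, ih hl.2, geomRep_simple, hx, if_neg (Ne.symm hl.1), zero_smul,
        sub_zero]
  have hsplit : c = c.take a ++ (i :: c.drop (a + 1)) := by
    rw [hia, ← List.drop_eq_getElem_cons ha, List.take_append_drop]
  have hnd : i ∉ c.take a ∧ i ∉ c.drop (a + 1) := by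
    have := hc.1
    rw [hsplit, List.nodup_append, List.nodup_cons] at this
    exact ⟨fun h => this.2.2 i h i (by simp) rfl, this.2.1.1⟩
  have hroot : cs.cyclicRoot hn a = x - cs.geomRep (cs.wordProd c) x := by
    conv_rhs => rw [hsplit]
    rw [wordProd_append, wordProd_cons, geomRep_mul, geomRep_mul, hfix _ hnd.2, geomRep_simple, hx,
      if_pos rfl, one_smul, map_sub, hfix _ hnd.1, sub_sub_cancel, cyclicRoot,
      prefixElement_of_lt _ ha]
  rw [hroot, eulerForm_sub_wordProd hc]
  have hy : y = ∑ j, y j • simpleRoot j := eq_sum_smul_simpleRoot y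
  conv_lhs => rw [hy, map_sum]
  rw [Finset.sum_eq_single i]
  · have := cs.two_mul_innerForm_simpleRoot i x
    rw [hx, if_pos rfl, one_mul] at this
    rw [map_smul, smul_eq_mul]
    linear_combination (y i / 2) * this
  · intro j _ hj
    have := cs.two_mul_innerForm_simpleRoot j x
    rw [hx, if_neg hj, zero_mul] at this
    rw [map_smul, smul_eq_mul]
    linear_combination (y j / 2) * this
  · exact fun h => absurd (Finset.mem_univ i) h

theorem eulerForm_cyclicRoot_nonneg_of_lt (hc : IsCoxeterWord c) (hn : 0 < c.length) {a : ℕ}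
    (ha : a < c.length) {y : B → ℝ} (hy : 0 ≤ y) :
    0 ≤ cs.eulerForm c (cs.cyclicRoot hn a) y := by
  rw [eulerForm_cyclicRoot_of_lt hc hn ha]
  have := cs.innerForm_pos (ne_zero_of_mem_rootSet (cs.simpleRoot_mem (cyclicLetter c hn a)))
  exact mul_nonneg (by linarith) (hy _)

theorem eulerForm_cyclicRoot_eq_zero_of_lt (hc : IsCoxeterWord c) (hn : 0 < c.length) {a b : ℕ}
    (hab : a < b) (hb : b < c.length) :
    cs.eulerForm c (cs.cyclicRoot hn b) (cs.cyclicRoot hn a) = 0 := by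
  rw [eulerForm_cyclicRoot_of_lt hc hn hb, cs.cyclicRoot_apply_of_lt hc hn hab.le hb,
    if_neg hab.ne, mul_zero]

/-- Shift both positions back by the number of full copies of `c` before `j`: the first root becomes
one of the initial `n`, and the second is still positive. -/
theorem IsSortingPosition.eulerForm_nonneg (hc : IsCoxeterWord c) {hn : 0 < c.length} {j k : ℕ}
    (h : cs.IsSortingPosition hn k) (hjk : j / c.length ≤ k / c.length) :
    0 ≤ cs.eulerForm c (cs.cyclicRoot hn j) (cs.cyclicRoot hn k) := by
  have hj : j / c.length * c.length ≤ j := Nat.div_mul_le_self _ _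
  have hk : j / c.length * c.length ≤ k :=
    (Nat.mul_le_mul_right _ hjk).trans (Nat.div_mul_le_self _ _)
  rw [cyclicRoot_eq_pow hn hj, cyclicRoot_eq_pow hn hk, eulerForm_wordProd_pow hc]
  refine eulerForm_cyclicRoot_nonneg_of_lt hc hn ?_ (h _ hk)
  have := Nat.mod_lt j hn
  have h2 := Nat.div_add_mod' j c.length
  omega

theorem eulerForm_cyclicRoot_of_div_lt (hc : IsCoxeterWord c) {hn : 0 < c.length} {j k : ℕ}
    (hk : c.length ≤ k) :
    cs.eulerForm c (cs.cyclicRoot hn k) (cs.cyclicRoot hn j) =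
      - cs.eulerForm c (cs.cyclicRoot hn j) (cs.cyclicRoot hn (k - c.length)) := by
  have := eulerForm_serre (cs := cs) hc (cs.cyclicRoot hn (k - c.length)) (cs.cyclicRoot hn j)
  rw [← cyclicRoot_add_length, Nat.sub_add_cancel hk] at this
  rw [this, neg_neg]

theorem eulerForm_cyclicRoot_of_div_eq (hc : IsCoxeterWord c) {hn : 0 < c.length} {j k : ℕ}
    (hjk : j < k) (hdiv : j / c.length = k / c.length) :
    cs.eulerForm c (cs.cyclicRoot hn k) (cs.cyclicRoot hn j) = 0 := by
  have hj : j / c.length * c.length ≤ j := Nat.div_mul_le_self _ _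
  have hk : j / c.length * c.length ≤ k := by omega
  rw [cyclicRoot_eq_pow hn hj, cyclicRoot_eq_pow hn hk, eulerForm_wordProd_pow hc]
  refine eulerForm_cyclicRoot_eq_zero_of_lt hc hn (by omega) ?_
  have := Nat.mod_lt k hn
  have h2 := Nat.div_add_mod' k c.length
  rw [← hdiv] at h2
  omega

theorem IsSortingPosition.eulerForm_nonpos (hc : IsCoxeterWord c) {hn : 0 < c.length} {j k : ℕ}
    (h : cs.IsSortingPosition hn k) (hjk : j < k) :
    cs.eulerForm c (cs.cyclicRoot hn k) (cs.cyclicRoot hn j) ≤ 0 := by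
  rcases (Nat.div_le_div_right (c := c.length) hjk.le).eq_or_lt with hdiv | hdiv
  · exact (eulerForm_cyclicRoot_of_div_eq hc hjk hdiv).le
  · have hk : c.length ≤ k := by
      by_contra hcon
      rw [Nat.div_eq_of_lt (not_le.1 hcon)] at hdiv
      exact absurd hdiv (Nat.not_lt_zero _)
    rw [eulerForm_cyclicRoot_of_div_lt hc hk, neg_nonpos]
    refine (h.sub_length hk).eulerForm_nonneg hc ?_
    have : (k - c.length) / c.length + 1 = k / c.length := by
      rw [← Nat.add_div_right _ hn, Nat.sub_add_cancel hk]
    omega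

/-- A skipped root is the negative of one at a position in the same or an earlier copy of `c`, so
the value is both nonnegative and nonpositive. -/
theorem IsSortingPosition.eulerForm_eq_zero (hc : IsCoxeterWord c) {hn : 0 < c.length} {j k : ℕ}
    (h : cs.IsSortingPosition hn k) (hj : ¬ cs.IsSortingPosition hn j)
    (hjk : j / c.length ≤ k / c.length) :
    cs.eulerForm c (cs.cyclicRoot hn j) (cs.cyclicRoot hn k) = 0 := by
  refine le_antisymm ?_ (h.eulerForm_nonneg hc hjk)
  obtain ⟨i, hij, hi⟩ := exists_cyclicRoot_eq_neg hc hj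
  rw [hi, map_neg, LinearMap.neg_apply, neg_nonpos]
  exact h.eulerForm_nonneg hc (hij.trans hjk)

/-- Skipped reflections fix the roots at later sorting positions, so leaving them out of the word
does not change those roots. -/
theorem IsSortingPosition.innerForm_eq_zero (hc : IsCoxeterWord c) {hn : 0 < c.length} {j k : ℕ}
    (h : cs.IsSortingPosition hn k) (hj : ¬ cs.IsSortingPosition hn j) (hjk : j < k) :
    cs.innerForm (cs.cyclicRoot hn j) (cs.cyclicRoot hn k) = 0 := by
  have hle := Nat.div_le_div_right (c := c.length) hjk.le
  rw [← eulerForm_add_flip hc, h.eulerForm_eq_zero hc hj hle, zero_add]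
  rcases hle.eq_or_lt with hdiv | hdiv
  · exact eulerForm_cyclicRoot_of_div_eq hc hjk hdiv
  · have hk : c.length ≤ k := by
      by_contra hcon
      rw [Nat.div_eq_of_lt (not_le.1 hcon)] at hdiv
      exact absurd hdiv (Nat.not_lt_zero _)
    rw [eulerForm_cyclicRoot_of_div_lt hc hk, neg_eq_zero]
    refine (h.sub_length hk).eulerForm_eq_zero hc hj ?_
    have : (k - c.length) / c.length + 1 = k / c.length := by
      rw [← Nat.add_div_right _ hn, Nat.sub_add_cancel hk]
    omega

/-! ### Sorting positions enumerate the positive roots -/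

theorem injOn_cyclicRoot (hc : IsCoxeterWord c) (hn : 0 < c.length) :
    Set.InjOn (cs.cyclicRoot hn) {k | cs.IsSortingPosition hn k} := by
  have key {j k : ℕ} (hk : cs.IsSortingPosition hn k) (hjk : j < k) :
      cs.cyclicRoot hn j ≠ cs.cyclicRoot hn k := by
    intro h
    have h1 := hk.eulerForm_nonpos hc hjk
    rw [h] at h1
    exact absurd h1 (not_le.2 (eulerForm_pos hc (ne_zero_of_mem_rootSet (cs.cyclicRoot_mem hn k))))
  intro j hj k hk h
  rcases lt_trichotomy j k with hjk | rfl | hjk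
  · exact absurd h (key hk hjk)
  · rfl
  · exact absurd h.symm (key hj hjk)

variable (cs) in
theorem finite_rootSet : cs.rootSet.Finite := by
  refine (Set.finite_range fun p : W × B => cs.geomRep p.1 (simpleRoot p.2)).subset ?_
  rintro _ ⟨w, i, rfl⟩
  exact ⟨(w, i), rfl⟩

theorem finite_setOf_isSortingPosition (hc : IsCoxeterWord c) (hn : 0 < c.length) :
    {k | cs.IsSortingPosition hn k}.Finite := by
  refine Set.Finite.of_finite_image (cs.finite_rootSet.subset ?_) (injOn_cyclicRoot hc hn)
  rintro _ ⟨k, -, rfl⟩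
  exact cs.cyclicRoot_mem hn k

/-- Otherwise the sum over the orbit would be a nonzero vector fixed by `c`, but `E (y - c y) y =
⟨y, y⟩` excludes fixed vectors. -/
theorem exists_not_nonneg_pow (hc : IsCoxeterWord c) {x : B → ℝ} (hx : 0 ≤ x) (hx0 : x ≠ 0) :
    ∃ j, ¬ 0 ≤ cs.geomRep ((cs.wordProd c)⁻¹ ^ j) x := by
  by_contra hcon
  push Not at hcon
  set g := (cs.wordProd c)⁻¹ with hg
  set y := ∑ j ∈ Finset.range (orderOf g), cs.geomRep (g ^ j) x with hy
  have hxy : x ≤ y := by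
    have h0 : 0 ∈ Finset.range (orderOf g) := Finset.mem_range.2 (orderOf_pos g)
    have := Finset.single_le_sum (f := fun j => cs.geomRep (g ^ j) x) (fun j _ => hcon j) h0
    simpa only [pow_zero, geomRep_one] using this
  have hfix : cs.geomRep g y = y := by
    have h1 : cs.geomRep g y = ∑ j ∈ Finset.range (orderOf g), cs.geomRep (g ^ (j + 1)) x := by
      rw [hy, map_sum]
      exact Finset.sum_congr rfl fun j _ => by rw [pow_succ', geomRep_mul]
    have h2 := Finset.sum_range_succ' (fun j => cs.geomRep (g ^ j) x) (orderOf g)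
    have h3 := Finset.sum_range_succ (fun j => cs.geomRep (g ^ j) x) (orderOf g)
    rw [h3, pow_orderOf_eq_one, pow_zero] at h2
    rw [h1]
    exact (add_right_cancel h2).symm
  have hfix' : cs.geomRep (cs.wordProd c) y = y := by
    have : cs.geomRep (cs.wordProd c) (cs.geomRep g y) = y := by
      rw [hg, geomRep_apply_inv_self]
    rwa [hfix] at this
  have hy0 : y = 0 := by
    by_contra hne
    have h1 := eulerForm_sub_wordProd (cs := cs) hc y y
    rw [hfix', sub_self, map_zero, LinearMap.zero_apply] at h1
    exact (cs.innerForm_pos hne).ne h1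
  exact hx0 (le_antisymm (hy0 ▸ hxy) hx)

/-- Apply `c⁻¹` until the root is about to turn negative. There it is one of the first `n` roots,
and the way back gives its position. -/
theorem exists_isSortingPosition_eq (hc : IsCoxeterWord c) (hn : 0 < c.length) {x : B → ℝ}
    (hx : x ∈ cs.rootSet) (hpos : 0 ≤ x) :
    ∃ k, cs.IsSortingPosition hn k ∧ cs.cyclicRoot hn k = x := by
  classical
  have hex := exists_not_nonneg_pow (cs := cs) hc hpos (ne_zero_of_mem_rootSet hx)
  have hspec := Nat.find_spec hex
  have hmin : ∀ j < Nat.find hex, 0 ≤ cs.geomRep ((cs.wordProd c)⁻¹ ^ j) x :=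
    fun j hj => not_not.1 (Nat.find_min hex hj)
  obtain ⟨m, hm⟩ : ∃ m, Nat.find hex = m + 1 := by
    refine Nat.exists_eq_add_one_of_ne_zero fun h => ?_
    rw [h, pow_zero, geomRep_one] at hspec
    exact hspec hpos
  rw [hm] at hspec hmin
  obtain ⟨a, ha, hxa⟩ := cs.exists_eq_cyclicRoot_of_nonpos hn
    (geomRep_mem ((cs.wordProd c)⁻¹ ^ m) hx) (hmin m (Nat.lt_succ_self m)) (by
      rw [← geomRep_mul, ← pow_succ']
      exact (nonneg_or_nonpos_of_mem_rootSet (geomRep_mem _ hx)).resolve_left hspec)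
  have hroot (r : ℕ) (hr : r ≤ m) :
      cs.cyclicRoot hn (a + r * c.length) = cs.geomRep ((cs.wordProd c)⁻¹ ^ (m - r)) x := by
    rw [cyclicRoot_add_mul, ← hxa, ← geomRep_mul]
    congr 2
    obtain ⟨s, rfl⟩ := Nat.exists_eq_add_of_le hr
    rw [Nat.add_sub_cancel_left, pow_add, ← mul_assoc, inv_pow, mul_inv_cancel, one_mul]
  refine ⟨a + m * c.length, fun r hr => ?_, ?_⟩
  · have hrm : r ≤ m := by
      by_contra hcon
      have : (m + 1) * c.length ≤ r * c.length := Nat.mul_le_mul_right _ (by omega)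
      rw [add_mul] at this
      omega
    have : a + m * c.length - r * c.length = a + (m - r) * c.length := by
      rw [Nat.sub_mul, Nat.add_sub_assoc (Nat.mul_le_mul_right _ hrm)]
    rw [this, hroot _ (Nat.sub_le _ _)]
    exact hmin _ (by omega)
  · rw [hroot m le_rfl, Nat.sub_self, pow_zero, geomRep_one]

end CoxeterSystem

/-! ### The sorting word of the longest element -/

namespace CoxeterSystem

section Words

variable {B W : Type*} [Group W] {M : CoxeterMatrix B} {cs : CoxeterSystem M W} {c : List B}

theorem isReduced_append_singleton {ω : List B} {i : B} (hω : cs.IsReduced ω)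
    (h : ¬ cs.IsRightDescent (cs.wordProd ω) i) : cs.IsReduced (ω ++ [i]) := by
  rw [IsReduced, wordProd_append, wordProd_singleton, cs.not_isRightDescent_iff.1 h, hω,
    List.length_append, List.length_singleton]

theorem leftInvSeq_append_singleton (ω : List B) (i : B) :
    cs.leftInvSeq (ω ++ [i]) =
      cs.leftInvSeq ω ++ [cs.wordProd ω * cs.simple i * (cs.wordProd ω)⁻¹] := by
  rw [← List.concat_eq_append, leftInvSeq_concat, List.concat_eq_append]

theorem eq_map_of_isReducedSubword (hn : 0 < c.length) {w : W} {f : Fin (cs.length w) → ℕ}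
    {ω : List B} (h : cs.IsReducedSubword c w f ω) : ω = (List.ofFn f).map (cyclicLetter c hn) := by
  have h1 := h.2.1
  have h2 : List.ofFn (fun j => infiniteLetter c (f j)) =
      ((List.ofFn f).map (cyclicLetter c hn)).map some := by
    rw [List.map_map, List.map_ofFn]
    congr 1
    funext j
    exact infiniteLetter_eq_some hn _
  rw [h2] at h1
  exact List.map_injective_iff.2 (Option.some_injective _) h1

end Words

variable {B W : Type*} [Group W] {M : CoxeterMatrix B} (cs : CoxeterSystem M W)
  [Fintype B] [DecidableEq B] {c : List B}

open scoped Classical in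
/-- The sorting positions before position `k`. -/
noncomputable def sortingPositions (hn : 0 < c.length) (k : ℕ) : List ℕ :=
  (List.range k).filter fun j => cs.IsSortingPosition hn j

/-- The reflection at position `k` of `c^∞`. -/
def cyclicReflection (hn : 0 < c.length) (k : ℕ) : W :=
  cs.prefixElement c k * cs.simple (cyclicLetter c hn k) * (cs.prefixElement c k)⁻¹

/-- The letters of `c^∞` at the sorting positions before position `k`. -/
noncomputable def sortedPrefix (hn : 0 < c.length) (k : ℕ) : List B :=
  (cs.sortingPositions hn k).map (cyclicLetter c hn)

variable {cs}

theorem mem_sortingPositions {hn : 0 < c.length} {j k : ℕ} :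
    j ∈ cs.sortingPositions hn k ↔ j < k ∧ cs.IsSortingPosition hn j := by
  simp [sortingPositions]

variable (cs) in
theorem sortedLT_sortingPositions (hn : 0 < c.length) (k : ℕ) :
    (cs.sortingPositions hn k).SortedLT :=
  (List.pairwise_lt_range.filter _).sortedLT

theorem sortingPositions_succ_of_pos {hn : 0 < c.length} {k : ℕ}
    (h : cs.IsSortingPosition hn k) :
    cs.sortingPositions hn (k + 1) = cs.sortingPositions hn k ++ [k] := by
  simp [sortingPositions, List.range_succ, h]

theorem sortingPositions_succ_of_neg {hn : 0 < c.length} {k : ℕ}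
    (h : ¬ cs.IsSortingPosition hn k) :
    cs.sortingPositions hn (k + 1) = cs.sortingPositions hn k := by
  simp [sortingPositions, List.range_succ, h]

theorem sortedPrefix_succ_of_pos {hn : 0 < c.length} {k : ℕ} (h : cs.IsSortingPosition hn k) :
    cs.sortedPrefix hn (k + 1) = cs.sortedPrefix hn k ++ [cyclicLetter c hn k] := by
  rw [sortedPrefix, sortingPositions_succ_of_pos h, List.map_append, List.map_singleton,
    sortedPrefix]

theorem sortedPrefix_succ_of_neg {hn : 0 < c.length} {k : ℕ} (h : ¬ cs.IsSortingPosition hn k) :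
    cs.sortedPrefix hn (k + 1) = cs.sortedPrefix hn k := by
  rw [sortedPrefix, sortingPositions_succ_of_neg h, sortedPrefix]

theorem sortingPositions_eq_of_le {hn : 0 < c.length} {K k : ℕ}
    (hK : ∀ j, cs.IsSortingPosition hn j → j < K) (hk : K ≤ k) :
    cs.sortingPositions hn k = cs.sortingPositions hn K := by
  refine (cs.sortedLT_sortingPositions hn k).eq_of_mem_iff (cs.sortedLT_sortingPositions hn K)
    fun j => ?_
  rw [mem_sortingPositions, mem_sortingPositions]
  exact ⟨fun h => ⟨hK j h.2, h.2⟩, fun h => ⟨h.1.trans_le hk, h.2⟩⟩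

variable [Finite W]

variable (cs) in
theorem isNormal_cyclicReflection (hn : 0 < c.length) (k : ℕ) :
    cs.IsNormal (cs.cyclicReflection hn k) (cs.cyclicRoot hn k) :=
  cs.isNormal_geomRep _ _

theorem geomRep_sortedPrefix_inv {hn : 0 < c.length} {k : ℕ} {y : B → ℝ}
    (h : ∀ j < k, ¬ cs.IsSortingPosition hn j → cs.innerForm (cs.cyclicRoot hn j) y = 0) :
    cs.geomRep (cs.wordProd (cs.sortedPrefix hn k))⁻¹ y =
      cs.geomRep (cs.prefixElement c k)⁻¹ y := by
  induction k with
  | zero => simp [sortedPrefix, sortingPositions, prefixElement_zero]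
  | succ k ih =>
    have ih' := ih fun j hj => h j (by omega)
    rw [prefixElement_succ _ hn, mul_inv_rev, inv_simple, geomRep_mul, ← ih']
    by_cases hk : cs.IsSortingPosition hn k
    · rw [sortedPrefix_succ_of_pos hk, wordProd_append, wordProd_singleton, mul_inv_rev, inv_simple,
        geomRep_mul]
    · have h0 := h k (by omega) hk
      rw [cyclicRoot, innerForm_geomRep_left, innerForm_comm, ← ih'] at h0
      rw [sortedPrefix_succ_of_neg hk, (cs.isNormal_simple _).2, h0, mul_zero, zero_div, zero_smul,
        sub_zero]

theorem IsSortingPosition.geomRep_sortedPrefix (hc : IsCoxeterWord c) {hn : 0 < c.length} {k : ℕ}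
    (h : cs.IsSortingPosition hn k) :
    cs.geomRep (cs.wordProd (cs.sortedPrefix hn k)) (simpleRoot (cyclicLetter c hn k)) =
      cs.cyclicRoot hn k := by
  have h1 := geomRep_sortedPrefix_inv (k := k) fun j hj hj' => h.innerForm_eq_zero hc hj' hj
  conv_rhs at h1 => rw [cyclicRoot, geomRep_inv_apply_self]
  rw [← h1, geomRep_apply_inv_self]

theorem isReduced_sortedPrefix (hc : IsCoxeterWord c) (hn : 0 < c.length) (k : ℕ) :
    cs.IsReduced (cs.sortedPrefix hn k) := by
  induction k with
  | zero => simp [sortedPrefix, sortingPositions, IsReduced]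
  | succ k ih =>
    by_cases hk : cs.IsSortingPosition hn k
    · rw [sortedPrefix_succ_of_pos hk]
      refine isReduced_append_singleton ih ?_
      rw [not_isRightDescent_iff_nonneg, hk.geomRep_sortedPrefix hc]
      exact hk.nonneg
    · rwa [sortedPrefix_succ_of_neg hk]

theorem leftInvSeq_sortedPrefix (hc : IsCoxeterWord c) (hn : 0 < c.length) (k : ℕ) :
    cs.leftInvSeq (cs.sortedPrefix hn k) =
      (cs.sortingPositions hn k).map (cs.cyclicReflection hn) := by
  induction k with
  | zero => simp [sortedPrefix, sortingPositions]
  | succ k ih =>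
    by_cases hk : cs.IsSortingPosition hn k
    · rw [sortedPrefix_succ_of_pos hk, leftInvSeq_append_singleton, sortingPositions_succ_of_pos hk,
        List.map_append, ih, List.map_singleton]
      congr 2
      have h1 := cs.isNormal_geomRep (cs.wordProd (cs.sortedPrefix hn k)) (cyclicLetter c hn k)
      rw [hk.geomRep_sortedPrefix hc] at h1
      exact h1.eq (cs.isNormal_cyclicReflection hn k)
    · rw [sortedPrefix_succ_of_neg hk, sortingPositions_succ_of_neg hk, ih]

/-- Otherwise the root added by the letter is positive, hence sits at a sorting position `l`. For `l
< k` a reflection repeats in the inversion sequence of a reduced word; for `l > k` the roots at `k`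
and `l` coincide although they are orthogonal. -/
theorem isRightDescent_sortedPrefix (hc : IsCoxeterWord c) {hn : 0 < c.length} {k : ℕ}
    (hk : ¬ cs.IsSortingPosition hn k) :
    cs.IsRightDescent (cs.wordProd (cs.sortedPrefix hn k)) (cyclicLetter c hn k) := by
  by_contra hcon
  have hnormal := cs.isNormal_geomRep (cs.wordProd (cs.sortedPrefix hn k)) (cyclicLetter c hn k)
  obtain ⟨l, hl, hly⟩ := exists_isSortingPosition_eq hc hn
    (cs.geomRep_simpleRoot_mem (cs.wordProd (cs.sortedPrefix hn k)) (cyclicLetter c hn k))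
    (cs.not_isRightDescent_iff_nonneg.1 hcon)
  rcases lt_trichotomy l k with hlk | rfl | hkl
  · have hnd :=
      (isReduced_append_singleton (isReduced_sortedPrefix hc hn k) hcon).nodup_leftInvSeq
    rw [leftInvSeq_append_singleton, List.nodup_append] at hnd
    refine hnd.2.2 _ ?_ _ (List.mem_singleton_self _) rfl
    rw [leftInvSeq_sortedPrefix hc, List.mem_map]
    refine ⟨l, mem_sortingPositions.2 ⟨hlk, hl⟩, ?_⟩
    rw [← hly] at hnormal
    exact (cs.isNormal_cyclicReflection hn l).eq hnormal
  · exact hk hl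
  · have h1 := geomRep_sortedPrefix_inv (k := k) fun j hj hj' =>
      hl.innerForm_eq_zero hc hj' (hj.trans hkl)
    conv_lhs at h1 => rw [hly, geomRep_inv_apply_self]
    have h2 : cs.cyclicRoot hn k = cs.cyclicRoot hn l := by
      rw [cyclicRoot, h1, geomRep_apply_inv_self]
    have h3 := hl.innerForm_eq_zero hc hk hkl
    rw [h2] at h3
    exact (cs.innerForm_pos (ne_zero_of_mem_rootSet (cs.cyclicRoot_mem hn l))).ne' h3

theorem wordProd_sortedPrefix (hc : IsCoxeterWord c) {hn : 0 < c.length} {K : ℕ}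
    (hK : ∀ j, cs.IsSortingPosition hn j → j < K) :
    cs.wordProd (cs.sortedPrefix hn K) = cs.longest := by
  refine cs.eq_longest_of_forall_isRightDescent fun i => ?_
  obtain ⟨a, -, rfl⟩ := exists_cyclicLetter_eq hc hn i
  -- Every letter occurs again beyond all sorting positions, where it is skipped and is thus a
  -- descent of the complete product.
  have hle : K ≤ a + K * c.length := (Nat.le_mul_of_pos_right K hn).trans (Nat.le_add_left _ _)
  have h := isRightDescent_sortedPrefix hc fun h => absurd (hK (a + K * c.length) h) (by omega)
  rwa [cyclicLetter_add_mul, sortedPrefix, sortingPositions_eq_of_le hK hle] at h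

theorem length_longest_eq (hc : IsCoxeterWord c) {hn : 0 < c.length} {K : ℕ}
    (hK : ∀ j, cs.IsSortingPosition hn j → j < K) :
    cs.length cs.longest = (cs.sortingPositions hn K).length := by
  rw [← wordProd_sortedPrefix hc hK, isReduced_sortedPrefix hc, sortedPrefix, List.length_map]

/-- At the first difference, an earlier subword would use a skipped position right after the sorted
prefix. The letter there is a descent, so the subword would not be reduced. -/
theorem sortingWord_longest (hc : IsCoxeterWord c) {hn : 0 < c.length} {K : ℕ}
    (hK : ∀ j, cs.IsSortingPosition hn j → j < K) :
    cs.sortingWord hc cs.longest = cs.sortedPrefix hn K := by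
  have hlen := length_longest_eq hc hK
  have hsorted := cs.sortedLT_sortingPositions hn K
  set L := cs.sortingPositions hn K with hL
  have hlt {i j : ℕ} (hi : i < L.length) (hj : j < L.length) : L[i] < L[j] ↔ i < j :=
    hsorted.getElem_lt_getElem_iff
  let f : Fin (cs.length cs.longest) → ℕ := fun j => L.get (j.cast hlen)
  have hfL : List.ofFn f = L := by
    apply List.ext_getElem <;> simp [f, hlen]
  have hf : cs.IsReducedSubword c cs.longest f (cs.sortedPrefix hn K) := by
    refine ⟨fun i j hij => (hlt _ _).2 hij, ?_, isReduced_sortedPrefix hc hn K,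
      wordProd_sortedPrefix hc hK⟩
    have : (fun j => infiniteLetter c (f j)) = (some ∘ cyclicLetter c hn) ∘ f :=
      funext fun j => infiniteLetter_eq_some hn _
    rw [this, ← List.map_ofFn, hfL, ← List.map_map, sortedPrefix]
  obtain ⟨f₀, hf₀, hmin⟩ := (cs.exists_isSortingWord hc cs.longest).choose_spec
  have heq : f₀ = f := by
    rcases (hmin _ _ hf).lt_or_eq with hlt' | h
    · exfalso
      obtain ⟨j, hj, hjlt⟩ := hlt'
      simp only [Pi.toLex_apply] at hj hjlt
      have hjL : (j : ℕ) < L.length := hlen ▸ j.2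
      -- A sorting position below `f j` is an earlier value `f i = f₀ i`, and `f₀` is strictly
      -- increasing.
      have hns : ¬ cs.IsSortingPosition hn (f₀ j) := by
        intro hs
        obtain ⟨i, hi, hij⟩ := List.mem_iff_getElem.1 (mem_sortingPositions.2 ⟨hK _ hs, hs⟩)
        have hlt1 : i < j := (hlt hi hjL).1 (hij.trans_lt hjlt)
        have h1 := hj ⟨i, hlen ▸ hi⟩ hlt1
        have h2 := hf₀.1 (show (⟨i, hlen ▸ hi⟩ : Fin _) < j from hlt1)
        rw [h1] at h2
        exact h2.ne hij
      have htake : cs.sortingPositions hn (f₀ j) = (List.ofFn f₀).take j := by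
        refine (cs.sortedLT_sortingPositions hn _).eq_of_mem_iff
          ((List.sortedLT_ofFn_iff.2 hf₀.1).pairwise.sublist (List.take_sublist _ _)).sortedLT
          fun x => ?_
        rw [mem_sortingPositions, List.mem_take_iff_getElem]
        constructor
        · rintro ⟨hx, hs⟩
          obtain ⟨i, hi, hix⟩ := List.mem_iff_getElem.1 (mem_sortingPositions.2 ⟨hK _ hs, hs⟩)
          have hij : i < j := (hlt hi hjL).1 (hix.trans_lt (hx.trans hjlt))
          refine ⟨i, by rw [List.length_ofFn]; omega, ?_⟩
          rw [List.getElem_ofFn, hj ⟨i, hlen ▸ hi⟩ hij]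
          exact hix
        · rintro ⟨i, hi, hix⟩
          have hij : i < j := by omega
          have hi' : i < cs.length cs.longest := hij.trans j.2
          rw [List.getElem_ofFn] at hix
          refine ⟨hix ▸ hf₀.1 hij, ?_⟩
          rw [← hix, hj ⟨i, hi'⟩ hij]
          exact (mem_sortingPositions.1 (List.getElem_mem (hlen ▸ hi'))).2
      have hred := hf₀.2.2.1.take (j + 1)
      have hword : List.take (j + 1) (cs.exists_isSortingWord hc cs.longest).choose =
          cs.sortedPrefix hn (f₀ j) ++ [cyclicLetter c hn (f₀ j)] := by
        rw [eq_map_of_isReducedSubword hn hf₀, ← List.map_take,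
          List.take_succ_eq_append_getElem (by simp), List.map_append, ← htake, List.getElem_ofFn]
        rfl
      rw [hword] at hred
      have hdesc := isRightDescent_sortedPrefix hc hns
      rw [IsRightDescent, isReduced_sortedPrefix hc hn, ← wordProd_singleton, ← wordProd_append,
        hred, List.length_append] at hdesc
      omega
    · exact toLex.injective h
  rw [sortingWord, eq_map_of_isReducedSubword hn hf₀, heq, hfL]
  rfl

end CoxeterSystem

/-! ### The sequence of roots of the powers of the longest element -/

namespace CoxeterSystem

variable {B W : Type*} [Group W] {M : CoxeterMatrix B} (cs : CoxeterSystem M W)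
  [Fintype B] [DecidableEq B] {c : List B}

/-- The roots at the sorting positions before `K`, continued antiperiodically. -/
noncomputable def signedRoot (hn : 0 < c.length) (K i : ℕ) : B → ℝ :=
  (-1 : ℝ) ^ (i / (cs.sortingPositions hn K).length) •
    cs.cyclicRoot hn ((cs.sortingPositions hn K).getD (i % (cs.sortingPositions hn K).length) 0)

/-- The roots at the first `c.length` positions of `c^∞`, moved by the Coxeter element so that
they become negative. -/
noncomputable def initialRoot (hn : 0 < c.length) (a : ℕ) : B → ℝ :=
  - cs.geomRep (cs.wordProd c)⁻¹ (cs.cyclicRoot hn a)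

variable {cs}

theorem sortingPositions_getD {hn : 0 < c.length} {K i : ℕ}
    (hi : i < (cs.sortingPositions hn K).length) :
    cs.IsSortingPosition hn ((cs.sortingPositions hn K).getD i 0) := by
  rw [List.getD_eq_getElem _ _ hi]
  exact (mem_sortingPositions.1 (List.getElem_mem hi)).2

theorem sortingPositions_getD_lt {hn : 0 < c.length} {K i j : ℕ} (hij : i < j)
    (hj : j < (cs.sortingPositions hn K).length) :
    (cs.sortingPositions hn K).getD i 0 < (cs.sortingPositions hn K).getD j 0 := by
  rw [List.getD_eq_getElem _ _ (hij.trans hj), List.getD_eq_getElem _ _ hj]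
  exact (cs.sortedLT_sortingPositions hn K).getElem_lt_getElem_iff.2 hij

theorem signedRoot_of_lt {hn : 0 < c.length} {K i : ℕ}
    (hi : i < (cs.sortingPositions hn K).length) :
    cs.signedRoot hn K i = cs.cyclicRoot hn ((cs.sortingPositions hn K).getD i 0) := by
  rw [signedRoot, Nat.div_eq_of_lt hi, Nat.mod_eq_of_lt hi, pow_zero, one_smul]

theorem exists_eq_signedRoot (hc : IsCoxeterWord c) {hn : 0 < c.length} {K : ℕ} [Finite W]
    (hK : ∀ j, cs.IsSortingPosition hn j → j < K) {x : B → ℝ} (hx : x ∈ cs.rootSet)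
    (hpos : 0 ≤ x) : ∃ i < (cs.sortingPositions hn K).length, x = cs.signedRoot hn K i := by
  obtain ⟨k, hk, rfl⟩ := exists_isSortingPosition_eq hc hn hx hpos
  obtain ⟨i, hi, rfl⟩ := List.mem_iff_getElem.1 (mem_sortingPositions.2 ⟨hK k hk, hk⟩)
  exact ⟨i, hi, by rw [signedRoot_of_lt hi, List.getD_eq_getElem _ _ hi]⟩

variable [Finite W]

/-- With `eulerForm_cyclicRoot_of_lt`, pairing with the initial roots on the right reads off the
coefficients of `y` up to positive factors. -/
theorem eulerForm_initialRoot (hc : IsCoxeterWord c) (hn : 0 < c.length) (y : B → ℝ) (b : ℕ) :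
    cs.eulerForm c y (cs.initialRoot hn b) = cs.eulerForm c (cs.cyclicRoot hn b) y := by
  rw [initialRoot, map_neg, eulerForm_serre hc, geomRep_apply_inv_self, neg_neg]

theorem eulerForm_signedRoot_nonneg (hc : IsCoxeterWord c) {hn : 0 < c.length} {K i j : ℕ}
    (hN : 0 < (cs.sortingPositions hn K).length) (hij : i ≤ j)
    (hji : j < i + (cs.sortingPositions hn K).length) :
    0 ≤ cs.eulerForm c (cs.signedRoot hn K i) (cs.signedRoot hn K j) := by
  have hi := Nat.div_add_mod' i (cs.sortingPositions hn K).length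
  have hj := Nat.div_add_mod' j (cs.sortingPositions hn K).length
  have hi' := Nat.mod_lt i hN
  have hj' := Nat.mod_lt j hN
  rw [signedRoot, signedRoot, map_smul, map_smul, LinearMap.smul_apply]
  have hle : i / (cs.sortingPositions hn K).length ≤ j / (cs.sortingPositions hn K).length :=
    Nat.div_le_div_right hij
  have hle' : j / (cs.sortingPositions hn K).length ≤
      i / (cs.sortingPositions hn K).length + 1 := by
    rw [← Nat.add_div_right _ hN]
    exact Nat.div_le_div_right hji.le
  generalize i / (cs.sortingPositions hn K).length = q at *
  generalize j / (cs.sortingPositions hn K).length = q' at *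
  have hsq : (-1 : ℝ) ^ q * (-1 : ℝ) ^ q = 1 := by rw [← mul_pow, neg_one_mul, neg_neg, one_pow]
  rw [smul_eq_mul, smul_eq_mul, ← mul_assoc]
  -- Either both indices lie in the same half-period, or `j` lies in the next one; then the extra
  -- sign turns `eulerForm_nonpos` into nonnegativity.
  rcases hle.eq_or_lt with rfl | hlt
  · rw [hsq, one_mul]
    refine (sortingPositions_getD hj').eulerForm_nonneg hc (Nat.div_le_div_right ?_)
    rcases (show i % (cs.sortingPositions hn K).length ≤
      j % (cs.sortingPositions hn K).length by omega).eq_or_lt with h | h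
    · rw [h]
    · exact (sortingPositions_getD_lt h hj').le
  · obtain rfl : q' = q + 1 := by omega
    rw [pow_succ, mul_neg_one, neg_mul, hsq, neg_one_mul]
    rw [add_mul, one_mul] at hj
    exact neg_nonneg.2 ((sortingPositions_getD hi').eulerForm_nonpos hc
      (sortingPositions_getD_lt (by omega) hi'))

theorem isSortedRootSequence (hc : IsCoxeterWord c) {hn : 0 < c.length} {K : ℕ}
    (hK : ∀ j, cs.IsSortingPosition hn j → j < K) :
    IsSortedRootSequence (cs.eulerForm c) cs.rootSet (cs.geomRep (cs.wordProd c)).toLinearMap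
      c.length (cs.sortingPositions hn K).length (cs.initialRoot hn) (cs.signedRoot hn K) where
  pos _ hx := eulerForm_pos hc hx
  ne_zero _ hx := ne_zero_of_mem_rootSet hx
  γ_mem i := by
    rw [signedRoot]
    rcases neg_one_pow_eq_or ℝ (i / (cs.sortingPositions hn K).length) with h | h
    · rw [h, one_smul]
      exact cs.cyclicRoot_mem hn _
    · rw [h, neg_one_smul]
      exact neg_mem_rootSet (cs.cyclicRoot_mem hn _)
  ρ_mem a _ := neg_mem_rootSet (geomRep_mem _ (cs.cyclicRoot_mem hn a))
  reflect x hx g hg := by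
    obtain ⟨w, i, rfl⟩ := hg
    have := (cs.isNormal_geomRep w i).reflectAlong hc x
    rw [LinearMap.BilinForm.reflectAlong] at this
    rw [this]
    exact geomRep_mem _ hx
  c_mem x hx := geomRep_mem _ hx
  serre x y := eulerForm_serre hc x y
  antiperiodic i := by
    have hN : 0 < (cs.sortingPositions hn K).length := by
      have h0 := isSortingPosition_of_lt (cs := cs) hc hn hn
      exact List.length_pos_of_mem (mem_sortingPositions.2 ⟨hK 0 h0, h0⟩)
    rw [signedRoot, signedRoot, Nat.add_div_right _ hN, Nat.add_mod_right, pow_succ, mul_neg_one,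
      neg_smul]
  nonneg i j hij hji := eulerForm_signedRoot_nonneg hc (by omega) hij hji
  cover x hx := by
    rcases nonneg_or_nonpos_of_mem_rootSet hx with h | h
    · obtain ⟨i, hi, hxi⟩ := exists_eq_signedRoot hc hK hx h
      exact ⟨i, hi, Or.inl hxi⟩
    · obtain ⟨i, hi, hxi⟩ := exists_eq_signedRoot hc hK (neg_mem_rootSet hx) (neg_nonneg.2 h)
      exact ⟨i, hi, Or.inr (by rw [← hxi, neg_neg])⟩
  coef_nonneg i hi b hb := by
    rw [eulerForm_initialRoot hc]
    refine eulerForm_cyclicRoot_nonneg_of_lt hc hn hb ?_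
    rw [signedRoot_of_lt hi]
    exact (sortingPositions_getD hi).nonneg
  ρ_triangular a ha b hba := by
    rw [initialRoot, initialRoot, map_neg, map_neg, LinearMap.neg_apply, neg_neg,
      ← eulerForm_wordProd hc, geomRep_apply_inv_self, geomRep_apply_inv_self]
    exact eulerForm_cyclicRoot_eq_zero_of_lt hc hn hba ha
  eq_zero x hx := by
    funext i
    obtain ⟨a, ha, rfl⟩ := exists_cyclicLetter_eq hc hn i
    have h := hx a ha
    rw [eulerForm_initialRoot hc, eulerForm_cyclicRoot_of_lt hc hn ha] at h
    refine (mul_eq_zero.1 h).resolve_left ?_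
    exact (half_pos (cs.innerForm_pos (ne_zero_of_mem_rootSet (cs.simpleRoot_mem _)))).ne'
  initial i hi j hj hij := by
    have hij' : cs.geomRep (cs.wordProd c) (cs.signedRoot hn K i) = - cs.signedRoot hn K j := hij
    have hpos {l : ℕ} (hl : l < (cs.sortingPositions hn K).length) : 0 ≤ cs.signedRoot hn K l := by
      rw [signedRoot_of_lt hl]
      exact (sortingPositions_getD hl).nonneg
    have hinv : cs.geomRep (cs.wordProd c)⁻¹ (cs.signedRoot hn K j) = - cs.signedRoot hn K i := by
      rw [← neg_neg (cs.signedRoot hn K j), ← hij', map_neg, geomRep_inv_apply_self]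
    obtain ⟨a, ha, hja⟩ := cs.exists_eq_cyclicRoot_of_nonpos hn
      (by rw [signedRoot_of_lt hj]; exact cs.cyclicRoot_mem hn _) (hpos hj)
      (by rw [hinv]; exact neg_nonpos.2 (hpos hi))
    exact ⟨a, ha, by rw [initialRoot, ← hja, hinv, neg_neg]⟩

end CoxeterSystem

/-! ### Facets of subword complexes as exceptional sets -/

namespace CoxeterSystem

section Words

variable {B W : Type*} [Group W] {M : CoxeterMatrix B} (cs : CoxeterSystem M W) {c : List B}

theorem leftInvSeq_append (ω ω' : List B) :
    cs.leftInvSeq (ω ++ ω') =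
      cs.leftInvSeq ω ++ (cs.leftInvSeq ω').map (MulAut.conj (cs.wordProd ω)) := by
  induction ω with
  | nil => simp
  | cons i ω ih =>
    rw [List.cons_append, leftInvSeq, leftInvSeq, ih, List.map_append, List.map_map,
      List.cons_append, wordProd_cons, map_mul]
    rfl

theorem length_complementWord_add_card (Q : List B) (F : Finset (Fin Q.length)) :
    (complementWord Q F).length + F.card = Q.length := by
  have h := List.length_eq_length_filter_add (l := List.finRange Q.length) (· ∈ F)
  have hF : ((List.finRange Q.length).filter (· ∈ F)).length = F.card := by
    rw [← List.toFinset_card_of_nodup ((List.nodup_finRange _).filter _)]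
    congr 1
    ext i
    simp
  have hF' : (List.finRange Q.length).filter (· ∉ F) =
      (List.finRange Q.length).filter fun i => !decide (i ∈ F) :=
    List.filter_congr fun i _ => decide_not
  rw [hF, List.length_finRange] at h
  rw [complementWord, List.length_map, hF']
  omega

/-- Deleting a letter amounts to multiplying by its reflection in the left inversion sequence; the
reflections collect on the left in increasing order. -/
theorem wordProd_complementWord (Q : List B) (F : Finset (Fin Q.length)) :
    cs.wordProd (complementWord Q F) =
      (((List.finRange Q.length).filter (· ∈ F)).map fun i : Fin Q.length =>
        (cs.leftInvSeq Q).getD i 1).prod * cs.wordProd Q := by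
  have key (k : ℕ) (hk : k ≤ Q.length) :
      cs.wordProd ((((List.finRange Q.length).take k).filter (· ∉ F)).map Q.get) =
        ((((List.finRange Q.length).take k).filter (· ∈ F)).map fun i : Fin Q.length =>
          (cs.leftInvSeq Q).getD i 1).prod *
            cs.wordProd (Q.take k) := by
    induction k with
    | zero => simp
    | succ k ih =>
      have ih := ih (by omega)
      rw [List.take_succ_eq_append_getElem (by simpa using hk), List.filter_append,
        List.filter_append, List.map_append, List.map_append, wordProd_append, ih, List.prod_append,
        List.take_succ_eq_append_getElem (by simpa using hk), wordProd_append, wordProd_singleton,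
        List.getElem_finRange]
      by_cases hF : (⟨k, by omega⟩ : Fin Q.length) ∈ F
      · have h1 := cs.getElem_leftInvSeq Q k (by omega)
        rw [← List.getD_eq_getElem _ 1] at h1
        simp only [Fin.cast_mk, hF, not_true, decide_false, decide_true, List.filter_cons_of_pos,
          List.filter_nil, List.map_cons, List.map_nil, List.prod_singleton, h1,
          List.filter_cons_of_neg, Bool.false_eq_true, not_false_eq_true, wordProd_nil, mul_one]
        group
        rw [mul_assoc _ (cs.simple _) (cs.simple _), simple_mul_simple_self, mul_one]
      · simp [hF, mul_assoc]
  have := key Q.length le_rfl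
  rwa [List.take_of_length_le (by simp), List.take_length] at this

variable {cs}

theorem isReduced_sortingWord (hc : IsCoxeterWord c) (w : W) :
    cs.IsReduced (cs.sortingWord hc w) := by
  obtain ⟨f, hf, -⟩ := (cs.exists_isSortingWord hc w).choose_spec
  exact hf.2.2.1

theorem wordProd_sortingWord (hc : IsCoxeterWord c) (w : W) :
    cs.wordProd (cs.sortingWord hc w) = w := by
  obtain ⟨f, hf, -⟩ := (cs.exists_isSortingWord hc w).choose_spec
  exact hf.2.2.2

theorem longestPowWord_succ [Finite W] (hc : IsCoxeterWord c) (m : ℕ) :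
    cs.longestPowWord hc (m + 1) = cs.longestPowWord hc m ++
      if Even m then cs.sortingWord hc cs.longest
      else (cs.sortingWord hc cs.longest).map cs.conjLongest := by
  rw [longestPowWord, List.range_succ, List.flatMap_append, List.flatMap_singleton, longestPowWord]

theorem length_longestPowWord [Finite W] (hc : IsCoxeterWord c) (m : ℕ) :
    (cs.longestPowWord hc m).length = m * cs.length cs.longest := by
  have hq : (cs.sortingWord hc cs.longest).length = cs.length cs.longest := by
    rw [← isReduced_sortingWord hc, wordProd_sortingWord]
  induction m with
  | zero => simp [longestPowWord]
  | succ m ih =>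
    rw [longestPowWord_succ, List.length_append, ih, add_mul, one_mul]
    split_ifs
    · rw [hq]
    · rw [List.length_map, hq]

end Words

variable {B W : Type*} [Group W] {M : CoxeterMatrix B} {cs : CoxeterSystem M W}
  [Fintype B] [DecidableEq B] [Finite W] {c : List B}

theorem IsCoxeterWord.length_eq_card (hc : IsCoxeterWord c) : c.length = Fintype.card B := by
  rw [← List.toFinset_card_of_nodup hc.1, ← Finset.card_univ]
  congr 1
  ext i
  simp [hc.2 i]

/-- Both directions compare the product of reflections with `c` through `E (x - c x) y = E x y + E y
x`, an identity that the product satisfies on its own normal vectors exactly in the triangular case.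
-/
theorem prod_eq_inv_iff_isExceptional (hc : IsCoxeterWord c) {k : ℕ} {t : Fin k → W}
    {β : Fin k → B → ℝ} (h : ∀ i, cs.IsNormal (t i) (β i)) {F : Finset (Fin k)}
    (hF : F.card = c.length) :
    (((List.finRange k).filter (· ∈ F)).map t).prod = (cs.wordProd c)⁻¹ ↔
      IsExceptional (cs.eulerForm c) β ⊤ F := by
  set l := (List.finRange k).filter (· ∈ F) with hl
  have hmem (i : Fin k) : i ∈ l ↔ i ∈ F := by simp [hl]
  have hfr : Module.finrank ℝ (B → ℝ) = c.length := by
    rw [Module.finrank_fintype_fun_eq_card, hc.length_eq_card]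
  have hlen : l.length = F.card := by
    rw [← List.toFinset_card_of_nodup ((List.nodup_finRange _).filter _)]
    congr 1
    ext i
    simp
  have hlt : l.Pairwise (· < ·) := (List.pairwise_lt_finRange k).filter _
  have hfold := foldl_reflectAlong hc l (fun i _ => h i)
  have hpos (i : Fin k) : cs.eulerForm c (β i) (β i) ≠ 0 := (eulerForm_pos hc (h i).1).ne'
  constructor
  · intro hprod
    have hpw := LinearMap.BilinForm.pairwise_of_foldl_reflectAlong (cs.eulerForm c)
      (fun x hx => eulerForm_pos hc hx) (l := l.map β) (by rw [List.length_map, hlen, hF, hfr])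
      (by
        intro g hg
        obtain ⟨i, -, rfl⟩ := List.mem_map.1 hg
        exact (h i).1)
      (d := (cs.geomRep (cs.wordProd c)).toLinearMap)
      (fun x => by rw [hfold, hprod, inv_inv]; rfl)
      (fun x y => by
        rw [eulerForm_add_flip hc]
        exact eulerForm_sub_wordProd hc x y)
    rw [List.pairwise_map] at hpw
    refine ⟨fun _ _ => Submodule.mem_top, fun i hi j hj hij => ?_, by rw [finrank_top, hF, hfr]⟩
    obtain ⟨a, ha, rfl⟩ := List.mem_iff_getElem.1 ((hmem i).2 hi)
    obtain ⟨b, hb, rfl⟩ := List.mem_iff_getElem.1 ((hmem j).2 hj)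
    exact List.pairwise_iff_getElem.1 hpw a b ha hb (hlt.sortedLT.getElem_lt_getElem_iff.1 hij)
  · intro hexc
    have hpw : (l.map β).Pairwise fun g g' => cs.eulerForm c g' g = 0 := by
      rw [List.pairwise_map]
      exact hlt.imp_of_mem fun {i j} hi hj hij =>
        hexc.triangular i ((hmem i).1 hi) j ((hmem j).1 hj) hij
    rw [eq_inv_iff_mul_eq_one, ← inv_eq_iff_mul_eq_one]
    apply cs.geomRep_injective
    ext1 x
    rw [← hfold, ← sub_eq_zero]
    by_contra hne
    refine (eulerForm_pos (cs := cs) hc hne).ne' (hexc.eq_zero_of_forall_mem hpos (fun i hi => ?_)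
      Submodule.mem_top)
    have h1 := LinearMap.BilinForm.apply_sub_foldl_reflectAlong _ hpw (by
        intro g hg
        obtain ⟨i, -, rfl⟩ := List.mem_map.1 hg
        exact hpos i) x (List.mem_map_of_mem (f := β) ((hmem i).2 hi))
    have h2 := eulerForm_sub_wordProd (cs := cs) hc x (β i)
    rw [← eulerForm_add_flip (cs := cs) hc] at h2
    rw [map_sub, LinearMap.sub_apply] at h1 h2 ⊢
    linarith

theorem wordProd_map_conjLongest (ω : List B) :
    cs.wordProd (ω.map cs.conjLongest) = cs.longest * cs.wordProd ω * cs.longest⁻¹ := by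
  induction ω with
  | nil => simp
  | cons i ω ih => rw [List.map_cons, wordProd_cons, ih, simple_conjLongest, wordProd_cons]; group

theorem leftInvSeq_map_conjLongest (ω : List B) :
    cs.leftInvSeq (ω.map cs.conjLongest) =
      (cs.leftInvSeq ω).map (MulAut.conj cs.longest) := by
  induction ω with
  | nil => simp
  | cons i ω ih =>
    rw [List.map_cons, leftInvSeq, ih, simple_conjLongest, leftInvSeq, List.map_cons, List.map_map,
      List.map_map, MulAut.conj_apply]
    congr 2
    funext w
    simp only [Function.comp_apply, MulAut.conj_apply]
    group

theorem wordProd_longestPowWord (hc : IsCoxeterWord c) (m : ℕ) :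
    cs.wordProd (cs.longestPowWord hc m) = cs.longest ^ m := by
  induction m with
  | zero => simp [longestPowWord]
  | succ m ih =>
    rw [longestPowWord_succ, wordProd_append, ih, pow_succ]
    split_ifs
    · rw [wordProd_sortingWord]
    · rw [wordProd_map_conjLongest, wordProd_sortingWord, mul_inv_cancel_right]

theorem longest_pow (m : ℕ) : cs.longest ^ m = if Even m then 1 else cs.longest := by
  split_ifs with h
  · obtain ⟨r, rfl⟩ := h
    rw [← two_mul, pow_mul, pow_two, longest_mul_longest, one_pow]
  · obtain ⟨r, rfl⟩ := Nat.not_even_iff_odd.1 h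
    rw [pow_succ, pow_mul, pow_two, longest_mul_longest, one_pow, one_mul]

/-- Conjugation by the preceding power of `w_∘` undoes the twist of the letters, so every factor
contributes the same reflections in the same order. -/
theorem leftInvSeq_longestPowWord_succ (hc : IsCoxeterWord c) (m : ℕ) :
    cs.leftInvSeq (cs.longestPowWord hc (m + 1)) = cs.leftInvSeq (cs.longestPowWord hc m) ++
      cs.leftInvSeq (cs.sortingWord hc cs.longest) := by
  rw [longestPowWord_succ, leftInvSeq_append, wordProd_longestPowWord, longest_pow]
  congr 1
  split_ifs
  · simp
  · rw [leftInvSeq_map_conjLongest, List.map_map, ← MulAut.coe_mul, ← map_mul, longest_mul_longest,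
      map_one, MulAut.coe_one, List.map_id]

theorem leftInvSeq_longestPowWord (hc : IsCoxeterWord c) {hn : 0 < c.length} {K : ℕ}
    (hK : ∀ j, cs.IsSortingPosition hn j → j < K) (m : ℕ) :
    cs.leftInvSeq (cs.longestPowWord hc m) =
      (List.range (m * (cs.sortingPositions hn K).length)).map fun i =>
        cs.cyclicReflection hn
          ((cs.sortingPositions hn K).getD (i % (cs.sortingPositions hn K).length) 0) := by
  induction m with
  | zero => simp [longestPowWord]
  | succ m ih =>
    rw [leftInvSeq_longestPowWord_succ, ih, sortingWord_longest hc hK, leftInvSeq_sortedPrefix hc,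
      add_mul, one_mul, List.range_add, List.map_append]
    congr 1
    apply List.ext_getElem
    · simp
    · intro i h1 h2
      rw [List.length_map] at h1
      simp [Nat.mod_eq_of_lt h1, List.getElem?_eq_getElem h1]

theorem isNormal_leftInvSeq_of_prefix (hc : IsCoxeterWord c) {hn : 0 < c.length} {K : ℕ}
    (hK : ∀ j, cs.IsSortingPosition hn j → j < K) {m : ℕ} {Q : List B}
    (hQ : Q <+: cs.longestPowWord hc m) {i : ℕ} (hi : i < Q.length) :
    cs.IsNormal ((cs.leftInvSeq Q).getD i 1) (cs.signedRoot hn K i) := by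
  obtain ⟨R, hR⟩ := hQ
  have h := leftInvSeq_longestPowWord hc hK m
  have hget : (cs.leftInvSeq Q).getD i 1 = (cs.leftInvSeq (Q ++ R)).getD i 1 := by
    rw [leftInvSeq_append, List.getD_append _ _ _ _ (by simpa using hi)]
  have hlt : i < m * (cs.sortingPositions hn K).length := by
    have := congrArg List.length h
    rw [← hR, length_leftInvSeq, List.length_append, List.length_map, List.length_range] at this
    omega
  rw [hget, hR, h, List.getD_eq_getElem _ _ (by simpa using hlt), List.getElem_map,
    List.getElem_range, signedRoot]
  have hnormal := cs.isNormal_cyclicReflection hn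
    ((cs.sortingPositions hn K).getD (i % (cs.sortingPositions hn K).length) 0)
  rcases neg_one_pow_eq_or ℝ (i / (cs.sortingPositions hn K).length) with h | h
  · rwa [h, one_smul]
  · rw [h, neg_one_smul]
    exact hnormal.neg

/-- Conjugation by `c⁻¹` restores the inversion sequence of `Q` itself and turns the first `n`
normals into negatives of the initial roots. Signs are immaterial for normals, which permits the
antiperiodic choice in `signedRoot`. -/
theorem isNormal_positionVector (hc : IsCoxeterWord c) {hn : 0 < c.length} {K : ℕ}
    (hK : ∀ j, cs.IsSortingPosition hn j → j < K) {m : ℕ} {Q : List B}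
    (hQ : Q <+: cs.longestPowWord hc m) {i : ℕ} (hi : i < (c ++ Q).length) :
    cs.IsNormal (MulAut.conj (cs.wordProd c)⁻¹ ((cs.leftInvSeq (c ++ Q)).getD i 1))
      (positionVector c.length (cs.initialRoot hn) (cs.signedRoot hn K) i) := by
  rw [leftInvSeq_append]
  rcases lt_or_ge i c.length with h | h
  · rw [positionVector_of_lt h, List.getD_append _ _ _ _ (by simpa using h),
      List.getD_eq_getElem _ _ (by simpa using h), getElem_leftInvSeq _ _ _ h, initialRoot,
      MulAut.conj_apply]
    have h1 := cs.isNormal_cyclicReflection hn i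
    rw [cyclicReflection, prefixElement_of_lt _ h] at h1
    have h2 : cyclicLetter c hn i = getElem c i h := by
      simp only [cyclicLetter, Nat.mod_eq_of_lt h]
    rw [h2] at h1
    exact (h1.conj _).neg
  · obtain ⟨j, rfl⟩ := Nat.exists_eq_add_of_le h
    rw [List.length_append] at hi
    have hj : j < Q.length := by omega
    have h1 := isNormal_leftInvSeq_of_prefix hc hK hQ hj
    rw [List.getD_eq_getElem _ _ (by simpa using hj)] at h1
    rw [positionVector_add, List.getD_append_right _ _ _ _ (by simp), length_leftInvSeq,
      Nat.add_sub_cancel_left, List.getD_eq_getElem _ _ (by simpa using hj), List.getElem_map,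
      ← MulAut.mul_apply, ← map_mul, inv_mul_cancel, map_one, MulAut.one_apply]
    exact h1

theorem subwordComplex_eq_exceptionalComplex (hc : IsCoxeterWord c) {hn : 0 < c.length} {K : ℕ}
    (hK : ∀ j, cs.IsSortingPosition hn j → j < K) {m : ℕ} {Q : List B}
    (hQ : Q <+: cs.longestPowWord hc m) :
    cs.subwordComplex (c ++ Q) (cs.wordProd Q) Q.length =
      exceptionalComplex (cs.eulerForm c)
        (fun i : Fin (c ++ Q).length =>
          positionVector c.length (cs.initialRoot hn) (cs.signedRoot hn K) i)
        ⊤ (c ++ Q).length := by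
  rw [subwordComplex, exceptionalComplex]
  congr 1
  ext F
  have hlen := length_complementWord_add_card (c ++ Q) F
  have happ : (c ++ Q).length = c.length + Q.length := List.length_append
  have hcard : (complementWord (c ++ Q) F).length = Q.length ↔ F.card = c.length := by omega
  have hprod : cs.wordProd (complementWord (c ++ Q) F) = cs.wordProd Q ↔
      (((List.finRange (c ++ Q).length).filter (· ∈ F)).map fun i : Fin (c ++ Q).length =>
        MulAut.conj (cs.wordProd c)⁻¹ ((cs.leftInvSeq (c ++ Q)).getD i 1)).prod =
          (cs.wordProd c)⁻¹ := by
    -- The value of `Q` cancels, leaving `c⁻¹` as the product of reflections, and conjugation by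
    -- `c⁻¹` does not change `c⁻¹`.
    rw [wordProd_complementWord, wordProd_append, ← mul_assoc, mul_eq_right, ← eq_inv_iff_mul_eq_one,
      ← Function.comp_def (MulAut.conj (cs.wordProd c)⁻¹), ← List.map_map, ← map_list_prod]
    rw [MulAut.conj_apply, inv_inv, mul_assoc, mul_eq_left, eq_inv_iff_mul_eq_one]
  rw [Set.mem_ofPred_eq, Set.mem_ofPred_eq, hcard, hprod]
  constructor
  · rintro ⟨h1, h2⟩
    exact ⟨(prod_eq_inv_iff_isExceptional hc
      (fun i => isNormal_positionVector hc hK hQ i.2) h1).1 h2, fun i _ => i.2⟩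
  · rintro ⟨h, -⟩
    have h1 : F.card = c.length := by
      rw [h.card_eq, finrank_top, Module.finrank_fintype_fun_eq_card, hc.length_eq_card]
    exact ⟨h1, (prod_eq_inv_iff_isExceptional hc
      (fun i => isNormal_positionVector hc hK hQ i.2) h1).2 h⟩

theorem exists_bound_isSortingPosition (hc : IsCoxeterWord c) (hn : 0 < c.length) :
    ∃ K, ∀ j, cs.IsSortingPosition hn j → j < K := by
  obtain ⟨K, hK⟩ := (finite_setOf_isSortingPosition (cs := cs) hc hn).bddAbove
  exact ⟨K + 1, fun j hj => Nat.lt_succ_of_le (hK hj)⟩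

theorem vertexDecomposable_subwordComplex (hc : IsCoxeterWord c) (hn : 0 < c.length) {m : ℕ}
    {Q : List B} (hQ : Q <+: cs.longestPowWord hc m) :
    (cs.subwordComplex (c ++ Q) (cs.wordProd Q) Q.length).VertexDecomposable := by
  obtain ⟨K, hK⟩ := exists_bound_isSortingPosition (cs := cs) hc hn
  have hseq := isSortedRootSequence hc hK
  rw [subwordComplex_eq_exceptionalComplex hc hK hQ]
  refine vertexDecomposable_exceptionalComplex (fun i => (hseq.positionVector_pos i).ne')
    (hseq.exchangeProperty.comp_fin _) _ le_rfl _
    -- The positions of the initial `c` form a facet: their complement spells `Q`.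
    ⟨Finset.univ.map (Fin.castLEEmb (n := c.length) (by simp)), ?_, fun i _ => i.2⟩
  have hlt (i : Fin (c ++ Q).length)
      (hi : i ∈ Finset.univ.map (Fin.castLEEmb (n := c.length) (by simp))) :
      (i : ℕ) < c.length := by
    obtain ⟨a, -, rfl⟩ := Finset.mem_map.1 hi
    exact a.2
  refine ⟨fun _ _ => Submodule.mem_top, fun i hi j hj hij => ?_, ?_⟩
  · rw [positionVector_of_lt (hlt i hi), positionVector_of_lt (hlt j hj)]
    exact hseq.ρ_triangular j (hlt j hj) i hij
  · rw [Finset.card_map, Finset.card_fin, finrank_top, Module.finrank_fintype_fun_eq_card,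
      hc.length_eq_card]

theorem isShellingOrder_subwordComplex (hc : IsCoxeterWord c) (hn : 0 < c.length) {m : ℕ}
    {Q : List B} (hQ : Q <+: cs.longestPowWord hc m) :
    (cs.subwordComplex (c ++ Q) (cs.wordProd Q) Q.length).IsShellingOrder FaceComplex.lexLT := by
  obtain ⟨K, hK⟩ := exists_bound_isSortingPosition (cs := cs) hc hn
  have hseq := isSortedRootSequence hc hK
  rw [subwordComplex_eq_exceptionalComplex hc hK hQ]
  refine FaceComplex.isShellingOrder_lexLT ?_
  rw [exceptionalComplex, FaceComplex.facets_lowerClosure_of_card fun F hF => hF.1.card_eq]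
  rintro F ⟨hF, -⟩ G ⟨hG, -⟩ v hvG hvF hiff
  obtain ⟨x, hxv, hxG, hx⟩ := hF.exchange
    (η := fun i : Fin (c ++ Q).length =>
      positionVector c.length (cs.initialRoot hn) (cs.signedRoot hn K) i)
    (fun i => (hseq.positionVector_pos i).ne')
    (hseq.exchangeProperty.comp_fin _) hG hvG hvF hiff
  exact ⟨x, hxv, hxG, hx, fun i _ => i.2⟩

end CoxeterSystem

theorem mainTheorem8 {B W : Type*} [Group W] [Finite W] {M : CoxeterMatrix B}
    (cs : CoxeterSystem M W) (c : List B) (hc : CoxeterSystem.IsCoxeterWord c) (m : ℕ) :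
    (∀ Q : List B, Q <+: cs.longestPowWord hc m →
      (cs.subwordComplex (c ++ Q) (cs.wordProd Q) Q.length).VertexDecomposable) ∧
    (cs.clusterComplex hc m).VertexDecomposable ∧
    (cs.clusterComplex hc m).IsShellingOrder FaceComplex.lexLT := by
  classical
  let : Fintype B := ⟨c.toFinset, fun i => List.mem_toFinset.2 (hc.2 i)⟩
  -- This makes the cluster complex the case in which `Q` is the whole word.
  rw [CoxeterSystem.clusterComplex, ← CoxeterSystem.wordProd_longestPowWord hc,
    ← CoxeterSystem.length_longestPowWord hc]
  rcases Nat.eq_zero_or_pos c.length with hn | hn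
  -- In rank zero all words are empty and the complex is `{∅}`; `cyclicLetter` requires a nonempty
  -- `c`.
  · have hB : IsEmpty B := ⟨fun i => by
      have := hc.2 i
      rw [List.length_eq_zero_iff.1 hn] at this
      exact List.not_mem_nil this⟩
    have hQ (Q : List B) :
        (cs.subwordComplex (c ++ Q) (cs.wordProd Q) Q.length).VertexDecomposable := by
      obtain rfl : c = [] := Subsingleton.elim _ _
      obtain rfl : Q = [] := Subsingleton.elim _ _
      have : cs.subwordComplex ([] ++ []) (cs.wordProd []) ([] : List B).length =
          LowerSet.Iic ∅ := by
        have hset : {F | (CoxeterSystem.complementWord ([] ++ [] : List B) F).length =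
            ([] : List B).length ∧ cs.wordProd (CoxeterSystem.complementWord ([] ++ []) F) =
              cs.wordProd []} = {∅} := by
          ext F
          have hF : F = ∅ := Finset.eq_empty_of_forall_notMem fun i => i.elim0
          simp [hF, CoxeterSystem.complementWord]
        rw [CoxeterSystem.subwordComplex, hset, lowerClosure_singleton]
      rw [this]
      exact .singleton_empty
    refine ⟨fun Q _ => hQ Q, hQ _, FaceComplex.isShellingOrder_lexLT ?_⟩
    intro F _ G _ v
    exact hB.elim ((c ++ cs.longestPowWord hc m).get v)
  · exact ⟨fun Q hQ => CoxeterSystem.vertexDecomposable_subwordComplex hc hn hQ,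
      CoxeterSystem.vertexDecomposable_subwordComplex hc hn (List.prefix_refl _),
      CoxeterSystem.isShellingOrder_subwordComplex hc hn (List.prefix_refl _)⟩
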